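/- **Setting.** Let $H$ be a countable abelian group, $\mu\colon H\times H\to\mathbb T$ a normalized scalar 2-cocycle and $\chi\colon H\to\mathbb T$ a character. Let $\Lambda(H)$ be the group of finitely supported functions $\lambda\colon\mathbb Z^2\to H$ with $\sum_{k}\lambda(k)=0$ (pointwise addition), with the normalized 2-cocycle $\tilde\mu(\lambda_1,\lambda_2)=\prod_{k\in\mathbb Z^2}\mu(\lambda_1(k),\lambda_2(k))$. Let $N(H,\mu)$ be the twisted group von Neumann algebra $L_{\tilde\mu}(\Lambda(H))$, i.e. the von Neumann algebra on $\ell^2(\Lambda(H))$ generated by the unitaries $u(\lambda)\colon\delta_{\kappa}\mapsto\tilde\mu(\lambda,\kappa)\,\delta_{\lambda+\kappa}$; it carries the faithful normal tracial state $\mathrm{tr}=\langle\,\cdot\,\delta_0,\delta_0\rangle$. The group $\mathbb Z^2\rtimes \mathrm{SL}(2,\mathbb Z)$ acts on $\mathbb Z^2$ by $(k,\gamma)\cdot m=k+\gamma m$ and on $\Lambda(H)$ by $(g\cdot\lambda)(m)=\lambda(g^{-1}\cdot m)$. The twisted Bernoulli shift action $\beta=\beta(H,\mu,\chi)$ is the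 action of $\mathbb Z^2\rtimes \mathrm{SL}(2,\mathbb Z)$ on $N(H,\mu)$ by $*$-automorphisms determined by $$\beta(k,\gamma)(u(\lambda))=\Big(\prod_{m\in\mathbb Z^2}\chi\big((\gamma\cdot\lambda)(m)\big)^{\det(k,m)}\Big)\,u\big((k,\gamma)\cdot\lambda\big),$$ where $\det\big((a,b),(c,d)\big)=ad-bc$. Its centralizer is the group $\mathrm{Aut}(N(H,\mu),\beta)$ of all $*$-automorphisms $\alpha$ of $N(H,\mu)$ with $\alpha\circ\beta(g)=\beta(g)\circ\alpha$ for all $g\in\mathbb Z^2\rtimes \mathrm{SL}(2,\mathbb Z)$, equipped with the topology of pointwise convergence in the $2$-norm $\|x\|_2=\mathrm{tr}(x^*x)^{1/2}$. **Corollary 5.8.** Let $q\ge 3$ be an odd natural number and $H_q=(\mathbb Z/q\mathbb Z)^2$. Define a normalized 2-cocycle $\mu_q$ and a character $\chi_q$ on $H_q$ by $$\mu_q\big((s_1,t_1),(s_2,t_2)\big)=\exp(2\pi i\, s_1t_2/q),\qquad \chi_q\big((s,t)\big)=\exp(2\pi i\, s/q).$$ Then: 1. $N(H_q,\mu_q)$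 is the approximately finite dimensional (AFD) factor of type $\mathrm{II}_1$; that is, it is a factor of type $\mathrm{II}_1$ generated by an increasing sequence of finite-dimensional $*$-subalgebras. 2. The centralizer $\mathrm{Aut}\big(N(H_q,\mu_q),\beta(H_q,\mu_q,\chi_q)\big)$ is isomorphic, as a topological group, to the discrete group $\mathbb Z/q\mathbb Z$. -/

import Mathlib

open scoped lp ENNReal Matrix MatrixGroups

noncomputable section

namespace TwistedBernoulli

/-! ### Von Neumann algebras: generation, factors, type II₁, approximate finite dimensionality -/

section VonNeumann

variable {E : Type*} [NormedAddCommGroup E] [InnerProductSpace ℂ E] [CompleteSpace E]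

/-- The von Neumann algebra generated by a set `S` of bounded operators: the double commutant of
`S ∪ S*`. -/
def vnGenerated (S : Set (E →L[ℂ] E)) : VonNeumannAlgebra E where
  toStarSubalgebra :=
    StarSubalgebra.centralizer ℂ (StarSubalgebra.centralizer ℂ S : Set (E →L[ℂ] E))
  centralizer_centralizer' := by
    change Set.centralizer (Set.centralizer
      ((StarSubalgebra.centralizer ℂ (StarSubalgebra.centralizer ℂ S : Set (E →L[ℂ] E)) :
        StarSubalgebra ℂ (E →L[ℂ] E)) : Set (E →L[ℂ] E))) =
      ((StarSubalgebra.centralizer ℂ (StarSubalgebra.centralizer ℂ S : Set (E →L[ℂ] E)) :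
        StarSubalgebra ℂ (E →L[ℂ] E)) : Set (E →L[ℂ] E))
    rw [StarSubalgebra.coe_centralizer_centralizer, Set.centralizer_centralizer_centralizer]

theorem coe_vnGenerated (S : Set (E →L[ℂ] E)) :
    (vnGenerated S : Set (E →L[ℂ] E)) = (S ∪ star S).centralizer.centralizer :=
  StarSubalgebra.coe_centralizer_centralizer ℂ S

theorem subset_vnGenerated (S : Set (E →L[ℂ] E)) {x : E →L[ℂ] E} (hx : x ∈ S) :
    x ∈ vnGenerated S := by
  rw [← SetLike.mem_coe, coe_vnGenerated]
  exact Set.subset_centralizer_centralizer (Or.inl hx)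

/-- A von Neumann algebra is a factor if it is non-zero and its centre consists of the scalars. -/
def IsFactor (N : VonNeumannAlgebra E) : Prop :=
  (1 : E →L[ℂ] E) ≠ 0 ∧ ∀ x ∈ N, x ∈ N.commutant → ∃ c : ℂ, x = c • 1

/-- A von Neumann algebra is finite if its unit is a finite projection: every isometry in it is
unitary. -/
def IsFiniteVN (N : VonNeumannAlgebra E) : Prop :=
  ∀ v ∈ N, star v * v = 1 → v * star v = 1

/-- An abelian projection of `N` is a projection `p ∈ N` such that `p N p` is commutative. -/
def IsAbelianProjection (N : VonNeumannAlgebra E) (p : E →L[ℂ] E) : Prop :=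
  p ∈ N ∧ IsStarProjection p ∧
    ∀ x ∈ N, ∀ y ∈ N, (p * x * p) * (p * y * p) = (p * y * p) * (p * x * p)

/-- A von Neumann algebra is of type II₁ if it is finite and has no non-zero abelian projection. -/
def IsTypeIIOne (N : VonNeumannAlgebra E) : Prop :=
  IsFiniteVN N ∧ ∀ p, IsAbelianProjection N p → p = 0

/-- A von Neumann algebra is approximately finite dimensional (AFD) if it is generated by an
increasing sequence of finite-dimensional `*`-subalgebras. -/
def IsAFD (N : VonNeumannAlgebra E) : Prop :=
  ∃ A : ℕ → StarSubalgebra ℂ (E →L[ℂ] E), Monotone A ∧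
    (∀ n, FiniteDimensional ℂ (A n)) ∧ N = vnGenerated (⋃ n, (A n : Set (E →L[ℂ] E)))

/-- `N` is the AFD factor of type II₁. -/
def IsAFDFactorIIOne (N : VonNeumannAlgebra E) : Prop :=
  IsFactor N ∧ IsTypeIIOne N ∧ IsAFD N

/-- If a unitary `V` conjugates the generators into the generated algebra, then it conjugates the
whole generated algebra into itself. -/
theorem conj_mem_vnGenerated (S : Set (E →L[ℂ] E)) (V : unitary (E →L[ℂ] E))
    (hV : ∀ s ∈ S, (V : E →L[ℂ] E) * s * star (V : E →L[ℂ] E) ∈ vnGenerated S)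
    {x : E →L[ℂ] E} (hx : x ∈ vnGenerated S) :
    (V : E →L[ℂ] E) * x * star (V : E →L[ℂ] E) ∈ vnGenerated S := by
  have h1 : star (V : E →L[ℂ] E) * V = 1 := Unitary.coe_star_mul_self V
  have h2 : (V : E →L[ℂ] E) * star (V : E →L[ℂ] E) = 1 := Unitary.coe_mul_star_self V
  have hT : ∀ t ∈ S ∪ star S, (V : E →L[ℂ] E) * t * star (V : E →L[ℂ] E) ∈ vnGenerated S := by
    rintro t (ht | ht)
    · exact hV t ht
    · have := star_mem (hV _ ht)
      simpa [mul_assoc] using this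
  rw [← SetLike.mem_coe, coe_vnGenerated] at hx ⊢
  intro y hy
  have hy' : star (V : E →L[ℂ] E) * y * V ∈ (S ∪ star S).centralizer := by
    intro t ht
    have h3 := hT t ht
    rw [← SetLike.mem_coe, coe_vnGenerated] at h3
    have h4 := h3 y hy
    calc t * (star (V : E →L[ℂ] E) * y * V)
        = (star (V : E →L[ℂ] E) * V) * t * (star (V : E →L[ℂ] E) * y * V) := by rw [h1, one_mul]
      _ = star (V : E →L[ℂ] E) * ((V * t * star (V : E →L[ℂ] E)) * y) * V := by
          simp only [mul_assoc]
      _ = star (V : E →L[ℂ] E) * (y * (V * t * star (V : E →L[ℂ] E))) * V := by rw [h4]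
      _ = star (V : E →L[ℂ] E) * y * V * t * (star (V : E →L[ℂ] E) * V) := by
          simp only [mul_assoc]
      _ = star (V : E →L[ℂ] E) * y * V * t := by rw [h1, mul_one]
  have h5 := hx _ hy'
  calc y * (V * x * star (V : E →L[ℂ] E))
      = (V * star (V : E →L[ℂ] E)) * y * (V * x * star (V : E →L[ℂ] E)) := by rw [h2, one_mul]
    _ = V * ((star (V : E →L[ℂ] E) * y * V) * x) * star (V : E →L[ℂ] E) := by
        simp only [mul_assoc]
    _ = V * (x * (star (V : E →L[ℂ] E) * y * V)) * star (V : E →L[ℂ] E) := by rw [h5]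
    _ = V * x * star (V : E →L[ℂ] E) * y * (V * star (V : E →L[ℂ] E)) := by
        simp only [mul_assoc]
    _ = V * x * star (V : E →L[ℂ] E) * y := by rw [h2, mul_one]

/-- The group of `*`-automorphisms of a von Neumann algebra. -/
abbrev AutVN (N : VonNeumannAlgebra E) : Type _ :=
  N.toStarSubalgebra ≃⋆ₐ[ℂ] N.toStarSubalgebra

/-- A unitary representation normalizing `N` acts on `N` by `x ↦ U x U*`. -/
def conjAction {G : Type*} [Group G] (N : VonNeumannAlgebra E) (U : G →* unitary (E →L[ℂ] E))
    (hU : ∀ g, ∀ x ∈ N, (U g : E →L[ℂ] E) * x * star (U g : E →L[ℂ] E) ∈ N) :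
    G →* AutVN N :=
  MonoidHom.mk'
    (fun g =>
      { toFun := fun x => ⟨(U g : E →L[ℂ] E) * x * star (U g : E →L[ℂ] E), hU g x x.2⟩
        invFun := fun x =>
          ⟨(U g⁻¹ : E →L[ℂ] E) * x * star (U g⁻¹ : E →L[ℂ] E), hU g⁻¹ x x.2⟩
        left_inv := fun x => by
          apply Subtype.ext
          change (U g⁻¹ : E →L[ℂ] E) * ((U g : E →L[ℂ] E) * x * star (U g : E →L[ℂ] E)) *
            star (U g⁻¹ : E →L[ℂ] E) = x
          have h : (U g⁻¹ : E →L[ℂ] E) * U g = 1 := by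
            rw [← Submonoid.coe_mul, ← map_mul, inv_mul_cancel, map_one, Submonoid.coe_one]
          calc _ = ((U g⁻¹ : E →L[ℂ] E) * U g) * x * star ((U g⁻¹ : E →L[ℂ] E) * U g) := by
                simp only [star_mul, mul_assoc]
            _ = x := by rw [h]; simp
        right_inv := fun x => by
          apply Subtype.ext
          change (U g : E →L[ℂ] E) * ((U g⁻¹ : E →L[ℂ] E) * x * star (U g⁻¹ : E →L[ℂ] E)) *
            star (U g : E →L[ℂ] E) = x
          have h : (U g : E →L[ℂ] E) * U g⁻¹ = 1 := by
            rw [← Submonoid.coe_mul, ← map_mul, mul_inv_cancel, map_one, Submonoid.coe_one]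
          calc _ = ((U g : E →L[ℂ] E) * U g⁻¹) * x * star ((U g : E →L[ℂ] E) * U g⁻¹) := by
                simp only [star_mul, mul_assoc]
            _ = x := by rw [h]; simp
        map_mul' := fun x y => by
          apply Subtype.ext
          change (U g : E →L[ℂ] E) * ((x : E →L[ℂ] E) * y) * star (U g : E →L[ℂ] E) =
            ((U g : E →L[ℂ] E) * x * star (U g : E →L[ℂ] E)) *
              ((U g : E →L[ℂ] E) * y * star (U g : E →L[ℂ] E))
          have h1 : star (U g : E →L[ℂ] E) * U g = 1 := Unitary.coe_star_mul_self (U g)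
          calc (U g : E →L[ℂ] E) * ((x : E →L[ℂ] E) * y) * star (U g : E →L[ℂ] E)
              = (U g : E →L[ℂ] E) * x * 1 * y * star (U g : E →L[ℂ] E) := by
                simp only [mul_assoc, one_mul]
            _ = _ := by rw [← h1]; simp only [mul_assoc]
        map_add' := fun x y => by
          apply Subtype.ext
          change (U g : E →L[ℂ] E) * ((x : E →L[ℂ] E) + y) * star (U g : E →L[ℂ] E) =
            (U g : E →L[ℂ] E) * x * star (U g : E →L[ℂ] E) +
              (U g : E →L[ℂ] E) * y * star (U g : E →L[ℂ] E)
          rw [mul_add, add_mul]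
        map_star' := fun x => by
          apply Subtype.ext
          change (U g : E →L[ℂ] E) * star (x : E →L[ℂ] E) * star (U g : E →L[ℂ] E) =
            star ((U g : E →L[ℂ] E) * x * star (U g : E →L[ℂ] E))
          simp only [star_mul, star_star, mul_assoc]
        map_smul' := fun c x => by
          apply Subtype.ext
          change (U g : E →L[ℂ] E) * (c • (x : E →L[ℂ] E)) * star (U g : E →L[ℂ] E) =
            c • ((U g : E →L[ℂ] E) * x * star (U g : E →L[ℂ] E))
          rw [mul_smul_comm, smul_mul_assoc] })
    (fun g h => by
      apply StarAlgEquiv.ext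
      intro x
      apply Subtype.ext
      change (U (g * h) : E →L[ℂ] E) * x * star (U (g * h) : E →L[ℂ] E) =
        (U g : E →L[ℂ] E) * ((U h : E →L[ℂ] E) * x * star (U h : E →L[ℂ] E)) *
          star (U g : E →L[ℂ] E)
      simp only [map_mul, Submonoid.coe_mul, star_mul, mul_assoc])

theorem coe_conjAction {G : Type*} [Group G] (N : VonNeumannAlgebra E)
    (U : G →* unitary (E →L[ℂ] E))
    (hU : ∀ g, ∀ x ∈ N, (U g : E →L[ℂ] E) * x * star (U g : E →L[ℂ] E) ∈ N)
    (g : G) (x : N.toStarSubalgebra) :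
    ((conjAction N U hU g x : N.toStarSubalgebra) : E →L[ℂ] E) =
      (U g : E →L[ℂ] E) * x * star (U g : E →L[ℂ] E) := rfl

end VonNeumann

/-! ### Weighted permutation unitaries on `ℓ²(X)` -/

/-- The Hilbert space `ℓ²(X)`. -/
abbrev EllTwo (X : Type*) : Type _ := lp (fun _ : X => ℂ) 2

open Classical in
/-- The basis vector `δ_x` of `ℓ²(X)`. -/
def basisVec {X : Type*} (x : X) : EllTwo X := lp.single 2 x 1

section Weighted

variable {X : Type*}

theorem memlp_weighted (e : Equiv.Perm X) (c : X → Circle) (f : EllTwo X) :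
    Memℓp (fun y => (c (e.symm y) : ℂ) * f (e.symm y)) 2 := by
  have hf := (lp.memℓp f).summable (by norm_num)
  apply memℓp_gen
  have := (e.symm.summable_iff).2 hf
  refine this.congr fun y => ?_
  simp only [Function.comp_apply, norm_mul, Circle.norm_coe, one_mul]

/-- The isometry `δ_x ↦ c(x) δ_{e(x)}` of `ℓ²(X)`. -/
def weightedIsometry (e : Equiv.Perm X) (c : X → Circle) : EllTwo X ≃ₗᵢ[ℂ] EllTwo X where
  toFun f := ⟨fun y => (c (e.symm y) : ℂ) * f (e.symm y), memlp_weighted e c f⟩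
  invFun f := ⟨fun x => (((c x)⁻¹ : Circle) : ℂ) * f (e x), by
    have h := memlp_weighted e.symm (fun y => (c (e.symm y))⁻¹) f
    simp only [Equiv.symm_symm, Equiv.symm_apply_apply] at h
    exact h⟩
  left_inv f := by ext x; simp
  right_inv f := by ext x; simp
  map_add' f g := by
    ext x
    exact mul_add _ _ _
  map_smul' a f := by
    ext x
    exact mul_left_comm _ _ _
  norm_map' f := by
    rw [lp.norm_eq_tsum_rpow (by norm_num), lp.norm_eq_tsum_rpow (by norm_num)]
    congr 1
    rw [← e.symm.tsum_eq (fun i => ‖f i‖ ^ (2 : ℝ≥0∞).toReal)]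
    refine tsum_congr fun y => ?_
    change ‖(c (e.symm y) : ℂ) * f (e.symm y)‖ ^ (2 : ℝ≥0∞).toReal = _
    rw [norm_mul, Circle.norm_coe, one_mul]

/-- The unitary `δ_x ↦ c(x) δ_{e(x)}` of `ℓ²(X)`. -/
def weightedUnitary (e : Equiv.Perm X) (c : X → Circle) : unitary (EllTwo X →L[ℂ] EllTwo X) :=
  Unitary.linearIsometryEquiv.symm (weightedIsometry e c)

theorem weightedUnitary_apply (e : Equiv.Perm X) (c : X → Circle) (f : EllTwo X) (y : X) :
    ((weightedUnitary e c : EllTwo X →L[ℂ] EllTwo X) f) y = (c (e.symm y) : ℂ) * f (e.symm y) :=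
  rfl

theorem weightedUnitary_basisVec (e : Equiv.Perm X) (c : X → Circle) (x : X) :
    (weightedUnitary e c : EllTwo X →L[ℂ] EllTwo X) (basisVec x) =
      (c x : ℂ) • basisVec (e x) := by
  classical
  ext y
  rw [weightedUnitary_apply]
  by_cases h : y = e x
  · subst h; simp [basisVec]
  · have h' : e.symm y ≠ x := fun hh => h (by rw [← hh]; simp)
    simp [basisVec, h, h']

theorem weightedUnitary_mul (e e' : Equiv.Perm X) (c c' : X → Circle) :
    weightedUnitary e c * weightedUnitary e' c' =
      weightedUnitary (e * e') (fun x => c (e' x) * c' x) := by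
  apply Subtype.ext
  ext f y
  change ((weightedUnitary e c : EllTwo X →L[ℂ] EllTwo X)
    ((weightedUnitary e' c' : EllTwo X →L[ℂ] EllTwo X) f)) y = _
  simp only [weightedUnitary_apply]
  have h : (e * e').symm y = e'.symm (e.symm y) := rfl
  simp [h, mul_assoc]

end Weighted

/-! ### Twisted group von Neumann algebras -/

/-- A normalized scalar 2-cocycle on an (additive) group. -/
structure NormalizedTwoCocycle (Γ : Type*) [AddCommGroup Γ] where
  /-- the underlying function -/
  toFun : Γ → Γ → Circle
  map_zero_left : ∀ g, toFun 0 g = 1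
  map_zero_right : ∀ g, toFun g 0 = 1
  cocycle : ∀ g h k, toFun g h * toFun (g + h) k = toFun h k * toFun g (h + k)

section TwistedGroup

variable {Γ : Type*} [AddCommGroup Γ]

/-- The unitary `u_γ : δ_g ↦ μ(γ, g) δ_{γ + g}` on `ℓ²(Γ)`. -/
def twistedTranslation (μ : NormalizedTwoCocycle Γ) (γ : Γ) :
    unitary (EllTwo Γ →L[ℂ] EllTwo Γ) :=
  weightedUnitary (Equiv.addLeft γ) (fun g => μ.toFun γ g)

/-- The twisted group von Neumann algebra `L_μ(Γ)`, generated by the unitaries `u_γ`. -/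
def twistedGroupVN (μ : NormalizedTwoCocycle Γ) : VonNeumannAlgebra (EllTwo Γ) :=
  vnGenerated (Set.range fun γ => (twistedTranslation μ γ : EllTwo Γ →L[ℂ] EllTwo Γ))

/-- The pointwise `2`-norm topology on the automorphism group of `L_μ(Γ)`: the coarsest topology
for which all the maps `α ↦ α(x)` are continuous into `L_μ(Γ)` with the `2`-norm
`‖x‖₂ = tr(x* x)^{1/2} = ‖x δ_0‖`, where `tr = ⟨· δ_0, δ_0⟩`. -/
instance autTopology (μ : NormalizedTwoCocycle Γ) : TopologicalSpace (AutVN (twistedGroupVN μ)) :=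
  TopologicalSpace.induced
    (fun α (x : (twistedGroupVN μ).toStarSubalgebra) =>
      ((α x : (twistedGroupVN μ).toStarSubalgebra) : EllTwo Γ →L[ℂ] EllTwo Γ) (basisVec 0))
    Pi.topologicalSpace

end TwistedGroup

/-! ### The group `ℤ² ⋊ SL(2, ℤ)` and its action on `ℤ²` -/

/-- The lattice `ℤ²`. -/
abbrev Lattice : Type := Fin 2 → ℤ

/-- `det((q, r), (q₀, r₀)) = q r₀ - r q₀`. -/
def latticeDet (k m : Lattice) : ℤ := k 0 * m 1 - k 1 * m 0

/-- The matrix-vector product `γ · k` for `γ ∈ SL(2, ℤ)` and `k ∈ ℤ²`. -/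
def slMulVec (γ : SL(2, ℤ)) (k : Lattice) : Lattice :=
  (γ : Matrix (Fin 2) (Fin 2) ℤ) *ᵥ k

theorem slMulVec_one (k : Lattice) : slMulVec 1 k = k := by
  rw [slMulVec, Matrix.SpecialLinearGroup.coe_one, Matrix.one_mulVec]

theorem slMulVec_mul (γ γ' : SL(2, ℤ)) (k : Lattice) :
    slMulVec (γ * γ') k = slMulVec γ (slMulVec γ' k) := by
  rw [slMulVec, slMulVec, slMulVec, Matrix.SpecialLinearGroup.coe_mul, Matrix.mulVec_mulVec]

theorem slMulVec_add (γ : SL(2, ℤ)) (k m : Lattice) :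
    slMulVec γ (k + m) = slMulVec γ k + slMulVec γ m :=
  Matrix.mulVec_add _ _ _

theorem latticeDet_sl (γ : SL(2, ℤ)) (k m : Lattice) :
    latticeDet (slMulVec γ k) (slMulVec γ m) = latticeDet k m := by
  have h := γ.2
  rw [Matrix.det_fin_two] at h
  simp only [latticeDet, slMulVec, Matrix.mulVec, dotProduct, Fin.sum_univ_two]
  linear_combination (k 0 * m 1 - k 1 * m 0) * h

/-- The action of `SL(2, ℤ)` on `ℤ²` by group automorphisms. -/
def slAction : SL(2, ℤ) →* MulAut (Multiplicative Lattice) :=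
  MonoidHom.mk'
    (fun γ =>
      { toFun := fun v => Multiplicative.ofAdd (slMulVec γ v.toAdd)
        invFun := fun v => Multiplicative.ofAdd (slMulVec γ⁻¹ v.toAdd)
        left_inv := fun v => by
          beta_reduce
          rw [toAdd_ofAdd, ← slMulVec_mul, inv_mul_cancel, slMulVec_one, ofAdd_toAdd]
        right_inv := fun v => by
          beta_reduce
          rw [toAdd_ofAdd, ← slMulVec_mul, mul_inv_cancel, slMulVec_one, ofAdd_toAdd]
        map_mul' := fun v w => by rw [toAdd_mul, slMulVec_add, ofAdd_add] })
    (fun γ γ' => by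
      apply MulEquiv.ext
      intro v
      change Multiplicative.ofAdd (slMulVec (γ * γ') v.toAdd) =
        Multiplicative.ofAdd (slMulVec γ (slMulVec γ' v.toAdd))
      rw [slMulVec_mul])

/-- The group `ℤ² ⋊ SL(2, ℤ)`. -/
abbrev AffineSL : Type := Multiplicative Lattice ⋊[slAction] SL(2, ℤ)

/-- The translation part `k` of `(k, γ)`. -/
def trans (g : AffineSL) : Lattice := g.left.toAdd

theorem trans_mul (g h : AffineSL) :
    trans (g * h) = trans g + slMulVec g.right (trans h) := rfl

/-- The action of `ℤ² ⋊ SL(2, ℤ)` on `ℤ²`: `(k, γ) · m = k + γ · m`. -/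
def affinePerm : AffineSL →* Equiv.Perm Lattice :=
  MonoidHom.mk'
    (fun g =>
      { toFun := fun m => trans g + slMulVec g.right m
        invFun := fun m => slMulVec g.right⁻¹ (m - trans g)
        left_inv := fun m => by
          beta_reduce
          rw [add_sub_cancel_left, ← slMulVec_mul, inv_mul_cancel, slMulVec_one]
        right_inv := fun m => by
          beta_reduce
          rw [← slMulVec_mul, mul_inv_cancel, slMulVec_one, add_sub_cancel] })
    (fun g h => by
      apply Equiv.ext
      intro m
      change trans (g * h) + slMulVec (g * h).right m =
        trans g + slMulVec g.right (trans h + slMulVec h.right m)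
      rw [trans_mul, SemidirectProduct.mul_right, slMulVec_mul, slMulVec_add, add_assoc])

theorem affinePerm_apply (g : AffineSL) (m : Lattice) :
    affinePerm g m = trans g + slMulVec g.right m := rfl

theorem affinePerm_inr (γ : SL(2, ℤ)) (m : Lattice) :
    affinePerm (SemidirectProduct.inr γ) m = slMulVec γ m :=
  zero_add _

/-! ### The group `Λ(H)` and the algebra `N(H, μ)` -/

section Bernoulli

variable {H : Type*} [AddCommGroup H]

variable (H) in
/-- `Λ(H)`: the finitely supported functions `ℤ² → H` whose values sum to zero. -/
def LambdaGroup : AddSubgroup (Lattice →₀ H) where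
  carrier := {l | ∑ᶠ k, l k = 0}
  zero_mem' := by simp
  add_mem' := by
    intro a b ha hb
    simp only [Set.mem_ofPred_eq, Finsupp.coe_add, Pi.add_apply] at *
    rw [finsum_add_distrib a.hasFiniteSupport b.hasFiniteSupport, ha, hb, add_zero]
  neg_mem' := by
    intro a ha
    simp only [Set.mem_ofPred_eq, Finsupp.coe_neg, Pi.neg_apply] at *
    rw [finsum_neg_distrib, ha, neg_zero]

/-- The permutation action on `Λ(H)`: `(e · l)(k) = l(e⁻¹ k)`. -/
def permute : Equiv.Perm Lattice →* Equiv.Perm (LambdaGroup H) :=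
  MonoidHom.mk'
    (fun e =>
      { toFun := fun l => ⟨Finsupp.equivMapDomain e l, by
          have h : ∑ᶠ k, (l : Lattice →₀ H) k = 0 := l.2
          change ∑ᶠ k, (l : Lattice →₀ H) (e.symm k) = 0
          rw [← h]
          exact finsum_comp_equiv e.symm⟩
        invFun := fun l => ⟨Finsupp.equivMapDomain e.symm l, by
          have h : ∑ᶠ k, (l : Lattice →₀ H) k = 0 := l.2
          change ∑ᶠ k, (l : Lattice →₀ H) (e k) = 0
          rw [← h]
          exact finsum_comp_equiv e⟩
        left_inv := fun l => by
          apply Subtype.ext; apply Finsupp.ext; intro k; simp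
        right_inv := fun l => by
          apply Subtype.ext; apply Finsupp.ext; intro k; simp })
    (fun e e' => by
      apply Equiv.ext
      intro l
      apply Subtype.ext
      apply Finsupp.ext
      intro k
      rfl)

theorem permute_apply (e : Equiv.Perm Lattice) (l : LambdaGroup H) (k : Lattice) :
    (permute e l : Lattice →₀ H) k = (l : Lattice →₀ H) (e.symm k) := rfl

theorem permute_add (e : Equiv.Perm Lattice) (l l' : LambdaGroup H) :
    permute e (l + l') = permute e l + permute e l' := by
  apply Subtype.ext; apply Finsupp.ext; intro k; rfl

theorem finite_mulSupport_left (f : Lattice → H → Circle) (hf : ∀ k, f k 0 = 1)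
    (l : Lattice →₀ H) : (fun k => f k (l k)).HasFiniteMulSupport := by
  refine Set.Finite.subset l.hasFiniteSupport fun k hk => ?_
  rw [Function.mem_support]
  intro h
  exact hk (by simp [h, hf])

/-- The cocycle `μ̃(l₁, l₂) = ∏_{k ∈ ℤ²} μ(l₁(k), l₂(k))` on `Λ(H)`. -/
def cocycleTilde (μ : NormalizedTwoCocycle H) : NormalizedTwoCocycle (LambdaGroup H) where
  toFun l₁ l₂ := ∏ᶠ k, μ.toFun ((l₁ : Lattice →₀ H) k) ((l₂ : Lattice →₀ H) k)
  map_zero_left l := by simp [μ.map_zero_left]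
  map_zero_right l := by simp [μ.map_zero_right]
  cocycle a b c := by
    have hl : ∀ (x : Lattice →₀ H) (y : Lattice → H),
        (fun k => μ.toFun (x k) (y k)).HasFiniteMulSupport := fun x y =>
      finite_mulSupport_left (fun k h => μ.toFun h (y k)) (fun k => μ.map_zero_left _) x
    rw [← finprod_mul_distrib (hl a b) (hl (a + b : LambdaGroup H) c),
      ← finprod_mul_distrib (hl b c) (hl a (b + c : LambdaGroup H))]
    exact finprod_congr fun k => μ.cocycle _ _ _

/-- The algebra `N(H, μ) = L_{μ̃}(Λ(H))`. -/
def bernoulliVN (μ : NormalizedTwoCocycle H) : VonNeumannAlgebra (EllTwo (LambdaGroup H)) :=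
  twistedGroupVN (cocycleTilde μ)

instance bernoulliAutTopology (μ : NormalizedTwoCocycle H) :
    TopologicalSpace (AutVN (bernoulliVN μ)) :=
  autTopology (cocycleTilde μ)

theorem cocycleTilde_permute (μ : NormalizedTwoCocycle H) (e : Equiv.Perm Lattice)
    (a b : LambdaGroup H) :
    (cocycleTilde μ).toFun (permute e a) (permute e b) = (cocycleTilde μ).toFun a b :=
  finprod_comp_equiv (f := fun k => μ.toFun ((a : Lattice →₀ H) k) ((b : Lattice →₀ H) k)) e.symm

/-! ### The twisted Bernoulli shift action `β(H, μ, χ)` -/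

/-- The scalar `∏_{m ∈ ℤ²} χ(l(m))^{det(k, m)}`. -/
def shiftPhase (χ : AddChar H Circle) (k : Lattice) (l : LambdaGroup H) : Circle :=
  ∏ᶠ m, χ ((l : Lattice →₀ H) m) ^ latticeDet k m

/-- The scalar occurring when `(k, γ)` is applied to `u(l)`:
`∏_{m ∈ ℤ²} χ((γ · l)(m))^{det(k, m)}`. -/
def actionPhase (χ : AddChar H Circle) (g : AffineSL) (l : LambdaGroup H) : Circle :=
  shiftPhase χ (trans g) (permute (affinePerm (SemidirectProduct.inr g.right)) l)

theorem finite_mulSupport_char (χ : AddChar H Circle) (w : Lattice → ℤ) (l : Lattice →₀ H) :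
    (fun m => χ (l m) ^ w m).HasFiniteMulSupport :=
  finite_mulSupport_left (fun m h => χ h ^ w m) (fun m => by simp) l

theorem finprod_char_zpow_eq_one (χ : AddChar H Circle) (c : ℤ) (l : LambdaGroup H) :
    ∏ᶠ m, χ ((l : Lattice →₀ H) m) ^ c = 1 := by
  have h : ∑ᶠ k, (l : Lattice →₀ H) k = 0 := l.2
  have hs : (Function.support (l : Lattice →₀ H)) ⊆ ((l : Lattice →₀ H).support : Set Lattice) := by
    simp
  rw [finsum_eq_sum_of_support_subset _ hs] at h
  have h1 := map_prod χ.toMonoidHom (fun k => Multiplicative.ofAdd ((l : Lattice →₀ H) k))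
    (l : Lattice →₀ H).support
  rw [← ofAdd_sum, h, ofAdd_zero, map_one] at h1
  rw [finprod_eq_prod_of_mulSupport_subset (s := (l : Lattice →₀ H).support)]
  · rw [Finset.prod_zpow]
    exact (congrArg (· ^ c) h1.symm).trans (one_zpow c)
  · intro k hk
    simp only [Finset.mem_coe, Finsupp.mem_support_iff]
    intro h0
    exact hk (by simp [h0])

theorem actionPhase_eq (χ : AddChar H Circle) (g : AffineSL) (l : LambdaGroup H) :
    actionPhase χ g l =
      ∏ᶠ m, χ ((l : Lattice →₀ H) m) ^ latticeDet (trans g) (slMulVec g.right m) := by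
  rw [← finprod_comp_equiv (affinePerm (SemidirectProduct.inr g.right)).symm]
  refine finprod_congr fun m => ?_
  rw [permute_apply]
  congr 2
  rw [← affinePerm_inr, Equiv.apply_symm_apply]

theorem actionPhase_add (χ : AddChar H Circle) (g : AffineSL) (l l' : LambdaGroup H) :
    actionPhase χ g (l + l') = actionPhase χ g l * actionPhase χ g l' := by
  simp only [actionPhase_eq]
  rw [← finprod_mul_distrib (finite_mulSupport_char χ _ l) (finite_mulSupport_char χ _ l')]
  refine finprod_congr fun m => ?_
  simp [AddChar.map_add_eq_mul, mul_zpow]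

theorem actionPhase_mul (χ : AddChar H Circle) (g h : AffineSL) (l : LambdaGroup H) :
    actionPhase χ (g * h) l =
      actionPhase χ g (permute (affinePerm h) l) * actionPhase χ h l := by
  have e1 : actionPhase χ g (permute (affinePerm h) l) =
      ∏ᶠ m, χ ((l : Lattice →₀ H) m) ^
        latticeDet (trans g) (slMulVec g.right (affinePerm h m)) := by
    rw [actionPhase_eq, ← finprod_comp_equiv (affinePerm h)]
    refine finprod_congr fun m => ?_
    rw [permute_apply, Equiv.symm_apply_apply]
  set c : ℤ := latticeDet (trans g) (slMulVec g.right (trans h)) with hc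
  have h1 : ∏ᶠ m, χ ((l : Lattice →₀ H) m) ^ c = 1 :=
    finprod_char_zpow_eq_one χ c l
  rw [e1, actionPhase_eq, actionPhase_eq, ← one_mul (finprod _), ← h1,
    ← finprod_mul_distrib (finite_mulSupport_char χ _ l) (finite_mulSupport_char χ _ l),
    ← finprod_mul_distrib (finite_mulSupport_char χ _ l) (finite_mulSupport_char χ _ l)]
  refine finprod_congr fun m => ?_
  rw [← zpow_add, ← zpow_add]
  congr 1
  have h2 := latticeDet_sl g.right (trans h) (slMulVec h.right m)
  rw [hc, affinePerm_apply, trans_mul, SemidirectProduct.mul_right, slMulVec_mul, slMulVec_add]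
  simp only [latticeDet, Pi.add_apply] at h2 ⊢
  linear_combination h2

/-- The unitary representation of `ℤ² ⋊ SL(2, ℤ)` on `ℓ²(Λ(H))` implementing the action:
`(k, γ)` sends `δ_l` to `∏_m χ((γ · l)(m))^{det(k, m)} δ_{(k, γ) · l}`. -/
def shiftRep (χ : AddChar H Circle) :
    AffineSL →* unitary (EllTwo (LambdaGroup H) →L[ℂ] EllTwo (LambdaGroup H)) :=
  MonoidHom.mk' (fun g => weightedUnitary (permute (affinePerm g)) (actionPhase χ g))
    (fun g h => by
      rw [weightedUnitary_mul, map_mul, map_mul]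
      congr 1
      funext l
      exact actionPhase_mul χ g h l)

/-- Conjugation by the implementing unitaries maps `u(l)` to
`∏_m χ((γ · l)(m))^{det(k, m)} u((k, γ) · l)`. -/
theorem shiftRep_conj (μ : NormalizedTwoCocycle H) (χ : AddChar H Circle) (g : AffineSL)
    (l : LambdaGroup H) :
    (shiftRep χ g : EllTwo (LambdaGroup H) →L[ℂ] EllTwo (LambdaGroup H)) *
        twistedTranslation (cocycleTilde μ) l *
        star (shiftRep χ g : EllTwo (LambdaGroup H) →L[ℂ] EllTwo (LambdaGroup H)) =
      (actionPhase χ g l : ℂ) • (twistedTranslation (cocycleTilde μ) (permute (affinePerm g) l) :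
        EllTwo (LambdaGroup H) →L[ℂ] EllTwo (LambdaGroup H)) := by
  have key : (shiftRep χ g : EllTwo (LambdaGroup H) →L[ℂ] EllTwo (LambdaGroup H)) *
        twistedTranslation (cocycleTilde μ) l =
      (actionPhase χ g l : ℂ) • ((twistedTranslation (cocycleTilde μ) (permute (affinePerm g) l) :
        EllTwo (LambdaGroup H) →L[ℂ] EllTwo (LambdaGroup H)) * shiftRep χ g) := by
    change ((weightedUnitary (permute (affinePerm g)) (actionPhase χ g) *
        weightedUnitary (Equiv.addLeft l) (fun g => (cocycleTilde μ).toFun l g) :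
          unitary (EllTwo (LambdaGroup H) →L[ℂ] EllTwo (LambdaGroup H))) :
          EllTwo (LambdaGroup H) →L[ℂ] EllTwo (LambdaGroup H)) =
      (actionPhase χ g l : ℂ) • ((weightedUnitary (Equiv.addLeft (permute (affinePerm g) l))
        (fun x => (cocycleTilde μ).toFun (permute (affinePerm g) l) x) *
        weightedUnitary (permute (affinePerm g)) (actionPhase χ g) :
          unitary (EllTwo (LambdaGroup H) →L[ℂ] EllTwo (LambdaGroup H))) :
          EllTwo (LambdaGroup H) →L[ℂ] EllTwo (LambdaGroup H))
    rw [weightedUnitary_mul, weightedUnitary_mul]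
    have he : permute (affinePerm g) * Equiv.addLeft l =
        Equiv.addLeft (permute (affinePerm g) l) * permute (affinePerm g) := by
      apply Equiv.ext
      intro x
      exact permute_add _ l x
    rw [he]
    ext f y
    simp only [smul_apply, lp.coeFn_smul, Pi.smul_apply,
      weightedUnitary_apply, smul_eq_mul, ← mul_assoc, ← Circle.coe_mul]
    congr 2
    simp only [Equiv.coe_addLeft, actionPhase_add, cocycleTilde_permute]
    apply Circle.ext
    push_cast
    ring
  have hs : (shiftRep χ g : EllTwo (LambdaGroup H) →L[ℂ] EllTwo (LambdaGroup H)) *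
      star (shiftRep χ g : EllTwo (LambdaGroup H) →L[ℂ] EllTwo (LambdaGroup H)) = 1 :=
    Unitary.coe_mul_star_self _
  rw [key, smul_mul_assoc, mul_assoc, hs, mul_one]

/-- The twisted Bernoulli shift action `β(H, μ, χ)` of `ℤ² ⋊ SL(2, ℤ)` on `N(H, μ)`, given on the
generators by `β(k, γ)(u(l)) = ∏_m χ((γ · l)(m))^{det(k, m)} u((k, γ) · l)`. -/
def bernoulliAction (μ : NormalizedTwoCocycle H) (χ : AddChar H Circle) :
    AffineSL →* AutVN (bernoulliVN μ) :=
  conjAction (bernoulliVN μ) (shiftRep χ) fun g _ hx =>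
    conj_mem_vnGenerated _ (shiftRep χ g) (by
      rintro _ ⟨l, rfl⟩
      change (shiftRep χ g : EllTwo (LambdaGroup H) →L[ℂ] EllTwo (LambdaGroup H)) *
        (twistedTranslation (cocycleTilde μ) l) * star (shiftRep χ g :
          EllTwo (LambdaGroup H) →L[ℂ] EllTwo (LambdaGroup H)) ∈ _
      rw [shiftRep_conj]
      exact (vnGenerated _).toStarSubalgebra.smul_mem
        (subset_vnGenerated _ (Set.mem_range_self _)) _) hx

/-- The centralizer `Aut(N(H, μ), β)`: the automorphisms of `N(H, μ)` commuting with all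
`β(g)`. -/
def bernoulliCentralizer (μ : NormalizedTwoCocycle H) (χ : AddChar H Circle) :
    Subgroup (AutVN (bernoulliVN μ)) :=
  Subgroup.centralizer (Set.range (bernoulliAction μ χ))

/-- The canonical unitary `u(l)` as an element of `N(H, μ)`. -/
def bernoulliUnitary (μ : NormalizedTwoCocycle H) (l : LambdaGroup H) :
    (bernoulliVN μ).toStarSubalgebra :=
  ⟨twistedTranslation (cocycleTilde μ) l, subset_vnGenerated _ (Set.mem_range_self l)⟩

theorem bernoulliAction_bernoulliUnitary (μ : NormalizedTwoCocycle H) (χ : AddChar H Circle)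
    (g : AffineSL) (l : LambdaGroup H) :
    bernoulliAction μ χ g (bernoulliUnitary μ l) =
      (actionPhase χ g l : ℂ) • bernoulliUnitary μ (permute (affinePerm g) l) :=
  Subtype.ext (shiftRep_conj μ χ g l)

end Bernoulli

/-! ### The triple `(H_q, μ_q, χ_q)` -/

/-- The group `H_q = (ℤ/qℤ)²`. -/
abbrev HGroup (q : ℕ) : Type := ZMod q × ZMod q

/-- `μ_q((s₁, t₁), (s₂, t₂)) = exp(2πi s₁ t₂ / q)`. -/
def muCocycle (q : ℕ) [NeZero q] : NormalizedTwoCocycle (HGroup q) where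
  toFun x y := ZMod.toCircle (x.1 * y.2)
  map_zero_left g := by simp
  map_zero_right g := by simp
  cocycle g h k := by
    simp only [← AddChar.map_add_eq_mul, Prod.fst_add, Prod.snd_add]
    congr 1
    ring

/-- `χ_q(s, t) = exp(2πi s / q)`. -/
def chiChar (q : ℕ) [NeZero q] : AddChar (HGroup q) Circle :=
  ZMod.toCircle.compAddMonoidHom (AddMonoidHom.fst (ZMod q) (ZMod q))

theorem muCocycle_intCast (q : ℕ) [NeZero q] (s₁ t₁ s₂ t₂ : ℤ) :
    ((muCocycle q).toFun ((s₁ : ZMod q), (t₁ : ZMod q)) ((s₂ : ZMod q), (t₂ : ZMod q)) : ℂ) =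
      Complex.exp (2 * Real.pi * Complex.I * (s₁ * t₂) / q) := by
  have h := ZMod.toCircle_intCast (N := q) (s₁ * t₂)
  push_cast at h
  exact h

theorem chiChar_intCast (q : ℕ) [NeZero q] (s t : ℤ) :
    (chiChar q ((s : ZMod q), (t : ZMod q)) : ℂ) =
      Complex.exp (2 * Real.pi * Complex.I * s / q) :=
  ZMod.toCircle_intCast (N := q) s

end TwistedBernoulli

end

noncomputable section

namespace TwistedBernoulli

open Filter Topology
open scoped ComplexConjugate InnerProductSpace

/-! Write `δ_0` for the basis vector at the origin. It is separating for `L_μ(Γ)`, because the right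
translations commute with the algebra and move `δ_0` to every basis vector. An element is therefore
its vector of Fourier coefficients, with twisted convolution as product. Three facts about the
cocycle then give the first claim. The pairing on `Λ(H_q)` is nondegenerate, because finite support
excludes nonzero constant functions, so the algebra is a factor. Dipoles moving to infinity are
asymptotically central but fail to commute with each other by a fixed scalar, which rules out
abelian projections. And `Λ(H_q)` is an increasing union of finite subgroups, which gives AFD.

For the centralizer, call `u(edge h)`, with `edge h = h δ_0 - h δ_(1,0)`, an edge unitary. It is
fixed by the upper shear, so its image `x` under a commuting automorphism is fixed too.
Square-summability then forces the Fourier support of `x` to live on the first axis. The triangle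
with vertices 0, (1,0), (1,1) says that `x` times a rotated copy of `x` (on the line `m 0 = 1`) is a
multiple of a sheared copy (on the diagonal). The axis and the line meet in one point, so no
cancellation occurs in this product, and the support of `x` must be a single dipole on the same edge
(`exists_eq_smul_dipole`).

Hence every edge unitary goes to a multiple `a` of an edge unitary. The triangle relation determines
`a` (`map_edge_phase`), the half-turn exchanging the endpoints shows that the first coordinate of
`h` is preserved (`map_edge_fst`), and commutators preserve the symplectic form
(`map_edge_symplectic`). Only the shears `(s, t) ↦ (s, t + c s)` remain. Each of them does occur:
since 2 is invertible mod `q`, the quadratic form `½ ∑ s_k²` corrects the change of cocycle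
(`halfSquare_add`).

An automorphism is not assumed normal, so its values on the canonical unitaries determine it only
once it is known to preserve the trace. This is `inner_map_eq_of_commute`: the mean ergodic theorem
for a translation, combined with a noncommutative Borel–Cantelli argument. Finally, the centralizer
is finite and the automorphism group is Hausdorff, so its topology is discrete. -/

theorem vnGenerated_le {E : Type*} [NormedAddCommGroup E] [InnerProductSpace ℂ E]
    [CompleteSpace E] {S : Set (E →L[ℂ] E)} {N : VonNeumannAlgebra E}
    (h : S ⊆ N) : vnGenerated S ≤ N := by
  intro x hx
  rw [← SetLike.mem_coe, coe_vnGenerated] at hx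
  rw [← SetLike.mem_coe, ← N.centralizer_centralizer]
  refine Set.centralizer_subset (Set.centralizer_subset ?_) hx
  rintro t (ht | ht)
  · exact h ht
  · simpa using star_mem (h ht)

/-! ### Basis vectors of `ℓ²(X)` -/

section Basis

variable {X : Type*}

theorem inner_basisVec_left (x : X) (f : EllTwo X) : ⟪basisVec x, f⟫_ℂ = f x := by
  classical
  unfold basisVec
  rw [lp.inner_single_left]
  simp

theorem inner_basisVec_right (x : X) (f : EllTwo X) : ⟪f, basisVec x⟫_ℂ = conj (f x) := by
  rw [← inner_conj_symm, inner_basisVec_left]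

theorem basisVec_apply_self (x : X) : (basisVec x : EllTwo X) x = 1 := by
  classical
  simp [basisVec]

theorem basisVec_apply_of_ne {x y : X} (h : y ≠ x) : (basisVec x : EllTwo X) y = 0 := by
  classical
  simp [basisVec, h]

theorem norm_basisVec (x : X) : ‖(basisVec x : EllTwo X)‖ = 1 := by
  classical
  rw [basisVec, lp.norm_single (by norm_num), norm_one]

theorem basisVec_ne_zero (x : X) : (basisVec x : EllTwo X) ≠ 0 := fun h => by
  simpa [h] using basisVec_apply_self x

theorem hasSum_smul_basisVec (f : EllTwo X) : HasSum (fun x => f x • basisVec x) f := by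
  classical
  have h := lp.hasSum_single (p := 2) (by norm_num) f
  refine h.congr_fun fun x => ?_
  rw [basisVec, ← lp.single_smul, smul_eq_mul, mul_one]

theorem eq_smul_basisVec {f : EllTwo X} {x : X} (h : ∀ y, y ≠ x → f y = 0) :
    f = f x • basisVec x := by
  ext y
  by_cases hy : y = x
  · subst hy; simp [basisVec_apply_self]
  · simp [h y hy, basisVec_apply_of_ne hy]

theorem smul_basisVec_injective {x y : X} {c d : ℂ} (hc : c ≠ 0)
    (h : c • (basisVec x : EllTwo X) = d • basisVec y) : x = y := by
  by_contra hxy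
  have := congrArg (fun f : EllTwo X => f x) h
  simp [basisVec_apply_self, basisVec_apply_of_ne hxy, hc] at this

theorem clm_ext_basisVec {F : Type*} [NormedAddCommGroup F] [NormedSpace ℂ F]
    {S T : EllTwo X →L[ℂ] F} (h : ∀ x, S (basisVec x) = T (basisVec x)) : S = T := by
  ext f
  have hf := hasSum_smul_basisVec f
  have h1 := hf.mapL S
  have h2 := hf.mapL T
  simp only [map_smul, h] at h1 h2
  exact h1.unique h2

/-- A square-summable function takes each non-zero absolute value only finitely often. -/
theorem finite_norm_eq (f : EllTwo X) {c : ℝ} (hc : 0 < c) : {x | ‖f x‖ = c}.Finite := by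
  have hs := (lp.memℓp f).summable (by norm_num)
  have h := hs.tendsto_cofinite_zero.eventually_lt_const (u := c ^ (2 : ℝ≥0∞).toReal) (by positivity)
  refine Set.Finite.subset h fun x hx hlt => ?_
  rw [Set.mem_ofPred_eq] at hx hlt
  rw [hx] at hlt
  exact lt_irrefl _ hlt

end Basis

/-! ### Fourier coefficients in twisted group von Neumann algebras. -/

section TwistedGroup

variable {Γ : Type*} [AddCommGroup Γ] (μ : NormalizedTwoCocycle Γ)

/-- The right translation `δ_g ↦ μ(g, γ) δ_{g + γ}`, which commutes with `L_μ(Γ)`. -/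
def rightTranslation (γ : Γ) : unitary (EllTwo Γ →L[ℂ] EllTwo Γ) :=
  weightedUnitary (Equiv.addRight γ) (fun g => μ.toFun g γ)

theorem twistedTranslation_basisVec (γ g : Γ) :
    (twistedTranslation μ γ : EllTwo Γ →L[ℂ] EllTwo Γ) (basisVec g) =
      (μ.toFun γ g : ℂ) • basisVec (γ + g) :=
  weightedUnitary_basisVec _ _ _

theorem rightTranslation_basisVec (γ g : Γ) :
    (rightTranslation μ γ : EllTwo Γ →L[ℂ] EllTwo Γ) (basisVec g) =
      (μ.toFun g γ : ℂ) • basisVec (g + γ) :=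
  weightedUnitary_basisVec _ _ _

theorem twistedTranslation_basisVec_zero (γ : Γ) :
    (twistedTranslation μ γ : EllTwo Γ →L[ℂ] EllTwo Γ) (basisVec 0) = basisVec γ := by
  rw [twistedTranslation_basisVec, μ.map_zero_right, add_zero, Circle.coe_one, one_smul]

theorem rightTranslation_basisVec_zero (γ : Γ) :
    (rightTranslation μ γ : EllTwo Γ →L[ℂ] EllTwo Γ) (basisVec 0) = basisVec γ := by
  rw [rightTranslation_basisVec, μ.map_zero_left, zero_add, Circle.coe_one, one_smul]

theorem twistedTranslation_zero :
    (twistedTranslation μ 0 : EllTwo Γ →L[ℂ] EllTwo Γ) = 1 :=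
  clm_ext_basisVec fun g => by
    rw [twistedTranslation_basisVec, μ.map_zero_left, zero_add, Circle.coe_one, one_smul]
    rfl

theorem twistedTranslation_mul (a b : Γ) :
    (twistedTranslation μ a : EllTwo Γ →L[ℂ] EllTwo Γ) * twistedTranslation μ b =
      (μ.toFun a b : ℂ) • (twistedTranslation μ (a + b) : EllTwo Γ →L[ℂ] EllTwo Γ) :=
  clm_ext_basisVec fun g => by
    rw [mul_apply_eq_comp, smul_apply,
      twistedTranslation_basisVec, map_smul, twistedTranslation_basisVec,
      twistedTranslation_basisVec, smul_smul, smul_smul, ← Circle.coe_mul, ← Circle.coe_mul,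
      μ.cocycle, add_assoc]

theorem star_twistedTranslation (a : Γ) :
    star (twistedTranslation μ a : EllTwo Γ →L[ℂ] EllTwo Γ) =
      (((μ.toFun a (-a))⁻¹ : Circle) : ℂ) •
        (twistedTranslation μ (-a) : EllTwo Γ →L[ℂ] EllTwo Γ) := by
  have h := twistedTranslation_mul μ a (-a)
  rw [add_neg_cancel, twistedTranslation_zero] at h
  have h1 : star (twistedTranslation μ a : EllTwo Γ →L[ℂ] EllTwo Γ) * twistedTranslation μ a = 1 :=
    Unitary.coe_star_mul_self _
  have h2 := congrArg (fun z => star (twistedTranslation μ a : EllTwo Γ →L[ℂ] EllTwo Γ) * z) h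
  simp only [← mul_assoc, h1, one_mul, mul_smul_comm, mul_one] at h2
  rw [h2, smul_smul, ← Circle.coe_mul, inv_mul_cancel, Circle.coe_one, one_smul]

theorem twistedTranslation_mem (γ : Γ) :
    (twistedTranslation μ γ : EllTwo Γ →L[ℂ] EllTwo Γ) ∈ twistedGroupVN μ :=
  subset_vnGenerated _ (Set.mem_range_self γ)

theorem twistedTranslation_mul_rightTranslation (a b : Γ) :
    (twistedTranslation μ a : EllTwo Γ →L[ℂ] EllTwo Γ) * rightTranslation μ b =
      rightTranslation μ b * twistedTranslation μ a :=
  clm_ext_basisVec fun g => by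
    rw [mul_apply_eq_comp, mul_apply_eq_comp,
      twistedTranslation_basisVec, rightTranslation_basisVec, map_smul, map_smul,
      twistedTranslation_basisVec, rightTranslation_basisVec, smul_smul, smul_smul,
      ← Circle.coe_mul, ← Circle.coe_mul, μ.cocycle, add_assoc]

theorem rightTranslation_mul (a b : Γ) :
    (rightTranslation μ b : EllTwo Γ →L[ℂ] EllTwo Γ) * rightTranslation μ a =
      (μ.toFun a b : ℂ) • (rightTranslation μ (a + b) : EllTwo Γ →L[ℂ] EllTwo Γ) :=
  clm_ext_basisVec fun g => by
    rw [mul_apply_eq_comp, smul_apply, rightTranslation_basisVec, map_smul,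
      rightTranslation_basisVec, rightTranslation_basisVec, smul_smul, smul_smul,
      ← Circle.coe_mul, ← Circle.coe_mul, μ.cocycle, add_assoc]

variable {μ}

/-- The adjoint of a generator is a scalar multiple of another generator, so commuting with the
generators is enough to lie in the commutant. -/
theorem mem_twistedGroupVN_comm {x : EllTwo Γ →L[ℂ] EllTwo Γ} (hx : x ∈ twistedGroupVN μ) (b : Γ) :
    x * rightTranslation μ b = rightTranslation μ b * x := by
  have hx' := hx
  rw [← SetLike.mem_coe, twistedGroupVN, coe_vnGenerated] at hx'
  refine (hx' _ ?_).symm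
  have hg : ∀ a : Γ, (twistedTranslation μ a : EllTwo Γ →L[ℂ] EllTwo Γ) * rightTranslation μ b =
      rightTranslation μ b * twistedTranslation μ a :=
    fun a => twistedTranslation_mul_rightTranslation μ a b
  rintro t (⟨a, rfl⟩ | ⟨a, ha⟩)
  · exact hg a
  · have : t = star (twistedTranslation μ a : EllTwo Γ →L[ℂ] EllTwo Γ) := by
      rw [show (twistedTranslation μ a : EllTwo Γ →L[ℂ] EllTwo Γ) = star t from ha, star_star]
    rw [this, star_twistedTranslation, smul_mul_assoc, mul_smul_comm, hg]

theorem mem_twistedGroupVN_apply_basisVec {x : EllTwo Γ →L[ℂ] EllTwo Γ}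
    (hx : x ∈ twistedGroupVN μ) (γ : Γ) :
    x (basisVec γ) = (rightTranslation μ γ : EllTwo Γ →L[ℂ] EllTwo Γ) (x (basisVec 0)) := by
  rw [← rightTranslation_basisVec_zero μ γ, ← mul_apply_eq_comp,
    mem_twistedGroupVN_comm hx, mul_apply_eq_comp]

/-- The whole matrix of `x` is a twisted Toeplitz matrix, determined by its column at 0. -/
theorem mem_twistedGroupVN_coeff {x : EllTwo Γ →L[ℂ] EllTwo Γ}
    (hx : x ∈ twistedGroupVN μ) (γ g : Γ) :
    (x (basisVec γ)) g = (μ.toFun (g - γ) γ : ℂ) * (x (basisVec 0)) (g - γ) := by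
  rw [mem_twistedGroupVN_apply_basisVec hx, rightTranslation, weightedUnitary_apply]
  simp [sub_eq_add_neg]

/-- The vector `δ_0` is separating for `L_μ(Γ)`. -/
theorem eq_of_apply_basisVec_zero {x y : EllTwo Γ →L[ℂ] EllTwo Γ}
    (hx : x ∈ twistedGroupVN μ) (hy : y ∈ twistedGroupVN μ)
    (h : x (basisVec 0) = y (basisVec 0)) : x = y :=
  clm_ext_basisVec fun γ => by
    rw [mem_twistedGroupVN_apply_basisVec hx, mem_twistedGroupVN_apply_basisVec hy, h]

theorem star_coeff {x : EllTwo Γ →L[ℂ] EllTwo Γ}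
    (hx : x ∈ twistedGroupVN μ) (g : Γ) :
    (star x (basisVec 0)) g = conj ((μ.toFun (-g) g : ℂ) * (x (basisVec 0)) (-g)) := by
  have h := mem_twistedGroupVN_coeff hx g 0
  rw [zero_sub] at h
  rw [← h, ← inner_basisVec_left, ContinuousLinearMap.star_eq_adjoint,
    ContinuousLinearMap.adjoint_inner_right, inner_basisVec_right]

/-- The product is twisted convolution of Fourier coefficients. Summability comes for free, the sum
being the inner product of `x* δ_g` with `y δ_0`. -/
theorem hasSum_mul_coeff {x y : EllTwo Γ →L[ℂ] EllTwo Γ}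
    (hx : x ∈ twistedGroupVN μ) (g : Γ) :
    HasSum (fun k => (μ.toFun (g - k) k : ℂ) * (x (basisVec 0)) (g - k) * (y (basisVec 0)) k)
      (((x * y) (basisVec 0)) g) := by
  have h := lp.hasSum_inner (𝕜 := ℂ) (star x (basisVec g)) (y (basisVec 0))
  rw [ContinuousLinearMap.star_eq_adjoint, ContinuousLinearMap.adjoint_inner_left,
    inner_basisVec_left] at h
  refine h.congr_fun fun k => ?_
  rw [← mem_twistedGroupVN_coeff hx k g, ← inner_basisVec_left k (ContinuousLinearMap.adjoint x _),
    ContinuousLinearMap.adjoint_inner_right, inner_basisVec_right]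
  simp [mul_comm]

/-- This is the trace property: up to phases and conjugation, taking adjoints reindexes the
coefficients by `g ↦ -g`. -/
theorem norm_star_apply_basisVec {x : EllTwo Γ →L[ℂ] EllTwo Γ}
    (hx : x ∈ twistedGroupVN μ) : ‖star x (basisVec 0)‖ = ‖x (basisVec 0)‖ := by
  rw [lp.norm_eq_tsum_rpow (by norm_num), lp.norm_eq_tsum_rpow (by norm_num)]
  congr 1
  rw [← (Equiv.neg Γ).tsum_eq (fun i => ‖(x (basisVec 0)) i‖ ^ (2 : ℝ≥0∞).toReal)]
  refine tsum_congr fun g => ?_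
  rw [star_coeff hx, RCLike.norm_conj, norm_mul, Circle.norm_coe, one_mul]
  rfl

/-! ### Structure of `L_μ(Γ)` -/

theorem isFiniteVN_twistedGroupVN : IsFiniteVN (twistedGroupVN μ) := by
  intro v hv h
  have hvs : star v ∈ twistedGroupVN μ := star_mem hv
  refine eq_of_apply_basisVec_zero (mul_mem hv hvs) (one_mem _) ?_
  have h1 : ‖v (basisVec 0)‖ ^ 2 = 1 := by
    rw [← inner_self_eq_norm_sq (𝕜 := ℂ), ← ContinuousLinearMap.adjoint_inner_right,
      ← ContinuousLinearMap.star_eq_adjoint, ← mul_apply_eq_comp, h]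
    simp [norm_basisVec]
  have h2 : ‖star v (basisVec 0)‖ ^ 2 = 1 := by rw [norm_star_apply_basisVec hv, h1]
  set ξ := star v (basisVec 0) with hξ
  have h3 : ‖v ξ‖ ^ 2 = 1 := by
    rw [← h2, ← inner_self_eq_norm_sq (𝕜 := ℂ), ← ContinuousLinearMap.adjoint_inner_right,
      ← ContinuousLinearMap.star_eq_adjoint, ← mul_apply_eq_comp, h]
    exact inner_self_eq_norm_sq (𝕜 := ℂ) _
  -- Both `v ξ` and `δ_0` are unit vectors, so inner product 1 forces them to be equal.
  have h4 : ⟪v ξ, basisVec 0⟫_ℂ = 1 := by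
    rw [← ContinuousLinearMap.adjoint_inner_right, ← ContinuousLinearMap.star_eq_adjoint, ← hξ,
      inner_self_eq_norm_sq_to_K, ← RCLike.ofReal_pow, h2]
    simp
  change v ξ = basisVec 0
  rw [← sub_eq_zero, ← norm_eq_zero, ← sq_eq_zero_iff, @norm_sub_sq ℂ, h3, h4, norm_basisVec]
  norm_num

/-- Comparing coefficients at `γ + κ` in `x u(κ) = u(κ) x` gives two phases times the same
coefficient `x_γ`. If `γ` and `κ` do not commute under the cocycle, that coefficient vanishes. -/
theorem isFactor_twistedGroupVN (hμ : ∀ γ : Γ, γ ≠ 0 → ∃ κ, μ.toFun γ κ ≠ μ.toFun κ γ) :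
    IsFactor (twistedGroupVN μ) := by
  refine ⟨fun h => basisVec_ne_zero (0 : Γ) ?_, fun x hx hx' => ⟨(x (basisVec 0)) 0, ?_⟩⟩
  · simpa using congrArg (fun T : EllTwo Γ →L[ℂ] EllTwo Γ => T (basisVec 0)) h
  · refine eq_of_apply_basisVec_zero hx ((twistedGroupVN μ).toStarSubalgebra.smul_mem
      (one_mem _) _) ?_
    refine eq_smul_basisVec fun γ hγ => ?_
    obtain ⟨κ, hκ⟩ := hμ γ hγ
    have h1 := VonNeumannAlgebra.mem_commutant_iff.1 hx' _ (twistedTranslation_mem μ κ)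
    have h2 := congrArg (fun T : EllTwo Γ →L[ℂ] EllTwo Γ => (T (basisVec 0)) (γ + κ)) h1
    simp only [mul_apply_eq_comp, twistedTranslation_basisVec_zero] at h2
    rw [mem_twistedGroupVN_coeff hx, add_sub_cancel_right, twistedTranslation,
      weightedUnitary_apply] at h2
    simp only [Equiv.addLeft_symm, Equiv.coe_addLeft, neg_add_cancel_comm_assoc] at h2
    by_contra h0
    exact hκ (Circle.ext (mul_right_cancel₀ h0 h2).symm)

/-- If `a n`, `b n` are asymptotically central, then so are the corresponding unitaries. -/
theorem tendsto_translation_sub {a : ℕ → Γ}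
    (ha : ∀ γ, ∀ᶠ n in atTop, μ.toFun (a n) γ = μ.toFun γ (a n)) (ξ : EllTwo Γ) :
    Tendsto (fun n => (twistedTranslation μ (a n) : EllTwo Γ →L[ℂ] EllTwo Γ) ξ -
      (rightTranslation μ (a n) : EllTwo Γ →L[ℂ] EllTwo Γ) ξ) atTop (𝓝 0) := by
  have hU : ∀ (U : unitary (EllTwo Γ →L[ℂ] EllTwo Γ)) (η : EllTwo Γ),
      ‖(U : EllTwo Γ →L[ℂ] EllTwo Γ) η‖ = ‖η‖ := fun U η =>
    (Unitary.linearIsometryEquiv U).norm_map η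
  have hfin : ∀ s : Finset Γ, ∀ᶠ n in atTop,
      (twistedTranslation μ (a n) : EllTwo Γ →L[ℂ] EllTwo Γ) (∑ x ∈ s, ξ x • basisVec x) =
      (rightTranslation μ (a n) : EllTwo Γ →L[ℂ] EllTwo Γ) (∑ x ∈ s, ξ x • basisVec x) := by
    intro s
    filter_upwards [(Filter.eventually_all_finset s).2 fun x _ => ha x] with n hn
    simp only [map_sum, map_smul]
    refine Finset.sum_congr rfl fun x hx => ?_
    rw [twistedTranslation_basisVec, rightTranslation_basisVec, hn x hx, add_comm]
  rw [Metric.tendsto_nhds]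
  intro ε hε
  -- On a finite partial sum of `ξ` the two translations eventually agree exactly; the tail costs at
  -- most twice its norm.
  obtain ⟨s, hs⟩ := ((Metric.tendsto_nhds.1 (hasSum_smul_basisVec ξ)) (ε / 2)
    (by positivity)).exists
  filter_upwards [hfin s] with n hn
  rw [dist_zero_right]
  rw [dist_comm, dist_eq_norm] at hs
  set η := ∑ x ∈ s, ξ x • basisVec x
  calc _ = ‖(twistedTranslation μ (a n) : EllTwo Γ →L[ℂ] EllTwo Γ) (ξ - η) -
        (rightTranslation μ (a n) : EllTwo Γ →L[ℂ] EllTwo Γ) (ξ - η)‖ := by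
        rw [map_sub, map_sub, hn]; congr 1; abel
    _ ≤ ‖ξ - η‖ + ‖ξ - η‖ := (norm_sub_le _ _).trans (by rw [hU, hU])
    _ < ε := by linarith

/-- `L_μ(Γ)` has no non-zero abelian projection if it contains two asymptotically central
sequences of canonical unitaries that commute up to a fixed non-trivial scalar. -/
theorem isTypeIIOne_twistedGroupVN {a b : ℕ → Γ} {w : Circle} (hw : w ≠ 1)
    (ha : ∀ γ, ∀ᶠ n in atTop, μ.toFun (a n) γ = μ.toFun γ (a n))
    (hb : ∀ γ, ∀ᶠ n in atTop, μ.toFun (b n) γ = μ.toFun γ (b n))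
    (hab : ∀ n, μ.toFun (a n) (b n) = w * μ.toFun (b n) (a n)) :
    IsTypeIIOne (twistedGroupVN μ) := by
  refine ⟨isFiniteVN_twistedGroupVN, fun p ⟨hp, hproj, hab'⟩ => ?_⟩
  refine eq_of_apply_basisVec_zero hp (zero_mem _) ?_
  change p (basisVec 0) = 0
  set ξ := p (basisVec 0) with hξ
  have hpξ : p ξ = ξ := by
    rw [hξ, ← mul_apply_eq_comp, hproj.isIdempotentElem.eq]
  have hU : ∀ (U : unitary (EllTwo Γ →L[ℂ] EllTwo Γ)) (η : EllTwo Γ),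
      ‖(U : EllTwo Γ →L[ℂ] EllTwo Γ) η‖ = ‖η‖ := fun U η =>
    (Unitary.linearIsometryEquiv U).norm_map η
  have comm : ∀ {x : EllTwo Γ →L[ℂ] EllTwo Γ}, x ∈ twistedGroupVN μ → ∀ (c : Γ) (η : EllTwo Γ),
      x ((rightTranslation μ c : EllTwo Γ →L[ℂ] EllTwo Γ) η) =
        (rightTranslation μ c : EllTwo Γ →L[ℂ] EllTwo Γ) (x η) := fun hx c η => by
    rw [← mul_apply_eq_comp, mem_twistedGroupVN_comm hx, mul_apply_eq_comp]
  -- Left translations by asymptotically central elements may be replaced by right translations,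
  -- which commute with `p`. So `p u(a) p · p u(b) p δ_0` is asymptotically a phase times a unitary
  -- image of `ξ = p δ_0`.
  have key : ∀ {a b : ℕ → Γ}, (∀ γ, ∀ᶠ n in atTop, μ.toFun (a n) γ = μ.toFun γ (a n)) →
      (∀ γ, ∀ᶠ n in atTop, μ.toFun (b n) γ = μ.toFun γ (b n)) →
      Tendsto (fun n => ((p * twistedTranslation μ (a n) * p) *
        (p * twistedTranslation μ (b n) * p)) (basisVec 0) -
        (μ.toFun (a n) (b n) : ℂ) •
          (rightTranslation μ (a n + b n) : EllTwo Γ →L[ℂ] EllTwo Γ) ξ) atTop (𝓝 0) := by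
    intro a b ha hb
    have h1 := (tendsto_translation_sub ha ξ).norm
    have h2 := (tendsto_translation_sub hb ξ).norm
    rw [norm_zero] at h1 h2
    have h3 := (h2.const_mul (‖p‖ * ‖p * p‖)).add (h1.const_mul ‖p‖)
    simp only [mul_zero, add_zero] at h3
    refine squeeze_zero_norm (fun n => ?_) h3
    have e2 : ((p * twistedTranslation μ (a n) * p) *
        (p * twistedTranslation μ (b n) * p)) (basisVec 0) -
        (μ.toFun (a n) (b n) : ℂ) •
          (rightTranslation μ (a n + b n) : EllTwo Γ →L[ℂ] EllTwo Γ) ξ =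
        p ((twistedTranslation μ (a n) : EllTwo Γ →L[ℂ] EllTwo Γ) ((p * p)
          ((twistedTranslation μ (b n) : EllTwo Γ →L[ℂ] EllTwo Γ) ξ -
            (rightTranslation μ (b n) : EllTwo Γ →L[ℂ] EllTwo Γ) ξ))) +
        (rightTranslation μ (b n) : EllTwo Γ →L[ℂ] EllTwo Γ)
          (p ((twistedTranslation μ (a n) : EllTwo Γ →L[ℂ] EllTwo Γ) ξ -
            (rightTranslation μ (a n) : EllTwo Γ →L[ℂ] EllTwo Γ) ξ)) := by
      have e3 : (μ.toFun (a n) (b n) : ℂ) •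
          (rightTranslation μ (a n + b n) : EllTwo Γ →L[ℂ] EllTwo Γ) ξ =
          (rightTranslation μ (b n) : EllTwo Γ →L[ℂ] EllTwo Γ)
            ((rightTranslation μ (a n) : EllTwo Γ →L[ℂ] EllTwo Γ) ξ) := by
        rw [← mul_apply_eq_comp (rightTranslation μ (b n) : EllTwo Γ →L[ℂ] EllTwo Γ),
          rightTranslation_mul, smul_apply]
      rw [e3]
      simp only [mul_apply_eq_comp, map_sub, ← hξ, hpξ, comm hp, comm (twistedTranslation_mem μ _)]
      abel
    rw [e2]
    refine (norm_add_le _ _).trans (add_le_add ?_ ?_)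
    · refine (p.le_opNorm _).trans ?_
      rw [hU, mul_assoc]
      exact mul_le_mul_of_nonneg_left ((p * p).le_opNorm _) (norm_nonneg _)
    · rw [hU]
      exact p.le_opNorm _
  -- Commutativity of `p N p` cancels the operator products and leaves a vector of constant norm `‖w
  -- - 1‖ ‖ξ‖` tending to 0.
  have h1 := (key ha hb).sub (key hb ha)
  rw [sub_zero] at h1
  have h2 : Tendsto (fun _ : ℕ => ‖(w : ℂ) - 1‖ * ‖ξ‖) atTop (𝓝 ‖(0 : EllTwo Γ)‖) := by
    refine h1.norm.congr fun n => ?_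
    rw [hab' _ (twistedTranslation_mem μ (a n)) _ (twistedTranslation_mem μ (b n)),
      sub_sub_sub_cancel_left, add_comm (b n), ← sub_smul, norm_smul, hU, hab n, norm_sub_rev]
    congr 1
    rw [Circle.coe_mul, ← sub_one_mul, norm_mul, Circle.norm_coe, mul_one]
  rw [norm_zero] at h2
  have h3 := tendsto_nhds_unique tendsto_const_nhds h2
  rcases mul_eq_zero.1 h3 with h | h
  · exact absurd (Circle.ext (by simpa [sub_eq_zero] using h)) hw
  · exact norm_eq_zero.1 h

variable (μ) in
/-- The elements of `L_μ(Γ)` whose Fourier coefficients vanish outside a subgroup. -/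
def supportedSubalgebra (G : AddSubgroup Γ) : StarSubalgebra ℂ (EllTwo Γ →L[ℂ] EllTwo Γ) where
  carrier := {x | x ∈ twistedGroupVN μ ∧ ∀ g ∉ G, (x (basisVec 0)) g = 0}
  mul_mem' := by
    rintro x y ⟨hx, hx'⟩ ⟨hy, hy'⟩
    refine ⟨mul_mem hx hy, fun g hg => ?_⟩
    refine (hasSum_mul_coeff hx g).unique (hasSum_zero.congr_fun fun k => ?_)
    by_cases hk : k ∈ G
    · rw [hx' _ fun h => hg (by simpa using G.add_mem h hk), mul_zero, zero_mul]
    · rw [hy' k hk, mul_zero]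
  add_mem' := by
    rintro x y ⟨hx, hx'⟩ ⟨hy, hy'⟩
    refine ⟨add_mem hx hy, fun g hg => ?_⟩
    simp [hx' g hg, hy' g hg]
  algebraMap_mem' c := by
    refine ⟨(twistedGroupVN μ).toStarSubalgebra.algebraMap_mem c, fun g hg => ?_⟩
    have : g ≠ 0 := fun h => hg (h ▸ G.zero_mem)
    simp [Algebra.algebraMap_eq_smul_one, basisVec_apply_of_ne this]
  star_mem' := by
    rintro x ⟨hx, hx'⟩
    refine ⟨star_mem hx, fun g hg => ?_⟩
    rw [star_coeff hx, hx' _ fun h => hg (by simpa using G.neg_mem h), mul_zero, map_zero]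

/-- The coefficients on `G` determine the element because `δ_0` is separating. -/
theorem finiteDimensional_supportedSubalgebra (G : AddSubgroup Γ) [Finite G] :
    FiniteDimensional ℂ (supportedSubalgebra μ G) := by
  let f : supportedSubalgebra μ G →ₗ[ℂ] (G → ℂ) :=
    { toFun := fun x g => ((x : EllTwo Γ →L[ℂ] EllTwo Γ) (basisVec 0)) g
      map_add' := fun x y => rfl
      map_smul' := fun c x => rfl }
  refine FiniteDimensional.of_injective f fun x y h => Subtype.ext ?_
  refine eq_of_apply_basisVec_zero x.2.1 y.2.1 ?_
  ext g
  by_cases hg : g ∈ G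
  · exact congrFun h ⟨g, hg⟩
  · rw [x.2.2 g hg, y.2.2 g hg]

theorem isAFD_twistedGroupVN (G : ℕ → AddSubgroup Γ) (hG : Monotone G) [∀ n, Finite (G n)]
    (hcover : ∀ γ, ∃ n, γ ∈ G n) : IsAFD (twistedGroupVN μ) := by
  refine ⟨fun n => supportedSubalgebra μ (G n), fun m n hmn x hx =>
    ⟨hx.1, fun g hg => hx.2 g fun h => hg (hG hmn h)⟩,
    fun n => finiteDimensional_supportedSubalgebra (G n), le_antisymm ?_ ?_⟩
  · refine vnGenerated_le ?_
    rintro _ ⟨γ, rfl⟩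
    obtain ⟨n, hn⟩ := hcover γ
    refine subset_vnGenerated _ (Set.mem_iUnion.2 ⟨n, twistedTranslation_mem μ γ, fun g hg => ?_⟩)
    rw [twistedTranslation_basisVec_zero, basisVec_apply_of_ne fun h => hg (by rwa [h])]
  · refine vnGenerated_le (Set.iUnion_subset fun n x hx => hx.1)

end TwistedGroup

/-! ### Automorphisms of von Neumann algebras and invariance of a vector state. -/

section Abstract

theorem isPositive_of_tendsto {E : Type*} [NormedAddCommGroup E] [InnerProductSpace ℂ E]
    {T : ℕ → E →L[ℂ] E} {S : E →L[ℂ] E}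
    (hT : ∀ᶠ n in atTop, 0 ≤ T n) (h : ∀ ξ, Tendsto (fun n => T n ξ) atTop (𝓝 (S ξ))) : 0 ≤ S := by
  rw [ContinuousLinearMap.nonneg_iff_isPositive, ContinuousLinearMap.isPositive_iff_complex]
  intro ξ
  have h1 : Tendsto (fun n => ⟪T n ξ, ξ⟫_ℂ) atTop (𝓝 ⟪S ξ, ξ⟫_ℂ) :=
    (h ξ).inner tendsto_const_nhds
  have h2 : Tendsto (fun n => RCLike.re ⟪T n ξ, ξ⟫_ℂ) atTop (𝓝 (RCLike.re ⟪S ξ, ξ⟫_ℂ)) :=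
    (RCLike.continuous_re.tendsto _).comp h1
  have h3 : ∀ᶠ n in atTop, ((RCLike.re ⟪T n ξ, ξ⟫_ℂ : ℝ) : ℂ) = ⟪T n ξ, ξ⟫_ℂ ∧
      0 ≤ RCLike.re ⟪T n ξ, ξ⟫_ℂ := hT.mono fun n hn =>
    (ContinuousLinearMap.isPositive_iff_complex _).1
      ((ContinuousLinearMap.nonneg_iff_isPositive _).1 hn) ξ
  refine ⟨?_, ge_of_tendsto h2 (h3.mono fun n hn => hn.2)⟩
  refine tendsto_nhds_unique_of_eventuallyEq ((Complex.continuous_ofReal.tendsto _).comp h2) h1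
    (h3.mono fun n hn => hn.1)

variable {E : Type*} [NormedAddCommGroup E] [InnerProductSpace ℂ E] [CompleteSpace E]

/-- In a von Neumann algebra, a positive operator is of the form `b* b` with `b` in the algebra. -/
theorem exists_star_mul_self {N : VonNeumannAlgebra E} {x : E →L[ℂ] E} (hx : x ∈ N) (h : 0 ≤ x) :
    ∃ b ∈ N, x = star b * b := by
  refine ⟨CFC.sqrt x, ?_, ?_⟩
  · rw [← SetLike.mem_coe, ← N.centralizer_centralizer]
    intro y hy
    have hxy : Commute x y := hy x hx
    rw [CFC.sqrt_eq_cfc]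
    exact (hxy.cfc_nnreal _).symm
  · rw [(CFC.sqrt_nonneg x).isSelfAdjoint.star_eq, CFC.sqrt_mul_sqrt_self x h]

/-- This is `A² ≤ A`: write `A = b* b` with `‖b‖ ≤ 1`. The algebra generated by all operators serves
only to supply the square root. -/
theorem sq_norm_apply_le {A : E →L[ℂ] E} (h0 : 0 ≤ A) (h1 : A ≤ 1) (ξ : E) :
    ‖A ξ‖ ^ 2 ≤ RCLike.re ⟪A ξ, ξ⟫_ℂ := by
  obtain ⟨b, -, rfl⟩ := exists_star_mul_self (N := (vnGenerated Set.univ)) (x := A)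
    (subset_vnGenerated _ (Set.mem_univ _)) h0
  have hn : ‖b‖ * ‖b‖ ≤ 1 := by
    rw [← CStarRing.norm_star_mul_self]
    exact (CStarAlgebra.norm_le_one_iff_of_nonneg _ h0).2 h1
  have h2 : RCLike.re ⟪(star b * b) ξ, ξ⟫_ℂ = ‖b ξ‖ ^ 2 := by
    rw [mul_apply_eq_comp, ContinuousLinearMap.star_eq_adjoint,
      ContinuousLinearMap.adjoint_inner_left, inner_self_eq_norm_sq]
  rw [h2]
  refine (pow_le_pow_left₀ (norm_nonneg _) (?_ : _ ≤ ‖b‖ * ‖b ξ‖) 2).trans ?_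
  · rw [mul_apply_eq_comp, ← norm_star b]
    exact (star b).le_opNorm _
  · rw [mul_pow, sq ‖b‖]
    exact mul_le_of_le_one_left (by positivity) hn

/-- Vigier's theorem: a bounded increasing sequence of operators converges strongly. -/
theorem exists_tendsto_of_monotone {T : ℕ → E →L[ℂ] E} (hT : Monotone T)
    (h0 : ∀ n, 0 ≤ T n) (h1 : ∀ n, T n ≤ 1) :
    ∃ S : E →L[ℂ] E, (∀ ξ, Tendsto (fun n => T n ξ) atTop (𝓝 (S ξ))) ∧
      (∀ n, T n ≤ S) ∧ S ≤ 1 := by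
  -- Apply `A² ≤ A` to the increment `T n - T m`, itself between 0 and 1; strong convergence then
  -- follows from that of the bounded monotone quadratic forms.
  have hsq : ∀ {m n}, m ≤ n → ∀ ξ, ‖T n ξ - T m ξ‖ ^ 2 ≤
      RCLike.re ⟪T n ξ, ξ⟫_ℂ - RCLike.re ⟪T m ξ, ξ⟫_ℂ := by
    intro m n hmn ξ
    have h := sq_norm_apply_le (sub_nonneg.2 (hT hmn))
      ((sub_le_self _ (h0 m)).trans (h1 n)) ξ
    rwa [sub_apply, inner_sub_left, map_sub] at h
  have hlim : ∀ ξ, ∃ η, Tendsto (fun n => T n ξ) atTop (𝓝 η) := by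
    intro ξ
    apply cauchySeq_tendsto_of_complete
    set a : ℕ → ℝ := fun n => RCLike.re ⟪T n ξ, ξ⟫_ℂ with ha
    have hmono : Monotone a := fun m n hmn => by
      have := (sq_nonneg _).trans (hsq hmn ξ)
      simp only [ha]
      linarith
    have hbdd : BddAbove (Set.range a) := by
      refine ⟨‖ξ‖ ^ 2, ?_⟩
      rintro _ ⟨n, rfl⟩
      have h := ((ContinuousLinearMap.nonneg_iff_isPositive _).1
        (sub_nonneg.2 (h1 n))).re_inner_nonneg_left ξ
      rw [sub_apply, inner_sub_left, map_sub, one_apply_eq_self, inner_self_eq_norm_sq] at h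
      simp only [ha]
      linarith
    have hL := tendsto_atTop_ciSup hmono hbdd
    refine cauchySeq_of_le_tendsto_0' (fun m => √((⨆ n, a n) - a m)) (fun m n hmn => ?_) ?_
    · rw [dist_comm, dist_eq_norm]
      refine Real.le_sqrt_of_sq_le ((hsq hmn ξ).trans ?_)
      exact sub_le_sub_right (le_ciSup hbdd n) _
    · have := (hL.const_sub (⨆ n, a n)).sqrt
      simpa using this
  choose f hf using hlim
  refine ⟨continuousLinearMapOfTendsto T (tendsto_pi_nhds.2 hf), hf, fun n => ?_, ?_⟩
  · rw [← sub_nonneg]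
    refine isPositive_of_tendsto (T := fun m => T m - T n) ?_ fun ξ => (hf ξ).sub_const _
    filter_upwards [eventually_ge_atTop n] with m hm using sub_nonneg.2 (hT hm)
  · rw [← sub_nonneg]
    exact isPositive_of_tendsto (T := fun m => 1 - T m)
      (Eventually.of_forall fun m => sub_nonneg.2 (h1 m)) fun ξ => (hf ξ).const_sub _

theorem mem_of_tendsto {N : VonNeumannAlgebra E} {T : ℕ → E →L[ℂ] E} {S : E →L[ℂ] E}
    (hT : ∀ n, T n ∈ N) (h : ∀ ξ, Tendsto (fun n => T n ξ) atTop (𝓝 (S ξ))) : S ∈ N := by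
  rw [← SetLike.mem_coe, ← N.centralizer_centralizer]
  intro y hy
  ext ξ
  refine tendsto_nhds_unique (((y.continuous.tendsto _).comp (h ξ)).congr fun n => ?_) (h (y ξ))
  exact DFunLike.congr_fun (hy _ (hT n)).symm ξ

/-- Positivity in the ambient operator algebra is visible to `*`-homomorphisms of `N`, because the
square root of a positive element of `N` stays in `N`. -/
theorem map_nonneg {N : VonNeumannAlgebra E} (α : AutVN N) {x : N.toStarSubalgebra}
    (h : 0 ≤ (x : E →L[ℂ] E)) : 0 ≤ (α x : E →L[ℂ] E) := by
  obtain ⟨b, hb, hxb⟩ := exists_star_mul_self x.2 h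
  have : x = star (⟨b, hb⟩ : N.toStarSubalgebra) * ⟨b, hb⟩ := Subtype.ext hxb
  rw [this, map_mul, map_star]
  exact star_mul_self_nonneg (α ⟨b, hb⟩ : E →L[ℂ] E)

theorem map_le_map {N : VonNeumannAlgebra E} (α : AutVN N) {x y : N.toStarSubalgebra}
    (h : (x : E →L[ℂ] E) ≤ y) : (α x : E →L[ℂ] E) ≤ α y := by
  rw [← sub_nonneg] at h ⊢
  have := map_nonneg α (x := y - x) h
  rwa [map_sub] at this

/-- The resolvent `(1 + S)⁻¹` of a positive element. -/
theorem ringInverse_mem {N : VonNeumannAlgebra E} {x : E →L[ℂ] E} (hx : x ∈ N) :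
    Ring.inverse x ∈ N := by
  rw [← SetLike.mem_coe, ← N.centralizer_centralizer]
  intro y hy
  have hxy : Commute x y := hy x hx
  by_cases hu : IsUnit x
  · obtain ⟨u, rfl⟩ := hu
    rw [Ring.inverse_unit]
    exact hxy.units_inv_left.symm
  · rw [Ring.inverse_non_unit _ hu, mul_zero, zero_mul]

theorem isStrictlyPositive_one_add {S : E →L[ℂ] E} (hS : 0 ≤ S) : IsStrictlyPositive (1 + S) :=
  IsStrictlyPositive.add_nonneg isStrictlyPositive_one hS

open Ring in
-- These are the scalar inequalities `1 - t ≤ (1 + t)⁻¹ ≤ 1` for `t ≥ 0`, lifted to operators.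
theorem resolvent_bounds {S : E →L[ℂ] E} (hS : 0 ≤ S) :
    0 ≤ (1 + S)⁻¹ʳ ∧ (1 + S)⁻¹ʳ ≤ 1 ∧ 1 - S ≤ (1 + S)⁻¹ʳ := by
  have hu := (isStrictlyPositive_one_add hS).isUnit
  have hl := Ring.inverse_mul_cancel _ hu
  have hr := Ring.mul_inverse_cancel _ hu
  set R := (1 + S)⁻¹ʳ with hR
  have h0 : 0 ≤ R := by
    have h := star_left_conjugate_nonneg (isStrictlyPositive_one_add hS).nonneg R
    have hs : star R * (1 + S) = 1 := by
      have := congrArg star hr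
      rwa [star_mul, star_one, (isStrictlyPositive_one_add hS).nonneg.isSelfAdjoint.star_eq] at this
    rwa [hs, one_mul] at h
  have h1 : R ≤ 1 := by
    have := CStarAlgebra.ringInverse_le_ringInverse (le_add_of_nonneg_right hS :
      (1 : E →L[ℂ] E) ≤ 1 + S) isStrictlyPositive_one
    rwa [Ring.inverse_one] at this
  refine ⟨h0, h1, ?_⟩
  -- With `R = (1 + S)⁻¹`, the difference `R - (1 - S)` equals `S R S`.
  have h := hS.isSelfAdjoint.conjugate_nonneg h0
  rw [← sub_nonneg]
  convert h using 1
  have hSR : S * R = 1 - R := by rw [add_mul, one_mul] at hr; rw [← hr]; abel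
  have hRS : R * S = 1 - R := by rw [mul_add, mul_one] at hl; rw [← hl]; abel
  rw [hSR, sub_mul, one_mul, hRS]
  abel

open Ring in
-- With `R = (1 + x²)⁻¹` one has `1 - R = x R x`, and `R ≥ (1 + C²)⁻¹` because `x² ≤ C²`.
theorem resolvent_sq_le {x : E →L[ℂ] E} (hx : IsSelfAdjoint x) {C : ℝ} (hC : ‖x‖ ≤ C) :
    (1 + x * x)⁻¹ʳ ≤ 1 - ((1 + C ^ 2)⁻¹ : ℝ) • (x * x) := by
  have hxx : 0 ≤ x * x := hx.mul_self_nonneg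
  have hu := (isStrictlyPositive_one_add hxx).isUnit
  have hr := Ring.mul_inverse_cancel _ hu
  have hcomm : (1 + x * x)⁻¹ʳ * x = x * (1 + x * x)⁻¹ʳ := by
    have hl := Ring.inverse_mul_cancel _ hu
    set R := (1 + x * x)⁻¹ʳ
    calc R * x = R * x * ((1 + x * x) * R) := by rw [hr, mul_one]
      _ = R * (1 + x * x) * x * R := by noncomm_ring
      _ = x * R := by rw [hl, one_mul]
  have hC0 : 0 ≤ C := (norm_nonneg x).trans hC
  have hle : algebraMap ℝ (E →L[ℂ] E) (1 + C ^ 2)⁻¹ ≤ (1 + x * x)⁻¹ʳ := by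
    have h1 : 1 + x * x ≤ algebraMap ℝ (E →L[ℂ] E) (1 + C ^ 2) := by
      rw [map_add, map_one]
      refine add_le_add_right ?_ _
      have h2 := CStarAlgebra.star_mul_le_algebraMap_norm_sq (a := x)
      rw [hx.star_eq] at h2
      exact h2.trans (algebraMap_mono _ (pow_le_pow_left₀ (norm_nonneg _) hC 2))
    have h3 := CStarAlgebra.ringInverse_le_ringInverse h1 (isStrictlyPositive_one_add hxx)
    have h4 : (algebraMap ℝ (E →L[ℂ] E) (1 + C ^ 2))⁻¹ʳ =
        algebraMap ℝ (E →L[ℂ] E) (1 + C ^ 2)⁻¹ := by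
      have hne : (1 + C ^ 2 : ℝ) ≠ 0 := by positivity
      exact Ring.inverse_unit (Units.map (algebraMap ℝ (E →L[ℂ] E)).toMonoidHom (Units.mk0 _ hne))
    rwa [h4] at h3
  have h := hx.conjugate_le_conjugate hle
  set R := (1 + x * x)⁻¹ʳ
  have h5 : x * R * x = 1 - R := by
    rw [mul_assoc, hcomm, ← mul_assoc]
    rw [add_mul, one_mul] at hr
    rw [← hr]; abel
  rw [h5, Algebra.algebraMap_eq_smul_one, mul_smul_comm, mul_one, smul_mul_assoc] at h
  exact le_sub_comm.1 h

open Ring in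
-- Apply the self-adjoint case to `|x|`, which has the same norm and square `x* x`.
theorem resolvent_star_mul_self_le {x : E →L[ℂ] E} {C : ℝ} (hC : ‖x‖ ≤ C) :
    (1 + star x * x)⁻¹ʳ ≤ 1 - ((1 + C ^ 2)⁻¹ : ℝ) • (star x * x) := by
  have h0 : 0 ≤ star x * x := star_mul_self_nonneg x
  have hs : IsSelfAdjoint (CFC.sqrt (star x * x)) := (CFC.sqrt_nonneg _).isSelfAdjoint
  have hmul := CFC.sqrt_mul_sqrt_self (star x * x) h0
  have hn : ‖CFC.sqrt (star x * x)‖ = ‖x‖ := by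
    rw [← mul_self_inj (norm_nonneg _) (norm_nonneg _), ← CStarRing.norm_star_mul_self (x := x),
      ← CStarRing.norm_star_mul_self, hs.star_eq, hmul]
  have := resolvent_sq_le hs (hn.trans_le hC)
  rwa [hmul] at this

theorem re_inner_mono {A B : E →L[ℂ] E} (h : A ≤ B) (ξ : E) :
    RCLike.re ⟪A ξ, ξ⟫_ℂ ≤ RCLike.re ⟪B ξ, ξ⟫_ℂ := by
  have := ((ContinuousLinearMap.nonneg_iff_isPositive _).1
    (sub_nonneg.2 h)).re_inner_nonneg_left ξ
  rw [sub_apply, inner_sub_left, map_sub] at this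
  linarith

theorem re_inner_star_mul_self (x : E →L[ℂ] E) (ξ : E) :
    RCLike.re ⟪(star x * x) ξ, ξ⟫_ℂ = ‖x ξ‖ ^ 2 := by
  rw [mul_apply_eq_comp, ContinuousLinearMap.star_eq_adjoint,
    ContinuousLinearMap.adjoint_inner_left, inner_self_eq_norm_sq]

open Ring in
/-- A noncommutative Borel–Cantelli lemma: a bounded sequence that is square-summable at `Ω` is
dominated by a decreasing sequence of contractions that vanishes at `Ω`. -/
theorem exists_antitone_dominating {N : VonNeumannAlgebra E} {Ω : E} {x : ℕ → E →L[ℂ] E}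
    (hx : ∀ n, x n ∈ N) {C : ℝ} (hC : ∀ n, ‖x n‖ ≤ C) (hxΩ : ∀ n, ‖x n Ω‖ ^ 2 ≤ (1 / 2) ^ n) :
    ∃ Q : ℕ → E →L[ℂ] E, (∀ n, Q n ∈ N) ∧ Antitone Q ∧ (∀ n, Q n ≤ 1) ∧
      (∀ n, ((1 + C ^ 2)⁻¹ : ℝ) • (star (x n) * x n) ≤ Q n) ∧
      Tendsto (fun n => RCLike.re ⟪Q n Ω, Ω⟫_ℂ) atTop (𝓝 0) := by
  set S : ℕ → ℕ → E →L[ℂ] E := fun n m => ∑ i ∈ Finset.Ico n m, star (x i) * x i with hS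
  have hS0 : ∀ n m, 0 ≤ S n m := fun n m => Finset.sum_nonneg fun i _ => star_mul_self_nonneg _
  have hSN : ∀ n m, S n m ∈ N := fun n m =>
    sum_mem fun i _ => mul_mem (star_mem (hx i)) (hx i)
  -- The function `1 - (1 + t)⁻¹` is operator monotone and bounded by 1. It turns the possibly
  -- unbounded tail sums `S n m` into contractions, increasing in `m` and decreasing in `n`; `Q n`
  -- is the strong limit as `m → ∞`.
  set T : ℕ → ℕ → E →L[ℂ] E := fun n m => 1 - (1 + S n m)⁻¹ʳ with hT
  have hTN : ∀ n m, T n m ∈ N := fun n m =>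
    sub_mem (one_mem _) (ringInverse_mem (add_mem (one_mem _) (hSN n m)))
  have hle : ∀ {n m n' m'}, S n m ≤ S n' m' → T n m ≤ T n' m' := fun h =>
    sub_le_sub_left (CStarAlgebra.ringInverse_le_ringInverse (add_le_add_right h 1)
      (isStrictlyPositive_one_add (hS0 _ _))) 1
  have hSle : ∀ {n m n' m'}, n' ≤ n → m ≤ m' → S n m ≤ S n' m' := fun h h' =>
    Finset.sum_le_sum_of_subset_of_nonneg (Finset.Ico_subset_Ico h h')
      fun i _ _ => star_mul_self_nonneg _
  have hT0 : ∀ n m, 0 ≤ T n m := fun n m => sub_nonneg.2 (resolvent_bounds (hS0 n m)).2.1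
  have hT1 : ∀ n m, T n m ≤ 1 := fun n m => sub_le_self _ (resolvent_bounds (hS0 n m)).1
  have hTS : ∀ n m, T n m ≤ S n m := fun n m => sub_le_comm.1 (resolvent_bounds (hS0 n m)).2.2
  choose Q hQlim hQge hQ1 using fun n => exists_tendsto_of_monotone (T := T n)
    (fun m m' h => hle (hSle le_rfl h)) (hT0 n) (hT1 n)
  have hQ0 : ∀ n, 0 ≤ Q n := fun n => (hT0 n 0).trans (hQge n 0)
  have hQle : ∀ n {B : E →L[ℂ] E}, (∀ m, T n m ≤ B) → Q n ≤ B := fun n B h => by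
    rw [← sub_nonneg]
    exact isPositive_of_tendsto (T := fun m => B - T n m)
      (Eventually.of_forall fun m => sub_nonneg.2 (h m)) fun ξ => (hQlim n ξ).const_sub _
  refine ⟨Q, fun n => mem_of_tendsto (hTN n) (hQlim n), fun n n' h => hQle _ fun m =>
    (hle (hSle h le_rfl)).trans (hQge n m), hQ1, fun n => ?_, ?_⟩
  -- The tail `Ico n (n + 1)` is the single term `x n* x n`.
  · refine le_trans ?_ (hQge n (n + 1))
    rw [hT, le_sub_comm]
    simpa [hS] using resolvent_star_mul_self_le (hC n)
  -- Since `T n m ≤ S n m`, the expectation of `Q n` at `Ω` is at most the geometric tail `∑_{i ≥ n}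
  -- (1/2)^i = 2 (1/2)^n`.
  · refine squeeze_zero (fun n => ?_) (fun n => ?_) (g := fun n => 2 * (1 / 2 : ℝ) ^ n) ?_
    · simpa using re_inner_mono (hQ0 n) Ω
    · have h1 : Tendsto (fun m => RCLike.re ⟪T n m Ω, Ω⟫_ℂ) atTop
          (𝓝 (RCLike.re ⟪Q n Ω, Ω⟫_ℂ)) :=
        (RCLike.continuous_re.tendsto _).comp ((hQlim n Ω).inner tendsto_const_nhds)
      refine le_of_tendsto h1 (Eventually.of_forall fun m => (re_inner_mono (hTS n m) Ω).trans ?_)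
      have h2 : RCLike.re ⟪S n m Ω, Ω⟫_ℂ = ∑ i ∈ Finset.Ico n m, ‖x i Ω‖ ^ 2 := by
        rw [hS]
        simp only [sum_apply, sum_inner, map_sum, re_inner_star_mul_self]
      rw [h2]
      refine (Finset.sum_le_sum fun i _ => hxΩ i).trans ?_
      have h3 := geom_sum_Ico_le_of_lt_one (m := n) (n := m) (x := (1 / 2 : ℝ)) (by norm_num)
        (by norm_num)
      refine h3.trans (le_of_eq ?_)
      ring
    · simpa using (tendsto_pow_atTop_nhds_zero_of_lt_one (r := (1 / 2 : ℝ)) (by norm_num)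
        (by norm_num)).const_mul 2

/-- Automorphisms of a von Neumann algebra with a separating vector are continuous, on bounded
sequences, for the topology given by that vector. -/
theorem eq_zero_of_tendsto {N : VonNeumannAlgebra E} {Ω : E} (hΩ : ‖Ω‖ = 1)
    (hsep : ∀ x ∈ N, x Ω = 0 → x = 0) (α : AutVN N) {x : ℕ → N.toStarSubalgebra} {C : ℝ}
    (hC : ∀ n, ‖(x n : E →L[ℂ] E)‖ ≤ C)
    (hx : Tendsto (fun n => (x n : E →L[ℂ] E) Ω) atTop (𝓝 0)) {δ : ℂ}
    (hδ : ∀ n, ⟪Ω, (α (x n) : E →L[ℂ] E) Ω⟫_ℂ = δ) : δ = 0 := by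
  -- Only a subsequence is needed, since the expectation `δ` is the same for every `n`.
  obtain ⟨k, -, hk⟩ := extraction_forall_of_eventually
    (P := fun n m => ‖(x m : E →L[ℂ] E) Ω‖ ^ 2 ≤ (1 / 2 : ℝ) ^ n) fun n => by
      have h := (hx.norm).pow 2
      rw [norm_zero, zero_pow two_ne_zero] at h
      exact h.eventually_le_const (by positivity)
  obtain ⟨Q, hQN, hQanti, hQ1, hQx, hQΩ⟩ := exists_antitone_dominating (N := N) (Ω := Ω)
    (x := fun n => (x (k n) : E →L[ℂ] E)) (fun n => (x (k n)).2) (fun n => hC (k n)) hk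
  have hQ0 : ∀ n, 0 ≤ Q n := fun n =>
    (smul_nonneg (by positivity) (star_mul_self_nonneg _)).trans (hQx n)
  let q : ℕ → N.toStarSubalgebra := fun n => ⟨Q n, hQN n⟩
  have hα1 : (α 1 : E →L[ℂ] E) = 1 := by rw [map_one]; rfl
  -- Without assuming normality of `α`, take the strong limit `Z` of the increasing sequence `α(1 -
  -- q n)`. Pulling `Z` back by the order isomorphism `α⁻¹` will show that it is 1.
  obtain ⟨Z, hZlim, hZge, hZ1⟩ := exists_tendsto_of_monotone
    (T := fun n => (α (1 - q n) : E →L[ℂ] E))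
    (fun n m h => map_le_map α (sub_le_sub_left (hQanti h) 1))
    (fun n => map_nonneg α (x := 1 - q n) (sub_nonneg.2 (hQ1 n)))
    (fun n => hα1 ▸ map_le_map α (x := 1 - q n) (y := 1) (sub_le_self _ (hQ0 n)))
  have hZN : Z ∈ N := mem_of_tendsto (fun n => (α (1 - q n)).2) hZlim
  set W : N.toStarSubalgebra := α.symm ⟨Z, hZN⟩ with hW
  have hWge : ∀ n, 1 - Q n ≤ W := fun n => by
    have := map_le_map α.symm (x := α (1 - q n)) (y := ⟨Z, hZN⟩) (hZge n)
    rwa [StarAlgEquiv.symm_apply_apply] at this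
  have hW1 : (W : E →L[ℂ] E) ≤ 1 := by
    have := map_le_map α.symm (x := ⟨Z, hZN⟩) (y := 1) hZ1
    rwa [map_one] at this
  -- As `1 - W ≤ Q n` for all `n`, the positive operator `1 - W` has expectation 0 at `Ω`; its
  -- square root kills the separating vector.
  have hWeq : (1 : E →L[ℂ] E) - W = 0 := by
    obtain ⟨b, hbN, hb⟩ := exists_star_mul_self (sub_mem (one_mem N) W.2) (sub_nonneg.2 hW1)
    have h1 : ‖b Ω‖ ^ 2 ≤ 0 := by
      rw [← re_inner_star_mul_self, ← hb]
      refine ge_of_tendsto hQΩ (Eventually.of_forall fun n => re_inner_mono ?_ Ω)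
      exact sub_le_comm.1 (hWge n)
    have h2 : b Ω = 0 := by
      rw [← norm_eq_zero, ← sq_eq_zero_iff]
      exact le_antisymm h1 (sq_nonneg _)
    rw [hb, hsep b hbN h2, mul_zero]
  have hZ : Z = 1 := by
    have h1 : W = 1 := Subtype.ext (sub_eq_zero.1 hWeq).symm
    have h2 : α W = ⟨Z, hZN⟩ := by rw [hW, StarAlgEquiv.apply_symm_apply]
    rw [h1, map_one] at h2
    exact (congrArg Subtype.val h2).symm
  have hlim : Tendsto (fun n => RCLike.re ⟪(α (q n) : E →L[ℂ] E) Ω, Ω⟫_ℂ) atTop (𝓝 0) := by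
    have h1 := (hZlim Ω).const_sub Ω
    rw [hZ, one_apply_eq_self, sub_self] at h1
    have h2 : Tendsto (fun n => (α (q n) : E →L[ℂ] E) Ω) atTop (𝓝 0) := by
      refine h1.congr fun n => ?_
      rw [map_sub, map_one]
      change Ω - (Ω - _) = _
      exact sub_sub_cancel _ _
    have h3 := (RCLike.continuous_re.tendsto _).comp
      (h2.inner (𝕜 := ℂ) (tendsto_const_nhds (x := Ω)))
    rw [inner_zero_left, map_zero] at h3
    exact h3
  -- `α` preserves the domination of `x n* x n` by `Q n`, and `‖α(x n) Ω‖ ≥ ‖δ‖` by Cauchy–Schwarz.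
  have hlow : ∀ n, (1 + C ^ 2)⁻¹ * ‖δ‖ ^ 2 ≤ RCLike.re ⟪(α (q n) : E →L[ℂ] E) Ω, Ω⟫_ℂ := by
    intro n
    have h1 := map_le_map α (x := ((((1 + C ^ 2)⁻¹ : ℝ) : ℂ) • (star (x (k n)) * x (k n))))
      (y := q n) (hQx n)
    refine le_trans ?_ (re_inner_mono h1 Ω)
    rw [map_smul, map_mul, map_star]
    change _ ≤ RCLike.re ⟪(((1 + C ^ 2)⁻¹ : ℝ) : ℂ) •
      (star (α (x (k n)) : E →L[ℂ] E) * (α (x (k n)) : E →L[ℂ] E)) Ω, Ω⟫_ℂ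
    rw [inner_smul_left, Complex.conj_ofReal]
    change _ ≤ (((((1 + C ^ 2)⁻¹ : ℝ) : ℂ)) * _).re
    rw [Complex.re_ofReal_mul]
    refine mul_le_mul_of_nonneg_left ?_ (by positivity)
    refine le_of_le_of_eq ?_ (re_inner_star_mul_self _ _).symm
    refine pow_le_pow_left₀ (norm_nonneg _) ?_ 2
    rw [← hδ (k n)]
    simpa [hΩ] using norm_inner_le_norm (𝕜 := ℂ) Ω ((α (x (k n)) : E →L[ℂ] E) Ω)
  have h := ge_of_tendsto hlim (Eventually.of_forall hlow)
  have h' : ‖δ‖ ^ 2 ≤ 0 := by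
    have hc : 0 < (1 + C ^ 2)⁻¹ := by positivity
    by_contra hh
    exact absurd (mul_pos hc (not_le.1 hh)) (not_lt.2 h)
  exact norm_eq_zero.1 (sq_eq_zero_iff.1 (le_antisymm h' (sq_nonneg _)))

/-- Let `V` be a unitary whose fixed vectors are the multiples of the separating vector `Ω`. Any
automorphism commuting with conjugation by `V` preserves the vector state of `Ω`. -/
theorem inner_map_eq_of_commute {N : VonNeumannAlgebra E} {Ω : E} (hΩ : ‖Ω‖ = 1)
    (hsep : ∀ x ∈ N, x Ω = 0 → x = 0) (V : unitary (E →L[ℂ] E)) (hVΩ : (V : E →L[ℂ] E) Ω = Ω)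
    (hV : ∀ ξ, (V : E →L[ℂ] E) ξ = ξ → ∃ c : ℂ, ξ = c • Ω) (θ : AutVN N)
    (hθ : ∀ x, (θ x : E →L[ℂ] E) = V * x * star (V : E →L[ℂ] E)) (α : AutVN N)
    (hα : ∀ x, α (θ x) = θ (α x)) (x : N.toStarSubalgebra) :
    ⟪Ω, (α x : E →L[ℂ] E) Ω⟫_ℂ = ⟪Ω, (x : E →L[ℂ] E) Ω⟫_ℂ := by
  have hVs : star (V : E →L[ℂ] E) Ω = Ω := by
    conv_lhs => rw [← hVΩ, ← mul_apply_eq_comp, Unitary.coe_star_mul_self]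
    rfl
  have hθΩ : ∀ z, (θ z : E →L[ℂ] E) Ω = (V : E →L[ℂ] E) ((z : E →L[ℂ] E) Ω) := fun z => by
    rw [hθ, mul_apply_eq_comp, mul_apply_eq_comp, hVs]
  have hθtr : ∀ z, ⟪Ω, (θ z : E →L[ℂ] E) Ω⟫_ℂ = ⟪Ω, (z : E →L[ℂ] E) Ω⟫_ℂ := fun z => by
    rw [hθΩ, ← ContinuousLinearMap.adjoint_inner_left, ← ContinuousLinearMap.star_eq_adjoint, hVs]
  have hVn : ‖(V : E →L[ℂ] E)‖ ≤ 1 := ContinuousLinearMap.opNorm_le_bound _ zero_le_one fun ξ => by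
    rw [one_mul]
    exact ((Unitary.linearIsometryEquiv V).norm_map ξ).le
  have hθn : ∀ z, ‖(θ z : E →L[ℂ] E)‖ ≤ ‖(z : E →L[ℂ] E)‖ := fun z => by
    rw [hθ]
    refine (norm_mul_le _ _).trans ?_
    rw [norm_star]
    refine (mul_le_of_le_one_right (norm_nonneg _) hVn).trans ?_
    exact (norm_mul_le _ _).trans (mul_le_of_le_one_left (norm_nonneg _) hVn)
  set t := ⟪Ω, (x : E →L[ℂ] E) Ω⟫_ℂ with ht
  set y : N.toStarSubalgebra := x - t • 1 with hy
  have hyΩ : (y : E →L[ℂ] E) Ω = (x : E →L[ℂ] E) Ω - t • Ω := rfl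
  have hytr : ⟪Ω, (y : E →L[ℂ] E) Ω⟫_ℂ = 0 := by
    rw [hyΩ, inner_sub_right, inner_smul_right, inner_self_eq_norm_sq_to_K, hΩ, ← ht]
    simp
  -- Averages of `y = x - t` along `θ`: `z n Ω` tends to 0 by ergodicity, while the expectation of
  -- `α(z n)` does not depend on `n`. The shift to `n + 1` avoids the empty average.
  set z : ℕ → N.toStarSubalgebra := fun n => birkhoffAverage ℂ θ _root_.id (n + 1) y with hz
  have hit : ∀ n, ((θ^[n] y : N.toStarSubalgebra) : E →L[ℂ] E) Ω =
      (V : E →L[ℂ] E)^[n] ((y : E →L[ℂ] E) Ω) := by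
    intro n
    induction n with
    | zero => rfl
    | succ n ih => rw [Function.iterate_succ_apply', Function.iterate_succ_apply', hθΩ, ih]
  have hαit : ∀ n, ⟪Ω, (α (θ^[n] y) : E →L[ℂ] E) Ω⟫_ℂ = ⟪Ω, (α y : E →L[ℂ] E) Ω⟫_ℂ := by
    intro n
    induction n with
    | zero => rfl
    | succ n ih => rw [Function.iterate_succ_apply', hα, hθtr, ih]
  have hnit : ∀ n, ‖((θ^[n] y : N.toStarSubalgebra) : E →L[ℂ] E)‖ ≤ ‖(y : E →L[ℂ] E)‖ := by
    intro n
    induction n with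
    | zero => rfl
    | succ n ih => rw [Function.iterate_succ_apply']; exact (hθn _).trans ih
  have hn0 : ∀ n : ℕ, ((n + 1 : ℕ) : ℂ) ≠ 0 := fun n => Nat.cast_ne_zero.2 n.succ_ne_zero
  have hcoe : ∀ n, ((z n : N.toStarSubalgebra) : E →L[ℂ] E) = ((n + 1 : ℕ) : ℂ)⁻¹ •
      ∑ i ∈ Finset.range (n + 1), ((θ^[i] y : N.toStarSubalgebra) : E →L[ℂ] E) := by
    intro n
    simp only [hz, birkhoffAverage, birkhoffSum, id]
    rw [← AddSubmonoidClass.coe_finsetSum]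
    rfl
  -- By the mean ergodic theorem the limit is the projection of `y Ω` onto the fixed vectors of `V`.
  -- These are the multiples of `Ω`, and `y Ω` is orthogonal to `Ω`.
  have hlim : Tendsto (fun n => (z n : E →L[ℂ] E) Ω) atTop (𝓝 0) := by
    have h1 := (ContinuousLinearMap.tendsto_birkhoffAverage_orthogonalProjection
      (V : E →L[ℂ] E) hVn ((y : E →L[ℂ] E) Ω)).comp (tendsto_add_atTop_nat 1)
    set K := (V : E →L[ℂ] E).eqLocus (1 : E →L[ℂ] E)
    have h2 : ((K.orthogonalProjectionOnto ((y : E →L[ℂ] E) Ω) : K) : E) = 0 := by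
      obtain ⟨c, hc⟩ := hV _ (K.orthogonalProjectionOnto ((y : E →L[ℂ] E) Ω)).2
      have h3 : ⟪Ω, ((K.orthogonalProjectionOnto ((y : E →L[ℂ] E) Ω) : K) : E)⟫_ℂ = 0 := by
        exact (K.inner_orthogonalProjectionOnto_eq_of_mem_left ⟨Ω, hVΩ⟩
          ((y : E →L[ℂ] E) Ω)).trans hytr
      rw [hc, inner_smul_right, inner_self_eq_norm_sq_to_K, hΩ] at h3
      simp only [RCLike.ofReal_one, one_pow, mul_one] at h3
      rw [hc, h3, zero_smul]
    rw [h2] at h1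
    refine h1.congr fun n => ?_
    rw [hcoe]
    simp only [Function.comp_apply, birkhoffAverage, birkhoffSum, id, smul_apply,
      sum_apply, hit]
  have hzero : ⟪Ω, (α y : E →L[ℂ] E) Ω⟫_ℂ = 0 := by
    refine eq_zero_of_tendsto hΩ hsep α (x := z) (C := ‖(y : E →L[ℂ] E)‖) (fun n => ?_) hlim
      fun n => ?_
    · rw [hcoe, norm_smul, norm_inv, Complex.norm_natCast, inv_mul_le_iff₀ (by positivity)]
      refine (norm_sum_le _ _).trans ((Finset.sum_le_sum fun i _ => hnit i).trans_eq ?_)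
      simp
    · have h1 : α (z n) = ((n + 1 : ℕ) : ℂ)⁻¹ • ∑ i ∈ Finset.range (n + 1), α (θ^[i] y) := by
        simp only [hz, birkhoffAverage, birkhoffSum, id]
        rw [map_smul, map_sum]
      have h2 : (α (z n) : E →L[ℂ] E) = ((n + 1 : ℕ) : ℂ)⁻¹ •
          ∑ i ∈ Finset.range (n + 1), (α (θ^[i] y) : E →L[ℂ] E) := by
        rw [h1, ← AddSubmonoidClass.coe_finsetSum]
        rfl
      rw [h2, smul_apply, sum_apply, inner_smul_right, inner_sum,
        Finset.sum_congr rfl fun i _ => hαit i, Finset.sum_const, Finset.card_range,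
        nsmul_eq_mul, inv_mul_cancel_left₀ (hn0 n)]
  have hαy : (α y : E →L[ℂ] E) Ω = (α x : E →L[ℂ] E) Ω - t • Ω := by
    rw [hy, map_sub, map_smul, map_one]
    rfl
  rw [hαy, inner_sub_right, inner_smul_right, inner_self_eq_norm_sq_to_K, hΩ] at hzero
  simp only [RCLike.ofReal_one, one_pow, mul_one] at hzero
  exact sub_eq_zero.1 hzero

end Abstract

/-! ### Dipoles in `Λ(H)`. -/

section Dipole

variable {H : Type*} [AddCommGroup H]

theorem permute_zero (e : Equiv.Perm Lattice) : permute e (0 : LambdaGroup H) = 0 := by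
  apply Subtype.ext; apply Finsupp.ext; intro k; rfl

theorem lambdaGroup_ext {l l' : LambdaGroup H}
    (h : ∀ m, (l : Lattice →₀ H) m = (l' : Lattice →₀ H) m) : l = l' :=
  Subtype.ext (Finsupp.ext h)

/-- An element of `Λ(H)` is determined by its values off a point. -/
theorem lambdaGroup_ext_of_ne {l l' : LambdaGroup H} (m₀ : Lattice)
    (h : ∀ m, m ≠ m₀ → (l : Lattice →₀ H) m = (l' : Lattice →₀ H) m) : l = l' := by
  rw [← sub_eq_zero]
  have h1 : ∀ m, m ≠ m₀ → ((l - l' : LambdaGroup H) : Lattice →₀ H) m = 0 := fun m hm =>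
    sub_eq_zero.2 (h m hm)
  have h2 : ∑ᶠ k, ((l - l' : LambdaGroup H) : Lattice →₀ H) k = 0 := (l - l').2
  rw [finsum_eq_single _ m₀ h1] at h2
  refine lambdaGroup_ext fun m => ?_
  by_cases hm : m = m₀
  · rw [hm, h2]; rfl
  · rw [h1 m hm]; rfl

/-- The element `h δ_m - h δ_n` of `Λ(H)`. -/
def dipole (h : H) (m n : Lattice) : LambdaGroup H :=
  ⟨Finsupp.single m h - Finsupp.single n h, by
    have hs : ∀ m : Lattice, ∑ᶠ k, (Finsupp.single m h : Lattice →₀ H) k = h := fun m => by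
      rw [finsum_eq_single _ m fun k hk => Finsupp.single_eq_of_ne hk, Finsupp.single_eq_same]
    change ∑ᶠ k, ((Finsupp.single m h : Lattice →₀ H) k - (Finsupp.single n h : Lattice →₀ H) k) = 0
    rw [finsum_sub_distrib (Finsupp.hasFiniteSupport _) (Finsupp.hasFiniteSupport _), hs, hs,
      sub_self]⟩

theorem dipole_apply (h : H) (m n k : Lattice) : (dipole h m n : Lattice →₀ H) k =
    (Finsupp.single m h : Lattice →₀ H) k - (Finsupp.single n h : Lattice →₀ H) k := rfl

theorem permute_dipole (e : Equiv.Perm Lattice) (h : H) (m n : Lattice) :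
    permute e (dipole h m n) = dipole h (e m) (e n) := by
  classical
  refine lambdaGroup_ext fun k => ?_
  rw [permute_apply, dipole_apply, dipole_apply]
  simp only [Finsupp.single_apply, Equiv.eq_symm_apply]

theorem dipole_add_dipole (h : H) (k m n : Lattice) :
    dipole h k m + dipole h m n = dipole h k n :=
  Subtype.ext (sub_add_sub_cancel _ _ _)

theorem neg_dipole (h : H) (m n : Lattice) : -dipole h m n = dipole h n m :=
  Subtype.ext (neg_sub _ _)

theorem dipole_neg (h : H) (m n : Lattice) : dipole (-h) m n = dipole h n m := by
  refine lambdaGroup_ext fun k => ?_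
  rw [dipole_apply, dipole_apply, Finsupp.single_neg, Finsupp.single_neg, Finsupp.neg_apply,
    Finsupp.neg_apply]
  abel

theorem dipole_self (h : H) (m : Lattice) : dipole h m m = 0 :=
  Subtype.ext (sub_self _)

theorem dipole_apply_left (h : H) {m n : Lattice} (hmn : m ≠ n) :
    (dipole h m n : Lattice →₀ H) m = h := by
  rw [dipole_apply, Finsupp.single_eq_same, Finsupp.single_eq_of_ne hmn, sub_zero]

theorem dipole_apply_right (h : H) {m n : Lattice} (hmn : m ≠ n) :
    (dipole h m n : Lattice →₀ H) n = -h := by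
  rw [dipole_apply, Finsupp.single_eq_same, Finsupp.single_eq_of_ne hmn.symm, zero_sub]

theorem dipole_apply_of_ne (h : H) {m n k : Lattice} (hm : k ≠ m) (hn : k ≠ n) :
    (dipole h m n : Lattice →₀ H) k = 0 := by
  rw [dipole_apply, Finsupp.single_eq_of_ne hm, Finsupp.single_eq_of_ne hn, sub_zero]

/-- The dipoles based at the origin generate `Λ(H)`. -/
theorem mem_of_dipole_mem (P : AddSubgroup (LambdaGroup H)) (hP : ∀ h m, dipole h 0 m ∈ P)
    (l : LambdaGroup H) : l ∈ P := by
  classical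
  have h1 : l = ∑ m ∈ (l : Lattice →₀ H).support, -dipole ((l : Lattice →₀ H) m) 0 m := by
    -- The value at the origin is forced by the vanishing total sum, so it need not be computed.
    refine lambdaGroup_ext_of_ne 0 fun k hk => ?_
    have h2 : ((∑ m ∈ (l : Lattice →₀ H).support, -dipole ((l : Lattice →₀ H) m) 0 m :
        LambdaGroup H) : Lattice →₀ H) =
        ∑ m ∈ (l : Lattice →₀ H).support,
          ((-dipole ((l : Lattice →₀ H) m) 0 m : LambdaGroup H) : Lattice →₀ H) :=
      AddSubmonoidClass.coe_finsetSum _ _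
    rw [h2, Finsupp.finsetSum_apply]
    simp only [neg_dipole, dipole_apply, Finsupp.single_eq_of_ne hk, sub_zero]
    simp [Finsupp.single_apply]
  rw [h1]
  exact sum_mem fun m _ => neg_mem (hP _ m)

theorem finprod_char_dipole (χ : AddChar H Circle) (w : Lattice → ℤ) (h : H) (m n : Lattice) :
    ∏ᶠ k, χ ((dipole h m n : Lattice →₀ H) k) ^ w k = χ h ^ w m * (χ h ^ w n)⁻¹ := by
  have hs : ∀ m : Lattice, ∏ᶠ k, χ ((Finsupp.single m h : Lattice →₀ H) k) ^ w k = χ h ^ w m :=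
    fun m => by
      rw [finprod_eq_single _ m fun k hk => by rw [Finsupp.single_eq_of_ne hk]; simp,
        Finsupp.single_eq_same]
  rw [← hs m, ← hs n, ← div_eq_mul_inv, ← finprod_div_distrib (finite_mulSupport_char χ w _)
    (finite_mulSupport_char χ w _)]
  refine finprod_congr fun k => ?_
  rw [dipole_apply, AddChar.map_sub_eq_div, div_zpow]

theorem actionPhase_dipole (χ : AddChar H Circle) (g : AffineSL) (h : H) (m n : Lattice) :
    actionPhase χ g (dipole h m n) = χ h ^ latticeDet (trans g) (slMulVec g.right m) *
      (χ h ^ latticeDet (trans g) (slMulVec g.right n))⁻¹ := by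
  rw [actionPhase_eq]
  exact finprod_char_dipole χ (fun k => latticeDet (trans g) (slMulVec g.right k)) h m n

theorem actionPhase_zero (χ : AddChar H Circle) (g : AffineSL) :
    actionPhase χ g (0 : LambdaGroup H) = 1 := by
  simp [actionPhase_eq]

end Dipole

/-! ### Fourier coefficients under the twisted Bernoulli shift. -/

section Action

variable {H : Type*} [AddCommGroup H] {μ : NormalizedTwoCocycle H} {χ : AddChar H Circle}

theorem shiftRep_apply_permute (g : AffineSL) (ξ : EllTwo (LambdaGroup H)) (l : LambdaGroup H) :
    ((shiftRep χ g : EllTwo (LambdaGroup H) →L[ℂ] EllTwo (LambdaGroup H)) ξ)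
      (permute (affinePerm g) l) = (actionPhase χ g l : ℂ) * ξ l := by
  change ((weightedUnitary (permute (affinePerm g)) (actionPhase χ g) :
    EllTwo (LambdaGroup H) →L[ℂ] EllTwo (LambdaGroup H)) ξ) _ = _
  rw [weightedUnitary_apply, Equiv.symm_apply_apply]

theorem shiftRep_basisVec_zero (g : AffineSL) :
    (shiftRep χ g : EllTwo (LambdaGroup H) →L[ℂ] EllTwo (LambdaGroup H)) (basisVec 0) =
      basisVec 0 := by
  refine (weightedUnitary_basisVec _ _ _).trans ?_
  rw [actionPhase_zero, permute_zero, Circle.coe_one, one_smul]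

theorem unitary_star_apply_eq {E : Type*} [NormedAddCommGroup E] [InnerProductSpace ℂ E]
    [CompleteSpace E] (V : unitary (E →L[ℂ] E)) {ξ : E} (h : (V : E →L[ℂ] E) ξ = ξ) :
    star (V : E →L[ℂ] E) ξ = ξ := by
  conv_lhs => rw [← h, ← mul_apply_eq_comp, Unitary.coe_star_mul_self]
  rfl

theorem coe_bernoulliAction (g : AffineSL) (x : (bernoulliVN μ).toStarSubalgebra) :
    (bernoulliAction μ χ g x : EllTwo (LambdaGroup H) →L[ℂ] EllTwo (LambdaGroup H)) =
      (shiftRep χ g : EllTwo (LambdaGroup H) →L[ℂ] EllTwo (LambdaGroup H)) * x *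
        star (shiftRep χ g : EllTwo (LambdaGroup H) →L[ℂ] EllTwo (LambdaGroup H)) := rfl

/-- The vector of Fourier coefficients of an element of `N(H, μ)`. -/
def fourier (x : (bernoulliVN μ).toStarSubalgebra) : EllTwo (LambdaGroup H) :=
  (x : EllTwo (LambdaGroup H) →L[ℂ] EllTwo (LambdaGroup H)) (basisVec 0)

theorem fourier_injective : Function.Injective (fourier (μ := μ)) := fun x y h =>
  Subtype.ext (eq_of_apply_basisVec_zero x.2 y.2 h)

theorem fourier_smul (c : ℂ) (x : (bernoulliVN μ).toStarSubalgebra) :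
    fourier (c • x) = c • fourier x := rfl

theorem fourier_bernoulliUnitary (l : LambdaGroup H) :
    fourier (bernoulliUnitary μ l) = basisVec l :=
  twistedTranslation_basisVec_zero _ l

theorem eq_smul_bernoulliUnitary {x : (bernoulliVN μ).toStarSubalgebra} {l : LambdaGroup H}
    {a : ℂ} (h : fourier x = a • basisVec l) : x = a • bernoulliUnitary μ l :=
  fourier_injective (by rw [h, fourier_smul, fourier_bernoulliUnitary])

/-- The implementing unitary fixes `δ_0`, so conjugation by it acts on coefficient vectors as the
unitary itself. -/
theorem fourier_bernoulliAction (g : AffineSL) (x : (bernoulliVN μ).toStarSubalgebra) :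
    fourier (bernoulliAction μ χ g x) =
      (shiftRep χ g : EllTwo (LambdaGroup H) →L[ℂ] EllTwo (LambdaGroup H)) (fourier x) := by
  rw [fourier, coe_bernoulliAction, mul_apply_eq_comp, mul_apply_eq_comp,
    unitary_star_apply_eq _ (shiftRep_basisVec_zero g), fourier]

theorem fourier_bernoulliAction_permute (g : AffineSL) (x : (bernoulliVN μ).toStarSubalgebra)
    (l : LambdaGroup H) :
    fourier (bernoulliAction μ χ g x) (permute (affinePerm g) l) =
      (actionPhase χ g l : ℂ) * fourier x l := by
  rw [fourier_bernoulliAction, shiftRep_apply_permute]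

theorem hasSum_fourier_mul (x y : (bernoulliVN μ).toStarSubalgebra) (l : LambdaGroup H) :
    HasSum (fun κ => ((cocycleTilde μ).toFun (l - κ) κ : ℂ) * fourier x (l - κ) * fourier y κ)
      (fourier (x * y) l) :=
  hasSum_mul_coeff (μ := cocycleTilde μ) (y := y) x.2 l

/-- The Fourier coefficients of a vector fixed by `g` are supported on functions whose support
contains no point with an infinite `g`-orbit. -/
theorem eq_zero_of_shiftRep_fixed {g : AffineSL} {ξ : EllTwo (LambdaGroup H)}
    (hξ : (shiftRep χ g : EllTwo (LambdaGroup H) →L[ℂ] EllTwo (LambdaGroup H)) ξ = ξ)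
    {l : LambdaGroup H} (hl : ξ l ≠ 0) {m : Lattice}
    (hm : Function.Injective fun n : ℕ => (affinePerm g)^[n] m) : (l : Lattice →₀ H) m = 0 := by
  by_contra hlm
  -- The modulus of a fixed vector is constant along orbits, because the action only multiplies
  -- coefficients by phases.
  have hnorm : ∀ n : ℕ, ‖ξ ((permute (affinePerm g))^[n] l)‖ = ‖ξ l‖ := by
    intro n
    induction n with
    | zero => rfl
    | succ n ih =>
      rw [Function.iterate_succ_apply', ← ih]
      conv_lhs => rw [← hξ, shiftRep_apply_permute, norm_mul, Circle.norm_coe, one_mul]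
  have hval : ∀ n : ℕ, (((permute (affinePerm g))^[n] l : LambdaGroup H) : Lattice →₀ H)
      ((affinePerm g)^[n] m) = (l : Lattice →₀ H) m := by
    intro n
    induction n with
    | zero => rfl
    | succ n ih =>
      rw [Function.iterate_succ_apply', Function.iterate_succ_apply', permute_apply,
        Equiv.symm_apply_apply, ih]
  -- Only finitely many functions carry a coefficient of modulus `‖ξ l‖`, so their supports cover
  -- finitely many points; yet they would contain the infinite orbit of `m`.
  have hfin := (finite_norm_eq ξ (norm_pos_iff.2 hl)).biUnion
    (t := fun l' => ((l' : Lattice →₀ H).support : Set Lattice)) fun l' _ => Finset.finite_toSet _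
  refine Set.infinite_of_injective_forall_mem hm (fun n => ?_) hfin
  refine Set.mem_biUnion (x := (permute (affinePerm g))^[n] l) (hnorm n) ?_
  simpa [hval n] using hlm

/-! ### Some elements of `ℤ² ⋊ SL(2, ℤ)` -/

/-- The affine map with linear part `γ` and translation part `k`. -/
def affine (k : Lattice) (γ : SL(2, ℤ)) : AffineSL := ⟨Multiplicative.ofAdd k, γ⟩

theorem affinePerm_affine (k : Lattice) (γ : SL(2, ℤ)) (m : Lattice) :
    affinePerm (affine k γ) m = k + slMulVec γ m := rfl

/-- `(1 1; 0 1)` -/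
def upperShear : SL(2, ℤ) := ⟨!![1, 1; 0, 1], by simp⟩

/-- `(1 0; 1 1)` -/
def lowerShear : SL(2, ℤ) := ⟨!![1, 0; 1, 1], by simp⟩

/-- `(0 -1; 1 0)` -/
def quarterTurn : SL(2, ℤ) := ⟨!![0, -1; 1, 0], by simp⟩

theorem slMulVec_upperShear (m : Lattice) : slMulVec upperShear m = ![m 0 + m 1, m 1] := by
  ext i; fin_cases i <;> simp [slMulVec, upperShear, Matrix.mulVec, dotProduct, Fin.sum_univ_two]

theorem slMulVec_lowerShear (m : Lattice) : slMulVec lowerShear m = ![m 0, m 0 + m 1] := by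
  ext i; fin_cases i <;> simp [slMulVec, lowerShear, Matrix.mulVec, dotProduct, Fin.sum_univ_two]

theorem slMulVec_quarterTurn (m : Lattice) : slMulVec quarterTurn m = ![-m 1, m 0] := by
  ext i; fin_cases i <;> simp [slMulVec, quarterTurn, Matrix.mulVec, dotProduct, Fin.sum_univ_two]

theorem slMulVec_neg_one (m : Lattice) : slMulVec (-1) m = -m := by
  ext i; fin_cases i <;> simp [slMulVec, Matrix.neg_mulVec]

/-- A vector fixed by the translation by `(1, 0)` is a multiple of `δ_0`. -/
theorem eq_smul_of_translation_fixed {ξ : EllTwo (LambdaGroup H)}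
    (hξ : (shiftRep χ (affine ![1, 0] 1) :
      EllTwo (LambdaGroup H) →L[ℂ] EllTwo (LambdaGroup H)) ξ = ξ) : ξ = ξ 0 • basisVec 0 := by
  refine eq_smul_basisVec fun l hl => ?_
  by_contra h0
  refine hl (lambdaGroup_ext fun m => eq_zero_of_shiftRep_fixed hξ h0 ?_)
  have hit : ∀ n : ℕ, ((affinePerm (affine ![1, 0] 1))^[n] m) 0 = n + m 0 := by
    intro n
    induction n with
    | zero => simp
    | succ n ih =>
      rw [Function.iterate_succ_apply', affinePerm_affine, slMulVec_one, Pi.add_apply, ih]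
      simp; ring
  intro a b hab
  have := congrFun hab 0
  simp only [hit] at this
  exact_mod_cast add_right_cancel this

/-- The Fourier coefficients of an element fixed by the upper shear are supported on functions
supported on the first coordinate axis. -/
theorem apply_eq_zero_of_upperShear_fixed {x : (bernoulliVN μ).toStarSubalgebra}
    (hx : bernoulliAction μ χ (affine 0 upperShear) x = x) {l : LambdaGroup H}
    (hl : fourier x l ≠ 0)
    {m : Lattice} (hm : m 1 ≠ 0) : (l : Lattice →₀ H) m = 0 := by
  refine eq_zero_of_shiftRep_fixed (χ := χ) (g := affine 0 upperShear) ?_ hl ?_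
  · rw [← fourier_bernoulliAction, hx]
  have hit : ∀ n : ℕ, ((affinePerm (affine 0 upperShear))^[n] m) 0 = n * m 1 + m 0 ∧
      ((affinePerm (affine 0 upperShear))^[n] m) 1 = m 1 := by
    intro n
    induction n with
    | zero => simp
    | succ n ih =>
      rw [Function.iterate_succ_apply', affinePerm_affine, slMulVec_upperShear, zero_add]
      simp [ih]; ring
  intro a b hab
  have := congrFun hab 0
  simp only [hit] at this
  exact_mod_cast mul_right_cancel₀ hm (add_right_cancel this)

/-- Let `ξ`, `η`, `ζ` be supported on functions living on the first axis, the line `{m | m 0 = 1}`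
and the diagonal. If products of `ξ` and `η` contribute to `ζ`, then `ξ` is supported on a single
dipole. -/
theorem exists_support_eq_dipole {ξ η ζ : LambdaGroup H → ℂ}
    (hξ : ∀ {l}, ξ l ≠ 0 → ∀ {m : Lattice}, m 1 ≠ 0 → (l : Lattice →₀ H) m = 0)
    (hη : ∀ {l}, η l ≠ 0 → ∀ {m : Lattice}, m 0 ≠ 1 → (l : Lattice →₀ H) m = 0)
    (hζ : ∀ {l}, ζ l ≠ 0 → ∀ {m : Lattice}, m 0 ≠ m 1 → (l : Lattice →₀ H) m = 0)
    (hprod : ∀ {l κ}, ξ l ≠ 0 → η κ ≠ 0 → ζ (l + κ) ≠ 0) (hη0 : ∃ κ, η κ ≠ 0) :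
    ∃ h : H, ∀ l, ξ l ≠ 0 → l = dipole h 0 ![1, 0] := by
  obtain ⟨κ, hκ⟩ := hη0
  have hne : (![1, 0] : Lattice) ≠ 0 := fun h => by simpa using congrFun h 0
  -- The sum `l + κ` vanishes off the diagonal. At (1,0) this gives `l = -κ`; at the other nonzero
  -- points of the axis `κ` is already zero, so `l` is too. The same `κ` works for every `l`, so the
  -- dipole is unique.
  refine ⟨(κ : Lattice →₀ H) ![1, 0], fun l hl => lambdaGroup_ext_of_ne 0 fun m hm => ?_⟩
  by_cases hm1 : m = ![1, 0]
  · have h2 : (l : Lattice →₀ H) m + (κ : Lattice →₀ H) m = 0 :=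
      hζ (hprod hl hκ) (m := m) (by rw [hm1]; simp)
    rw [hm1] at h2 ⊢
    rw [dipole_apply_right _ hne.symm]
    exact eq_neg_of_add_eq_zero_left h2
  · rw [dipole_apply_of_ne _ hm hm1]
    by_contra hlm
    have hm10 : m 1 = 0 := by
      by_contra h
      exact hlm (hξ hl h)
    have hm0 : m 0 ≠ 1 := fun h => hm1 (by ext i; fin_cases i <;> simp [hm10, h])
    have hm0' : m 0 ≠ m 1 := fun h => hm (by
      rw [hm10] at h
      ext i; fin_cases i <;> simp [hm10, h])
    have h1 : (l : Lattice →₀ H) m + (κ : Lattice →₀ H) m = 0 := hζ (hprod hl hκ) hm0'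
    rw [hη hκ hm0, add_zero] at h1
    exact hlm h1

/-- The Fourier coefficients of a product of elements supported on the first axis and on the line
`{m | m 0 = 1}` are the products of the Fourier coefficients. -/
theorem fourier_mul_add {x y : (bernoulliVN μ).toStarSubalgebra}
    (hx : ∀ {l}, fourier x l ≠ 0 → ∀ {m : Lattice}, m 1 ≠ 0 → (l : Lattice →₀ H) m = 0)
    (hy : ∀ {l}, fourier y l ≠ 0 → ∀ {m : Lattice}, m 0 ≠ 1 → (l : Lattice →₀ H) m = 0)
    {l κ : LambdaGroup H} (hl : fourier x l ≠ 0) (hκ : fourier y κ ≠ 0) :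
    fourier (x * y) (l + κ) =
      ((cocycleTilde μ).toFun l κ : ℂ) * fourier x l * fourier y κ := by
  refine (hasSum_fourier_mul x y (l + κ)).unique ?_
  convert hasSum_single κ fun κ' hne => ?_ using 1
  · rw [add_sub_cancel_right]
  · by_contra h5
    have hκ' := right_ne_zero_of_mul h5
    have hl' := right_ne_zero_of_mul (left_ne_zero_of_mul h5)
    -- The axis and the line `m 0 = 1` meet only at (1,0). Away from that point the sum `l + κ`
    -- determines its second summand, and the zero-sum condition determines the value there.
    refine hne (lambdaGroup_ext_of_ne ![1, 0] fun m hm => ?_)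
    by_cases hm0 : m 0 = 1
    · have hm1 : m 1 ≠ 0 := fun h => hm (by ext i; fin_cases i <;> simp [hm0, h])
      have h7 : (l : Lattice →₀ H) m + (κ : Lattice →₀ H) m - (κ' : Lattice →₀ H) m = 0 :=
        hx hl' hm1
      rw [hx hl hm1, zero_add] at h7
      exact (sub_eq_zero.1 h7).symm
    · rw [hy hκ hm0, hy hκ' hm0]

/-- Support conditions on Fourier coefficients are transported by the action. -/
theorem apply_eq_zero_of_fourier_bernoulliAction {x : (bernoulliVN μ).toStarSubalgebra}
    {P Q : Lattice → Prop} (g : AffineSL)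
    (hx : ∀ {l}, fourier x l ≠ 0 → ∀ {m : Lattice}, P m → (l : Lattice →₀ H) m = 0)
    (hPQ : ∀ m, Q (affinePerm g m) → P m) {l : LambdaGroup H}
    (hl : fourier (bernoulliAction μ χ g x) l ≠ 0) {m : Lattice} (hm : Q m) :
    (l : Lattice →₀ H) m = 0 := by
  obtain ⟨l, rfl⟩ := (permute (affinePerm g)).surjective l
  obtain ⟨m, rfl⟩ := (affinePerm g).surjective m
  rw [permute_apply, Equiv.symm_apply_apply]
  rw [fourier_bernoulliAction_permute] at hl
  exact hx (right_ne_zero_of_mul hl) (hPQ m hm)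

/-- An element fixed by the upper shear, whose product with its image on the line `{m | m 0 = 1}`
is its image on the diagonal, is a multiple of the canonical unitary of a dipole. -/
theorem exists_eq_smul_dipole {x : (bernoulliVN μ).toStarSubalgebra} (hx0 : x ≠ 0)
    (hx : bernoulliAction μ χ (affine 0 upperShear) x = x) {d : ℂ}
    (hmul : x * bernoulliAction μ χ (affine ![1, 0] quarterTurn) x =
      d • bernoulliAction μ χ (affine 0 lowerShear) x) :
    ∃ (h : H) (a : ℂ), a ≠ 0 ∧ x = a • bernoulliUnitary μ (dipole h 0 ![1, 0]) := by
  have hsupp : ∀ {l : LambdaGroup H}, fourier x l ≠ 0 → ∀ {m : Lattice}, m 1 ≠ 0 →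
      (l : Lattice →₀ H) m = 0 := fun hl m hm => apply_eq_zero_of_upperShear_fixed hx hl hm
  have hη : ∀ {l : LambdaGroup H},
      fourier (bernoulliAction μ χ (affine ![1, 0] quarterTurn) x) l ≠ 0 → ∀ {m : Lattice},
      m 0 ≠ 1 → (l : Lattice →₀ H) m = 0 := by
    intro l hl m hm
    refine apply_eq_zero_of_fourier_bernoulliAction (Q := fun m => m 0 ≠ 1) _ hsupp
      (fun m h h0 => h ?_) hl hm
    rw [affinePerm_affine, slMulVec_quarterTurn]
    simp [h0]
  have hζ : ∀ {l : LambdaGroup H},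
      fourier (bernoulliAction μ χ (affine 0 lowerShear) x) l ≠ 0 → ∀ {m : Lattice},
      m 0 ≠ m 1 → (l : Lattice →₀ H) m = 0 := by
    intro l hl m hm
    refine apply_eq_zero_of_fourier_bernoulliAction (Q := fun m => m 0 ≠ m 1) _ hsupp
      (fun m h h0 => h ?_) hl hm
    rw [affinePerm_affine, slMulVec_lowerShear]
    simp [h0]
  obtain ⟨l₁, hl₁⟩ : ∃ l₁, fourier x l₁ ≠ 0 := by
    by_contra hcon
    push Not at hcon
    refine hx0 (fourier_injective ?_)
    ext l
    exact hcon l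
  -- A single term contributes to each coefficient of the product, so nonzero coefficients cannot
  -- cancel.
  obtain ⟨h, hh⟩ := exists_support_eq_dipole hsupp hη hζ (fun {l κ} hl hκ hz => by
      have h1 := fourier_mul_add hsupp hη hl hκ
      rw [hmul, fourier_smul] at h1
      refine mul_ne_zero (mul_ne_zero (Circle.coe_ne_zero _) hl) hκ (h1.symm.trans ?_)
      change d * _ = 0
      rw [hz, mul_zero])
    ⟨permute (affinePerm (affine ![1, 0] quarterTurn)) l₁, by
      rw [fourier_bernoulliAction_permute]
      exact mul_ne_zero (Circle.coe_ne_zero _) hl₁⟩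
  refine ⟨h, fourier x l₁, hl₁, eq_smul_bernoulliUnitary ?_⟩
  rw [← hh l₁ hl₁]
  refine eq_smul_basisVec fun l hl => ?_
  by_contra h0
  exact hl ((hh l h0).trans (hh l₁ hl₁).symm)

end Action

/-! ### Images of the edge unitaries under an automorphism in the centralizer. -/

section Centralizer

variable {H : Type*} [AddCommGroup H] {μ : NormalizedTwoCocycle H} {χ : AddChar H Circle}

/-! The following instances of general facts spare the elaborator the unification of the
ambient structure on `ℓ²(Λ(H))`. -/

theorem bernoulliAut_mul (α : AutVN (bernoulliVN μ)) (x y : (bernoulliVN μ).toStarSubalgebra) :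
    α (x * y) = α x * α y := map_mul α x y

theorem bernoulliAut_smul (α : AutVN (bernoulliVN μ)) (c : ℂ)
    (x : (bernoulliVN μ).toStarSubalgebra) : α (c • x) = c • α x := map_smul α c x

theorem bernoulliAut_star (α : AutVN (bernoulliVN μ)) (x : (bernoulliVN μ).toStarSubalgebra) :
    α (star x) = star (α x) := map_star α x

theorem bernoulliAut_one (α : AutVN (bernoulliVN μ)) : α 1 = 1 := map_one α

theorem bernoulliAut_ne_zero (α : AutVN (bernoulliVN μ)) {x : (bernoulliVN μ).toStarSubalgebra}
    (hx : x ≠ 0) : α x ≠ 0 := (map_ne_zero_iff α α.injective).2 hx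

theorem bernoulliVN_smul_mul_smul (c d : ℂ) (x y : (bernoulliVN μ).toStarSubalgebra) :
    (c • x) * (d • y) = (c * d) • (x * y) := smul_mul_smul_comm c x d y

theorem bernoulliVN_mul_smul (d : ℂ) (x y : (bernoulliVN μ).toStarSubalgebra) :
    x * (d • y) = d • (x * y) := mul_smul_comm d x y

theorem bernoulliVN_smul_smul (c d : ℂ) (x : (bernoulliVN μ).toStarSubalgebra) :
    c • d • x = (c * d) • x := smul_smul c d x

theorem bernoulliVN_smul_right_cancel {c d : ℂ} {x : (bernoulliVN μ).toStarSubalgebra}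
    (hx : x ≠ 0) (h : c • x = d • x) : c = d := smul_left_injective ℂ hx h

theorem bernoulliVN_smul_left_cancel {c : ℂ} (hc : c ≠ 0)
    {x y : (bernoulliVN μ).toStarSubalgebra} (h : c • x = c • y) : x = y :=
  smul_right_injective _ hc h

theorem mem_bernoulliCentralizer_iff {α : AutVN (bernoulliVN μ)} :
    α ∈ bernoulliCentralizer μ χ ↔
      ∀ g x, α (bernoulliAction μ χ g x) = bernoulliAction μ χ g (α x) := by
  rw [bernoulliCentralizer, Subgroup.mem_centralizer_iff]
  constructor
  · intro h g x
    exact (DFunLike.congr_fun (h _ (Set.mem_range_self g)) x).symm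
  · rintro h _ ⟨g, rfl⟩
    exact StarAlgEquiv.ext fun x => (h g x).symm

theorem bernoulliUnitary_ne_zero (l : LambdaGroup H) : bernoulliUnitary μ l ≠ 0 := fun h =>
  basisVec_ne_zero l (by rw [← fourier_bernoulliUnitary (μ := μ), h]; rfl)

theorem bernoulliUnitary_mul (l l' : LambdaGroup H) :
    bernoulliUnitary μ l * bernoulliUnitary μ l' =
      ((cocycleTilde μ).toFun l l' : ℂ) • bernoulliUnitary μ (l + l') :=
  Subtype.ext (twistedTranslation_mul (cocycleTilde μ) l l')

theorem star_bernoulliUnitary (l : LambdaGroup H) :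
    star (bernoulliUnitary μ l) =
      ((((cocycleTilde μ).toFun l (-l))⁻¹ : Circle) : ℂ) • bernoulliUnitary μ (-l) :=
  Subtype.ext (star_twistedTranslation (cocycleTilde μ) l)

theorem smul_bernoulliUnitary_inj {a b : ℂ} {l l' : LambdaGroup H} (ha : a ≠ 0)
    (h : a • bernoulliUnitary μ l = b • bernoulliUnitary μ l') : l = l' ∧ a = b := by
  have h1 : a • (basisVec l : EllTwo (LambdaGroup H)) = b • basisVec l' := by
    rw [← fourier_bernoulliUnitary (μ := μ), ← fourier_bernoulliUnitary (μ := μ), ← fourier_smul,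
      h, fourier_smul]
  have h2 := smul_basisVec_injective ha h1
  subst h2
  exact ⟨rfl, bernoulliVN_smul_right_cancel (bernoulliUnitary_ne_zero l) h⟩

theorem vec_zero_zero : (![0, 0] : Lattice) = 0 := by
  ext i; fin_cases i <;> rfl

/-- The dipole on the edge from the origin to `(1, 0)`. -/
def edge (h : H) : LambdaGroup H := dipole h 0 ![1, 0]

theorem edge_injective : Function.Injective (edge (H := H)) := fun h h' hh => by
  have hne : (0 : Lattice) ≠ ![1, 0] := fun h => by simpa using congrFun h 0
  rw [← dipole_apply_left h hne, ← dipole_apply_left h' hne]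
  exact congrArg (fun l : LambdaGroup H => (l : Lattice →₀ H) 0) hh

variable (μ χ) in
/-- The scalar in the relation between the canonical unitaries of the edges of a triangle. -/
def trianglePhase (h : H) : Circle :=
  (χ h)⁻¹ * (cocycleTilde μ).toFun (edge h) (dipole h ![1, 0] ![1, 1])

theorem actionPhase_affine_zero (γ : SL(2, ℤ)) (h : H) (m n : Lattice) :
    actionPhase χ (affine 0 γ) (dipole h m n) = 1 := by
  rw [actionPhase_dipole]
  simp [affine, trans, latticeDet]

theorem bernoulliAction_upperShear (h : H) :
    bernoulliAction μ χ (affine 0 upperShear) (bernoulliUnitary μ (edge h)) =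
      bernoulliUnitary μ (edge h) := by
  rw [bernoulliAction_bernoulliUnitary, edge, actionPhase_affine_zero, permute_dipole,
    affinePerm_affine, affinePerm_affine, slMulVec_upperShear, slMulVec_upperShear]
  simp [vec_zero_zero]

theorem bernoulliAction_lowerShear (h : H) :
    bernoulliAction μ χ (affine 0 lowerShear) (bernoulliUnitary μ (edge h)) =
      bernoulliUnitary μ (dipole h 0 ![1, 1]) := by
  rw [bernoulliAction_bernoulliUnitary, edge, actionPhase_affine_zero, permute_dipole,
    affinePerm_affine, affinePerm_affine, slMulVec_lowerShear, slMulVec_lowerShear]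
  simp [vec_zero_zero]

/-- The phase `χ(h)⁻¹` comes from the far endpoint (1,0), which rotates to (0,1), and `det((1,0),
(0,1)) = 1`. Through it the character enters the triangle relation. -/
theorem bernoulliAction_quarterTurn (h : H) :
    bernoulliAction μ χ (affine ![1, 0] quarterTurn) (bernoulliUnitary μ (edge h)) =
      (((χ h)⁻¹ : Circle) : ℂ) • bernoulliUnitary μ (dipole h ![1, 0] ![1, 1]) := by
  rw [bernoulliAction_bernoulliUnitary, edge, actionPhase_dipole, permute_dipole,
    affinePerm_affine, affinePerm_affine]
  change ((χ h ^ latticeDet ![1, 0] (slMulVec quarterTurn 0) *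
    (χ h ^ latticeDet ![1, 0] (slMulVec quarterTurn ![1, 0]))⁻¹ : Circle) : ℂ) • _ = _
  rw [slMulVec_quarterTurn, slMulVec_quarterTurn]
  simp [latticeDet, vec_zero_zero]

/-- The half-turn `m ↦ (1,0) - m` swaps the two endpoints; all determinants involved vanish, so no
phase appears. -/
theorem bernoulliAction_flip (h : H) :
    bernoulliAction μ χ (affine ![1, 0] (-1)) (bernoulliUnitary μ (edge h)) =
      bernoulliUnitary μ (edge (-h)) := by
  rw [bernoulliAction_bernoulliUnitary, edge, actionPhase_dipole, permute_dipole,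
    affinePerm_affine, affinePerm_affine, edge, dipole_neg]
  change ((χ h ^ latticeDet ![1, 0] (slMulVec (-1) 0) *
    (χ h ^ latticeDet ![1, 0] (slMulVec (-1) ![1, 0]))⁻¹ : Circle) : ℂ) • _ = _
  rw [slMulVec_neg_one, slMulVec_neg_one]
  simp [latticeDet, vec_zero_zero]

/-- The edges from 0 to (1,0) and from (1,0) to (1,1) add up to the one from 0 to (1,1), and all
three are images of the first under the group. -/
theorem bernoulliUnitary_edge_mul (h : H) :
    bernoulliUnitary μ (edge h) *
        bernoulliAction μ χ (affine ![1, 0] quarterTurn) (bernoulliUnitary μ (edge h)) =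
      (trianglePhase μ χ h : ℂ) •
        bernoulliAction μ χ (affine 0 lowerShear) (bernoulliUnitary μ (edge h)) := by
  rw [bernoulliAction_quarterTurn, bernoulliAction_lowerShear, bernoulliVN_mul_smul,
    bernoulliUnitary_mul,
    bernoulliVN_smul_smul, trianglePhase, Circle.coe_mul]
  congr 2
  exact dipole_add_dipole _ _ _ _

variable {α : AutVN (bernoulliVN μ)}

theorem map_edge_mul (hα : α ∈ bernoulliCentralizer μ χ) (h : H) :
    α (bernoulliUnitary μ (edge h)) *
        bernoulliAction μ χ (affine ![1, 0] quarterTurn) (α (bernoulliUnitary μ (edge h))) =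
      (trianglePhase μ χ h : ℂ) •
        bernoulliAction μ χ (affine 0 lowerShear) (α (bernoulliUnitary μ (edge h))) := by
  rw [mem_bernoulliCentralizer_iff] at hα
  rw [← hα, ← hα]
  have h1 := congrArg α (bernoulliUnitary_edge_mul (μ := μ) (χ := χ) h)
  exact (bernoulliAut_mul α _ _).symm.trans (h1.trans (bernoulliAut_smul α _ _))

/-- An automorphism commuting with the action maps the canonical unitary of an edge to a multiple of
such a unitary. -/
theorem exists_map_edge (hα : α ∈ bernoulliCentralizer μ χ) (h : H) :
    ∃ (h' : H) (a : ℂ), a ≠ 0 ∧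
      α (bernoulliUnitary μ (edge h)) = a • bernoulliUnitary μ (edge h') := by
  refine exists_eq_smul_dipole (χ := χ) (d := trianglePhase μ χ h) ?_ ?_ (map_edge_mul hα h)
  · exact bernoulliAut_ne_zero α (bernoulliUnitary_ne_zero _)
  · rw [← mem_bernoulliCentralizer_iff.1 hα, bernoulliAction_upperShear]

set_option maxHeartbeats 1000000 in
-- The triangle relation is quadratic in the edge unitary on one side and linear on the other, so it
-- compares `a²` with `a`.
theorem map_edge_phase (hα : α ∈ bernoulliCentralizer μ χ) {h h' : H} {a : ℂ} (ha : a ≠ 0)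
    (hh : α (bernoulliUnitary μ (edge h)) = a • bernoulliUnitary μ (edge h')) :
    a * trianglePhase μ χ h' = trianglePhase μ χ h := by
  have h1 := map_edge_mul hα h
  have h3 : a • bernoulliUnitary μ (edge h') *
      a • bernoulliAction μ χ (affine ![1, 0] quarterTurn) (bernoulliUnitary μ (edge h')) =
      (a * a * trianglePhase μ χ h' : ℂ) • bernoulliUnitary μ (dipole h' 0 ![1, 1]) := by
    refine (bernoulliVN_smul_mul_smul a a _ _).trans ?_
    refine (congrArg ((a * a) • ·) (bernoulliUnitary_edge_mul (μ := μ) (χ := χ) h')).trans ?_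
    rw [bernoulliAction_lowerShear h', bernoulliVN_smul_smul]
  rw [hh, bernoulliAut_smul _ a, bernoulliAut_smul _ a, bernoulliAction_lowerShear h',
    bernoulliVN_smul_smul _ a] at h1
  replace h1 := h3.symm.trans h1
  have h2 := (smul_bernoulliUnitary_inj (mul_ne_zero (mul_ne_zero ha ha) (Circle.coe_ne_zero _))
    h1).2
  rw [mul_assoc, mul_comm _ a] at h2
  exact mul_left_cancel₀ ha h2

theorem map_edge_neg (hα : α ∈ bernoulliCentralizer μ χ) {h h' : H} {a : ℂ}
    (hh : α (bernoulliUnitary μ (edge h)) = a • bernoulliUnitary μ (edge h')) :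
    α (bernoulliUnitary μ (edge (-h))) = a • bernoulliUnitary μ (edge (-h')) := by
  rw [← bernoulliAction_flip (χ := χ), mem_bernoulliCentralizer_iff.1 hα, hh, bernoulliAut_smul,
    bernoulliAction_flip]

set_option maxHeartbeats 1000000 in
-- The scalar by which two edge unitaries commute is preserved by any automorphism, whatever the
-- coefficients `a₁` and `a₂`.
theorem map_edge_comm {h₁ h₂ k₁ k₂ : H} {a₁ a₂ : ℂ} (ha₁ : a₁ ≠ 0) (ha₂ : a₂ ≠ 0)
    (hh₁ : α (bernoulliUnitary μ (edge h₁)) = a₁ • bernoulliUnitary μ (edge k₁))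
    (hh₂ : α (bernoulliUnitary μ (edge h₂)) = a₂ • bernoulliUnitary μ (edge k₂)) :
    (cocycleTilde μ).toFun (edge h₂) (edge h₁) * (cocycleTilde μ).toFun (edge k₁) (edge k₂) =
      (cocycleTilde μ).toFun (edge h₁) (edge h₂) * (cocycleTilde μ).toFun (edge k₂) (edge k₁) := by
  have h1 : ((cocycleTilde μ).toFun (edge h₂) (edge h₁) : ℂ) •
      (bernoulliUnitary μ (edge h₁) * bernoulliUnitary μ (edge h₂)) =
      ((cocycleTilde μ).toFun (edge h₁) (edge h₂) : ℂ) •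
      (bernoulliUnitary μ (edge h₂) * bernoulliUnitary μ (edge h₁)) := by
    rw [bernoulliUnitary_mul (edge h₁), bernoulliUnitary_mul (edge h₂), bernoulliVN_smul_smul,
      bernoulliVN_smul_smul, mul_comm, add_comm (edge h₂)]
  have h2 : ∀ (k k' l l' : H) (c a a' : ℂ),
      α (bernoulliUnitary μ (edge k)) = a • bernoulliUnitary μ (edge l) →
      α (bernoulliUnitary μ (edge k')) = a' • bernoulliUnitary μ (edge l') →
      α (c • (bernoulliUnitary μ (edge k) * bernoulliUnitary μ (edge k'))) =
        (c * (a * a' * (cocycleTilde μ).toFun (edge l) (edge l'))) •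
          bernoulliUnitary μ (edge l + edge l') := by
    intro k k' l l' c a a' hk hk'
    rw [bernoulliAut_smul α c, bernoulliAut_mul α (bernoulliUnitary μ (edge k)), hk, hk',
      bernoulliVN_smul_mul_smul a a', bernoulliUnitary_mul (edge l), bernoulliVN_smul_smul (a * a'),
      bernoulliVN_smul_smul c]
  have h2 := (h2 h₁ h₂ k₁ k₂ _ a₁ a₂ hh₁ hh₂).symm.trans ((congrArg α h1).trans
    (h2 h₂ h₁ k₂ k₁ _ a₂ a₁ hh₂ hh₁))
  rw [add_comm (edge k₂)] at h2
  have h3 := bernoulliVN_smul_right_cancel (bernoulliUnitary_ne_zero _) h2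
  apply Circle.ext
  rw [Circle.coe_mul, Circle.coe_mul]
  have h4 : a₁ * a₂ ≠ 0 := mul_ne_zero ha₁ ha₂
  refine mul_left_cancel₀ h4 ?_
  linear_combination h3

/-- An automorphism commuting with the action preserves the trace. -/
theorem fourier_map_zero (hα : α ∈ bernoulliCentralizer μ χ)
    (x : (bernoulliVN μ).toStarSubalgebra) : fourier (α x) 0 = fourier x 0 := by
  have h := inner_map_eq_of_commute (N := bernoulliVN μ) (Ω := basisVec 0) (norm_basisVec 0)
    (fun x hx h => eq_of_apply_basisVec_zero (μ := cocycleTilde μ) hx (zero_mem _) h)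
    (shiftRep χ (affine ![1, 0] 1)) (shiftRep_basisVec_zero _)
    (fun ξ hξ => ⟨_, eq_smul_of_translation_fixed hξ⟩)
    (bernoulliAction μ χ (affine ![1, 0] 1)) (fun x => coe_bernoulliAction _ x) α
    (fun x => mem_bernoulliCentralizer_iff.1 hα _ x) x
  rwa [inner_basisVec_left, inner_basisVec_left] at h

/-- Every Fourier coefficient is a trace, so a trace-preserving automorphism controls all of them.
-/
theorem fourier_star_mul (l : LambdaGroup H) (x : (bernoulliVN μ).toStarSubalgebra) :
    fourier (star (bernoulliUnitary μ l) * x) 0 = fourier x l := by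
  rw [← inner_basisVec_left, ← inner_basisVec_left, ← fourier_bernoulliUnitary (μ := μ) l]
  rw [fourier, fourier, fourier]
  exact ContinuousLinearMap.adjoint_inner_right
    (bernoulliUnitary μ l : EllTwo (LambdaGroup H) →L[ℂ] EllTwo (LambdaGroup H)) _ _

theorem eq_one_of_map_bernoulliUnitary (hα : α ∈ bernoulliCentralizer μ χ)
    (h : ∀ l, α (bernoulliUnitary μ l) = bernoulliUnitary μ l) : α = 1 := by
  refine StarAlgEquiv.ext fun x => fourier_injective ?_
  ext l
  have h1 := fourier_map_zero hα (star (bernoulliUnitary μ l) * x)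
  rw [bernoulliAut_mul, bernoulliAut_star, h, fourier_star_mul, fourier_star_mul] at h1
  exact h1

theorem map_bernoulliUnitary_add {l l' : LambdaGroup H}
    (hl : α (bernoulliUnitary μ l) = bernoulliUnitary μ l)
    (hl' : α (bernoulliUnitary μ l') = bernoulliUnitary μ l') :
    α (bernoulliUnitary μ (l + l')) = bernoulliUnitary μ (l + l') := by
  have h1 := congrArg α (bernoulliUnitary_mul (μ := μ) l l')
  rw [bernoulliAut_mul α (bernoulliUnitary μ l), bernoulliAut_smul α, hl, hl',
    bernoulliUnitary_mul l l'] at h1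
  exact (bernoulliVN_smul_left_cancel (Circle.coe_ne_zero _) h1).symm

theorem map_bernoulliUnitary_neg {l : LambdaGroup H}
    (hl : α (bernoulliUnitary μ l) = bernoulliUnitary μ l) :
    α (bernoulliUnitary μ (-l)) = bernoulliUnitary μ (-l) := by
  have h1 := congrArg α (star_bernoulliUnitary (μ := μ) l)
  rw [bernoulliAut_star α (bernoulliUnitary μ l), bernoulliAut_smul α, hl,
    star_bernoulliUnitary l] at h1
  exact (bernoulliVN_smul_left_cancel (Circle.coe_ne_zero _) h1).symm

theorem bernoulliUnitary_zero : bernoulliUnitary μ (0 : LambdaGroup H) = 1 :=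
  Subtype.ext (twistedTranslation_zero (cocycleTilde μ))

/-- The elements of `Λ(H)` whose canonical unitaries are fixed by an automorphism. -/
def fixedSubgroup (α : AutVN (bernoulliVN μ)) : AddSubgroup (LambdaGroup H) where
  carrier := {l | α (bernoulliUnitary μ l) = bernoulliUnitary μ l}
  zero_mem' := by
    rw [Set.mem_ofPred_eq, bernoulliUnitary_zero]
    exact bernoulliAut_one α
  add_mem' hl hl' := map_bernoulliUnitary_add hl hl'
  neg_mem' hl := map_bernoulliUnitary_neg hl

theorem permute_mem_fixedSubgroup (hα : α ∈ bernoulliCentralizer μ χ) (g : AffineSL)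
    {l : LambdaGroup H} (hl : l ∈ fixedSubgroup α) :
    permute (affinePerm g) l ∈ fixedSubgroup α := by
  have hl' : α (bernoulliUnitary μ l) = bernoulliUnitary μ l := hl
  have h1 := mem_bernoulliCentralizer_iff.1 hα g (bernoulliUnitary μ l)
  rw [hl', bernoulliAction_bernoulliUnitary, bernoulliAut_smul α] at h1
  exact bernoulliVN_smul_left_cancel (Circle.coe_ne_zero _) h1

/-- An automorphism commuting with the action is determined by the images of the edges. -/
theorem eq_one_of_map_edge (hα : α ∈ bernoulliCentralizer μ χ)
    (h : ∀ h, α (bernoulliUnitary μ (edge h)) = bernoulliUnitary μ (edge h)) : α = 1 := by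
  have htrans : ∀ (k m n : Lattice) (h : H), dipole h m n ∈ fixedSubgroup α →
      dipole h (k + m) (k + n) ∈ fixedSubgroup α := fun k m n h hm => by
    have := permute_mem_fixedSubgroup hα (affine k 1) hm
    rwa [permute_dipole, affinePerm_affine, affinePerm_affine, slMulVec_one, slMulVec_one] at this
  -- Translation invariance of the fixed subgroup makes the set of `m` whose dipoles `dipole h 0 m`
  -- are all fixed a subgroup; it contains (1,0), hence (0,1) by rotation, hence the whole lattice.
  let P : AddSubgroup Lattice :=
    { carrier := {m | ∀ h : H, dipole h 0 m ∈ fixedSubgroup α}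
      zero_mem' := fun h => by rw [dipole_self]; exact zero_mem _
      add_mem' := fun {m n} hm hn h => by
        have := htrans m 0 n h (hn h)
        rw [add_zero] at this
        rw [← dipole_add_dipole h 0 m]
        exact add_mem (hm h) this
      neg_mem' := fun {m} hm h => by
        have := neg_mem (htrans (-m) 0 m h (hm h))
        rwa [add_zero, neg_add_cancel, neg_dipole] at this }
  have h1 : ![1, 0] ∈ P := h
  have h2 : ![0, 1] ∈ P := fun k => by
    have := permute_mem_fixedSubgroup hα (affine 0 quarterTurn) (h k : edge k ∈ fixedSubgroup α)
    rw [edge, permute_dipole, affinePerm_affine, affinePerm_affine, slMulVec_quarterTurn,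
      slMulVec_quarterTurn] at this
    simpa [vec_zero_zero] using this
  refine eq_one_of_map_bernoulliUnitary hα fun l => ?_
  refine mem_of_dipole_mem (fixedSubgroup α) (fun h m => ?_) l
  have h3 : m = m 0 • (![1, 0] : Lattice) + m 1 • ![0, 1] := by
    ext i; fin_cases i <;> simp
  have h4 : m ∈ P := by
    rw [h3]
    exact add_mem (P.zsmul_mem h1 _) (P.zsmul_mem h2 _)
  exact h4 h

end Centralizer

/-! ### The cocycle of `H_q` in additive form. -/

section ZModQ

variable {q : ℕ}

theorem toCircle_finsum [NeZero q] {f : Lattice → ZMod q} (hf : f.HasFiniteSupport) :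
    ∏ᶠ k, ZMod.toCircle (f k) = ZMod.toCircle (∑ᶠ k, f k) := by
  have hs : ∀ k, f k ≠ 0 → k ∈ Set.Finite.toFinset hf := fun k hk =>
    (Set.Finite.mem_toFinset hf).2 hk
  rw [finsum_eq_sum_of_support_subset f (s := Set.Finite.toFinset hf) fun k hk => hs k hk,
    finprod_eq_prod_of_mulSupport_subset (s := Set.Finite.toFinset hf) _ fun k hk => hs k fun h0 =>
      hk (by rw [h0, AddChar.map_zero_eq_one])]
  exact (map_prod (ZMod.toCircle (N := q)).toMonoidHom (fun k => Multiplicative.ofAdd (f k)) _).symm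

theorem hasFiniteSupport_comp {H A : Type*} [Zero H] [Zero A] (l : Lattice →₀ H)
    (f : Lattice → H → A) (hf : ∀ k, f k 0 = 0) : (fun k => f k (l k)).HasFiniteSupport := by
  refine Set.Finite.subset l.hasFiniteSupport fun k hk => ?_
  rw [Function.mem_support]
  intro h
  exact hk (by simp [h, hf])

/-- The bilinear form on `Λ(H_q)` whose exponential is the cocycle `μ̃_q`. -/
def pairing (l l' : LambdaGroup (HGroup q)) : ZMod q :=
  ∑ᶠ k, ((l : Lattice →₀ HGroup q) k).1 * ((l' : Lattice →₀ HGroup q) k).2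

theorem cocycleTilde_eq [NeZero q] (l l' : LambdaGroup (HGroup q)) :
    (cocycleTilde (muCocycle q)).toFun l l' = ZMod.toCircle (pairing l l') :=
  toCircle_finsum (hasFiniteSupport_comp (l : Lattice →₀ HGroup q)
    (fun k h => h.1 * ((l' : Lattice →₀ HGroup q) k).2) fun _ => by simp)

theorem pairing_dipole_left (h : HGroup q) (m n : Lattice) (l : LambdaGroup (HGroup q)) :
    pairing (dipole h m n) l =
      h.1 * ((l : Lattice →₀ HGroup q) m).2 - h.1 * ((l : Lattice →₀ HGroup q) n).2 := by
  have hs : ∀ m : Lattice, ∑ᶠ k, ((Finsupp.single m h : Lattice →₀ HGroup q) k).1 *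
      ((l : Lattice →₀ HGroup q) k).2 = h.1 * ((l : Lattice →₀ HGroup q) m).2 := fun m => by
    rw [finsum_eq_single _ m fun k hk => by rw [Finsupp.single_eq_of_ne hk]; simp,
      Finsupp.single_eq_same]
  have hf : ∀ m : Lattice, (fun k => ((Finsupp.single m h : Lattice →₀ HGroup q) k).1 *
      ((l : Lattice →₀ HGroup q) k).2).HasFiniteSupport := fun m =>
    hasFiniteSupport_comp (Finsupp.single m h)
      (fun k h => h.1 * ((l : Lattice →₀ HGroup q) k).2) fun k => by simp
  rw [← hs m, ← hs n, ← finsum_sub_distrib (hf m) (hf n)]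
  refine finsum_congr fun k => ?_
  rw [dipole_apply, Prod.fst_sub, sub_mul]

theorem pairing_dipole_right (h : HGroup q) (m n : Lattice) (l : LambdaGroup (HGroup q)) :
    pairing l (dipole h m n) =
      ((l : Lattice →₀ HGroup q) m).1 * h.2 - ((l : Lattice →₀ HGroup q) n).1 * h.2 := by
  have hs : ∀ m : Lattice, ∑ᶠ k, ((l : Lattice →₀ HGroup q) k).1 *
      ((Finsupp.single m h : Lattice →₀ HGroup q) k).2 = ((l : Lattice →₀ HGroup q) m).1 * h.2 :=
    fun m => by
      rw [finsum_eq_single _ m fun k hk => by rw [Finsupp.single_eq_of_ne hk]; simp,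
        Finsupp.single_eq_same]
  have hf : ∀ m : Lattice, (fun k => ((l : Lattice →₀ HGroup q) k).1 *
      ((Finsupp.single m h : Lattice →₀ HGroup q) k).2).HasFiniteSupport := fun m =>
    hasFiniteSupport_comp (Finsupp.single m h)
      (fun k h => ((l : Lattice →₀ HGroup q) k).1 * h.2) fun k => by simp
  rw [← hs m, ← hs n, ← finsum_sub_distrib (hf m) (hf n)]
  refine finsum_congr fun k => ?_
  rw [dipole_apply, Prod.snd_sub, mul_sub]

theorem cocycleTilde_eq_iff [NeZero q] (l l' : LambdaGroup (HGroup q)) :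
    (cocycleTilde (muCocycle q)).toFun l l' = (cocycleTilde (muCocycle q)).toFun l' l ↔
      pairing l l' = pairing l' l := by
  rw [cocycleTilde_eq, cocycleTilde_eq, ZMod.injective_toCircle.eq_iff]

/-! ### `N(H_q, μ_q)` is the AFD factor of type II₁ -/

/-- An element commuting with all dipoles of the two basis vectors of `H_q` is a constant function
on the lattice, and finite support makes it zero. -/
theorem isFactor_bernoulliVN [NeZero q] : IsFactor (bernoulliVN (muCocycle q)) := by
  refine isFactor_twistedGroupVN fun l hl => ?_
  by_contra hcon
  push Not at hcon
  have hz : ∀ m n, (l : Lattice →₀ HGroup q) m = (l : Lattice →₀ HGroup q) n := by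
    intro m n
    have h1 := (cocycleTilde_eq_iff _ _).1 (hcon (dipole (0, 1) m n))
    have h2 := (cocycleTilde_eq_iff _ _).1 (hcon (dipole (1, 0) m n))
    rw [pairing_dipole_left, pairing_dipole_right] at h1 h2
    simp only [mul_one, mul_zero, one_mul, zero_mul, sub_self] at h1 h2
    exact Prod.ext (sub_eq_zero.1 h1) (sub_eq_zero.1 h2.symm)
  obtain ⟨n, hn⟩ := Infinite.exists_notMem_finset (l : Lattice →₀ HGroup q).support
  refine hl (lambdaGroup_ext fun m => ?_)
  rw [hz m n]
  exact Finsupp.notMem_support_iff.1 hn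

theorem eventually_apply_eq_zero {H : Type*} [AddCommGroup H] (l : LambdaGroup H) (i : ℤ) :
    ∀ᶠ n : ℕ in atTop, (l : Lattice →₀ H) ![(n : ℤ), i] = 0 := by
  have hinj : Function.Injective fun n : ℕ => (![(n : ℤ), i] : Lattice) := fun a b h => by
    simpa using congrFun h 0
  have := hinj.tendsto_cofinite.eventually
    (Set.Finite.compl_mem_cofinite (Finset.finite_toSet (l : Lattice →₀ H).support))
  rw [Nat.cofinite_eq_atTop] at this
  filter_upwards [this] with n hn
  simpa using hn

theorem isTypeIIOne_bernoulliVN [NeZero q] (hq : 3 ≤ q) :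
    IsTypeIIOne (bernoulliVN (muCocycle q)) := by
  have hab : ∀ (h : HGroup q) (l : LambdaGroup (HGroup q)), ∀ᶠ n : ℕ in atTop,
      (cocycleTilde (muCocycle q)).toFun (dipole h ![(n : ℤ), 0] ![(n : ℤ), 1]) l =
      (cocycleTilde (muCocycle q)).toFun l (dipole h ![(n : ℤ), 0] ![(n : ℤ), 1]) := by
    intro h l
    filter_upwards [eventually_apply_eq_zero l 0, eventually_apply_eq_zero l 1] with n h0 h1
    rw [cocycleTilde_eq_iff, pairing_dipole_left, pairing_dipole_right, h0, h1]
    simp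
  have hne : ∀ n : ℕ, (![(n : ℤ), 0] : Lattice) ≠ ![(n : ℤ), 1] := fun n h => by
    simpa using congrFun h 1
  -- The two endpoints of the dipoles contribute equally, whence the 2; it is nonzero in `ZMod q`
  -- because `q ≥ 3`.
  refine isTypeIIOne_twistedGroupVN (w := ZMod.toCircle (2 : ZMod q)) ?_
    (hab (1, 0)) (hab (0, 1)) fun n => ?_
  · rw [← AddChar.map_zero_eq_one (ZMod.toCircle (N := q)), ZMod.injective_toCircle.ne_iff]
    intro h
    have h2 : ((2 : ℕ) : ZMod q) = 0 := by exact_mod_cast h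
    rw [ZMod.natCast_eq_zero_iff] at h2
    exact absurd (Nat.le_of_dvd two_pos h2) (by omega)
  · rw [cocycleTilde_eq, cocycleTilde_eq, ← AddChar.map_add_eq_mul, pairing_dipole_left,
      pairing_dipole_left, dipole_apply_left _ (hne n), dipole_apply_right _ (hne n),
      dipole_apply_left _ (hne n), dipole_apply_right _ (hne n)]
    congr 1
    norm_num

/-- The elements of `Λ(H)` supported in the box `[-n, n]²`. -/
def boxSubgroup (H : Type*) [AddCommGroup H] (n : ℕ) : AddSubgroup (LambdaGroup H) where
  carrier := {l | ∀ m, (l : Lattice →₀ H) m ≠ 0 → ∀ i, |m i| ≤ n}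
  zero_mem' m hm := absurd rfl hm
  add_mem' {a b} ha hb m hm := by
    by_cases h : (a : Lattice →₀ H) m = 0
    · refine hb m fun h' => hm ?_
      change (a : Lattice →₀ H) m + (b : Lattice →₀ H) m = 0
      rw [h, h', add_zero]
    · exact ha m h
  neg_mem' {a} ha m hm := ha m fun h => hm (by
    change -(a : Lattice →₀ H) m = 0
    rw [h, neg_zero])

instance finite_boxSubgroup (H : Type*) [AddCommGroup H] [Finite H] (n : ℕ) :
    Finite (boxSubgroup H n) := by
  let B := Set.Icc (fun _ => -(n : ℤ) : Lattice) (fun _ => (n : ℤ))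
  have : Finite B := (Set.finite_Icc _ _).to_subtype
  refine Finite.of_injective (β := B → H) (fun l k => ((l : LambdaGroup H) : Lattice →₀ H) k) ?_
  intro l l' h
  refine Subtype.ext (lambdaGroup_ext fun m => ?_)
  by_cases hm : m ∈ B
  · exact congrFun h ⟨m, hm⟩
  · have h0 : ∀ l : boxSubgroup H n, ((l : LambdaGroup H) : Lattice →₀ H) m = 0 := by
      intro l
      by_contra hl
      exact hm ⟨fun i => (abs_le.1 (l.2 m hl i)).1, fun i => (abs_le.1 (l.2 m hl i)).2⟩
    rw [h0, h0]

theorem isAFD_bernoulliVN {H : Type*} [AddCommGroup H] [Finite H] (μ : NormalizedTwoCocycle H) :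
    IsAFD (bernoulliVN μ) := by
  refine isAFD_twistedGroupVN (boxSubgroup H) (fun a b hab l hl m hm i =>
    (hl m hm i).trans (by exact_mod_cast hab)) fun l => ?_
  -- A crude box size: the sum of all coordinates of all support points in absolute value.
  refine ⟨∑ m ∈ (l : Lattice →₀ H).support, ∑ i, (m i).natAbs, fun m hm i => ?_⟩
  rw [Int.abs_eq_natAbs]
  have h1 : (m i).natAbs ≤ ∑ i, (m i).natAbs :=
    Finset.single_le_sum (f := fun i => (m i).natAbs) (fun _ _ => Nat.zero_le _) (Finset.mem_univ i)
  have h2 : ∑ i, (m i).natAbs ≤ ∑ m ∈ (l : Lattice →₀ H).support, ∑ i, (m i).natAbs :=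
    Finset.single_le_sum (f := fun m : Lattice => ∑ i, (m i).natAbs) (fun _ _ => Nat.zero_le _)
      (Finsupp.mem_support_iff.2 hm)
  exact_mod_cast h1.trans h2

/-! ### The shear automorphisms -/

/-- The automorphism `(s, t) ↦ (s, t + c s)` of `H_q`. -/
def shear (c : ZMod q) : HGroup q →+ HGroup q where
  toFun h := (h.1, h.2 + c * h.1)
  map_zero' := by simp
  map_add' h h' := by
    refine Prod.ext rfl ?_
    simp only [Prod.snd_add, Prod.fst_add]
    ring

theorem shear_fst (c : ZMod q) (h : HGroup q) : (shear c h).1 = h.1 := rfl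

theorem shear_snd (c : ZMod q) (h : HGroup q) : (shear c h).2 = h.2 + c * h.1 := rfl

theorem shear_shear (c d : ZMod q) (h : HGroup q) : shear c (shear d h) = shear (c + d) h := by
  refine Prod.ext rfl ?_
  simp only [shear_snd, shear_fst]
  ring

theorem shear_zero (h : HGroup q) : shear 0 h = h := by
  refine Prod.ext rfl ?_
  simp [shear_snd]

/-- The pointwise shear on `Λ(H_q)`. -/
def shearMap (c : ZMod q) (l : LambdaGroup (HGroup q)) : LambdaGroup (HGroup q) :=
  ⟨Finsupp.mapRange (shear c) (map_zero _) l, by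
    have h : ∑ᶠ k, (l : Lattice →₀ HGroup q) k = 0 := l.2
    change ∑ᶠ k, shear c ((l : Lattice →₀ HGroup q) k) = 0
    rw [← AddMonoidHom.map_finsum _ (Finsupp.hasFiniteSupport _), h, map_zero]⟩

theorem shearMap_apply (c : ZMod q) (l : LambdaGroup (HGroup q)) (k : Lattice) :
    (shearMap c l : Lattice →₀ HGroup q) k = shear c ((l : Lattice →₀ HGroup q) k) := rfl

theorem shearMap_add (c : ZMod q) (l l' : LambdaGroup (HGroup q)) :
    shearMap c (l + l') = shearMap c l + shearMap c l' :=
  lambdaGroup_ext fun _ => map_add (shear c) _ _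

theorem shearMap_shearMap (c d : ZMod q) (l : LambdaGroup (HGroup q)) :
    shearMap c (shearMap d l) = shearMap (c + d) l :=
  lambdaGroup_ext fun _ => shear_shear c d _

theorem shearMap_zero (l : LambdaGroup (HGroup q)) : shearMap 0 l = l :=
  lambdaGroup_ext fun _ => shear_zero _

theorem shearMap_dipole (c : ZMod q) (h : HGroup q) (m n : Lattice) :
    shearMap c (dipole h m n) = dipole (shear c h) m n := by
  classical
  refine lambdaGroup_ext fun k => ?_
  rw [shearMap_apply, dipole_apply, dipole_apply, map_sub]
  simp only [Finsupp.single_apply, apply_ite (shear c), map_zero]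

theorem permute_shearMap (e : Equiv.Perm Lattice) (c : ZMod q) (l : LambdaGroup (HGroup q)) :
    permute e (shearMap c l) = shearMap c (permute e l) :=
  lambdaGroup_ext fun _ => rfl

/-- The pointwise shear as a permutation of `Λ(H_q)`. -/
def shearPerm (c : ZMod q) : Equiv.Perm (LambdaGroup (HGroup q)) where
  toFun := shearMap c
  invFun := shearMap (-c)
  left_inv l := by rw [shearMap_shearMap, neg_add_cancel, shearMap_zero]
  right_inv l := by rw [shearMap_shearMap, add_neg_cancel, shearMap_zero]

/-- The quadratic form `½ ∑_k s_k²`. -/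
def halfSquare (l : LambdaGroup (HGroup q)) : ZMod q :=
  ∑ᶠ k, 2⁻¹ * (((l : Lattice →₀ HGroup q) k).1 * ((l : Lattice →₀ HGroup q) k).1)

theorem two_mul_inv_two (hodd : Odd q) : (2 : ZMod q) * 2⁻¹ = 1 :=
  ZMod.coe_mul_inv_eq_one 2 (Nat.coprime_two_left.2 hodd)

theorem halfSquare_shearMap (c : ZMod q) (l : LambdaGroup (HGroup q)) :
    halfSquare (shearMap c l) = halfSquare l := rfl

theorem halfSquare_permute (e : Equiv.Perm Lattice) (l : LambdaGroup (HGroup q)) :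
    halfSquare (permute e l) = halfSquare l :=
  finsum_comp_equiv (f := fun k => 2⁻¹ * (((l : Lattice →₀ HGroup q) k).1 *
    ((l : Lattice →₀ HGroup q) k).1)) e.symm

theorem hasFiniteSupport_halfSquare (l : LambdaGroup (HGroup q)) :
    (fun k => (2⁻¹ : ZMod q) * (((l : Lattice →₀ HGroup q) k).1 *
      ((l : Lattice →₀ HGroup q) k).1)).HasFiniteSupport :=
  hasFiniteSupport_comp (l : Lattice →₀ HGroup q)
    (fun _ h => (2⁻¹ : ZMod q) * (h.1 * h.1)) fun k => by simp

theorem hasFiniteSupport_pairing (l l' : LambdaGroup (HGroup q)) :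
    (fun k => ((l : Lattice →₀ HGroup q) k).1 *
      ((l' : Lattice →₀ HGroup q) k).2).HasFiniteSupport :=
  hasFiniteSupport_comp (l : Lattice →₀ HGroup q)
    (fun k h => h.1 * ((l' : Lattice →₀ HGroup q) k).2) fun _ => by simp

/-- The shear changes the pairing by the symmetric form `c ∑ s_k s'_k`, which is the polarization of
`c · ½ ∑ s_k²`. Thus the sheared cocycle is cohomologous to the original by an explicit coboundary.
-/
theorem halfSquare_add (hodd : Odd q) (c : ZMod q) (l l' : LambdaGroup (HGroup q)) :
    c * halfSquare (l + l') + pairing l l' =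
      c * halfSquare l + c * halfSquare l' + pairing (shearMap c l) (shearMap c l') := by
  simp only [halfSquare, pairing]
  have hf : ∀ l : LambdaGroup (HGroup q), (fun k => c * (2⁻¹ *
      (((l : Lattice →₀ HGroup q) k).1 * ((l : Lattice →₀ HGroup q) k).1))).HasFiniteSupport :=
    fun l => hasFiniteSupport_comp (l : Lattice →₀ HGroup q)
      (fun _ h => c * (2⁻¹ * (h.1 * h.1))) fun k => by simp
  rw [mul_finsum' _ _ (hasFiniteSupport_halfSquare _),
    mul_finsum' _ _ (hasFiniteSupport_halfSquare _),
    mul_finsum' _ _ (hasFiniteSupport_halfSquare _),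
    ← finsum_add_distrib (hf _) (hasFiniteSupport_pairing _ _),
    add_assoc, ← finsum_add_distrib (hf l') (hasFiniteSupport_pairing _ _)]
  refine (finsum_congr fun k => ?_).trans
    (finsum_add_distrib (hf l) ((hf l').add (hasFiniteSupport_pairing _ _)))
  change c * (2⁻¹ * ((((l : Lattice →₀ HGroup q) k).1 + ((l' : Lattice →₀ HGroup q) k).1) *
    (((l : Lattice →₀ HGroup q) k).1 + ((l' : Lattice →₀ HGroup q) k).1))) + _ =
    _ + (_ + ((l : Lattice →₀ HGroup q) k).1 * (((l' : Lattice →₀ HGroup q) k).2 +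
      c * ((l' : Lattice →₀ HGroup q) k).1))
  linear_combination (c * ((l : Lattice →₀ HGroup q) k).1 * ((l' : Lattice →₀ HGroup q) k).1) *
    two_mul_inv_two hodd

/-- The two endpoints contribute equally and cancel the factor `½`. -/
theorem halfSquare_edge (hodd : Odd q) (h : HGroup q) : halfSquare (edge h) = h.1 * h.1 := by
  have hne : (0 : Lattice) ≠ ![1, 0] := fun h => by simpa using congrFun h 0
  rw [halfSquare, finsum_eq_sum_of_support_subset (s := {0, ![1, 0]}), Finset.sum_pair hne, edge,
    dipole_apply_left _ hne, dipole_apply_right _ hne, Prod.fst_neg]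
  · linear_combination h.1 * h.1 * two_mul_inv_two hodd
  · intro k hk
    by_contra hk'
    simp only [Finset.coe_insert, Finset.coe_singleton, Set.mem_insert_iff, Set.mem_singleton_iff,
      not_or] at hk'
    have h0 := dipole_apply_of_ne h hk'.1 hk'.2
    exact hk (by simp [edge, h0])

theorem pairing_edge (h h' : HGroup q) : pairing (edge h) (edge h') = 2 * (h.1 * h'.2) := by
  have hne : (0 : Lattice) ≠ ![1, 0] := fun h => by simpa using congrFun h 0
  rw [edge, edge, pairing_dipole_left, dipole_apply_left _ hne, dipole_apply_right _ hne,
    Prod.snd_neg]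
  ring

theorem eq_zero_of_two_mul_eq_zero (hodd : Odd q) {x : ZMod q} (h : 2 * x = 0) : x = 0 := by
  linear_combination 2⁻¹ * h - x * two_mul_inv_two hodd

end ZModQ

theorem mul_conj_comm {R : Type*} [Semigroup R] [StarMul R] {a b : R} (h : a * b = b * a) (x : R) :
    a * (b * x * star b) * star a = b * (a * x * star a) * star b := by
  have h' : star b * star a = star a * star b := by rw [← star_mul, h, star_mul]
  simp only [mul_assoc, h']
  simp only [← mul_assoc, h]

/-! ### Finite subgroups of groups with a T1 topology. -/

section Subgroup

variable {G G' : Type*} [Group G] [Group G']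

/-- An injective homomorphism whose range is `S` is an isomorphism onto `S`. -/
def mulEquivSubgroup (f : G →* G') (S : Subgroup G') (hf : ∀ g, f g ∈ S)
    (hinj : Function.Injective f) (hsurj : ∀ s ∈ S, ∃ g, f g = s) : G ≃* S :=
  MulEquiv.ofBijective (f.codRestrict S hf)
    ⟨fun _ _ h => hinj (congrArg Subtype.val h), fun s =>
      (hsurj s s.2).imp fun _ hg => Subtype.ext hg⟩

/-- A finite T1 space is discrete, so continuity is automatic in both directions. -/
theorem nonempty_continuousMulEquiv [TopologicalSpace G'] [T1Space G'] [TopologicalSpace G]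
    [DiscreteTopology G] [Finite G] {S : Subgroup G'} (e : G ≃* S) : Nonempty (S ≃ₜ* G) := by
  have : Finite S := Finite.of_equiv _ e.toEquiv
  exact ⟨{ e.symm with
    continuous_toFun := continuous_of_discreteTopology
    continuous_invFun := continuous_of_discreteTopology }⟩

end Subgroup

theorem eq_of_map_edge_eq {H : Type*} [AddCommGroup H] {μ : NormalizedTwoCocycle H}
    {χ : AddChar H Circle} {α α' : AutVN (bernoulliVN μ)} (hα : α ∈ bernoulliCentralizer μ χ)
    (hα' : α' ∈ bernoulliCentralizer μ χ) (h : ∀ h, α (bernoulliUnitary μ (edge h)) =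
      α' (bernoulliUnitary μ (edge h))) : α = α' := by
  refine inv_mul_eq_one.1 (eq_one_of_map_edge (mul_mem (inv_mem hα) hα') fun h' => ?_)
  change α.symm (α' _) = _
  rw [← h h']
  exact α.symm_apply_apply _

/-! ### Shears as automorphisms commuting with the action. -/

section ShearAut

variable {q : ℕ} [NeZero q]

variable (q) in
/-- The unitary representation `δ_l ↦ exp(2πi c ½ ∑_k s_k² / q) δ_{c · l}` of `ℤ/qℤ` implementing
the shear automorphisms. -/
def shearRep : Multiplicative (ZMod q) →*
    unitary (EllTwo (LambdaGroup (HGroup q)) →L[ℂ] EllTwo (LambdaGroup (HGroup q))) :=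
  MonoidHom.mk'
    (fun c => weightedUnitary (shearPerm c.toAdd) fun l => ZMod.toCircle (c.toAdd * halfSquare l))
    (fun c d => by
      rw [weightedUnitary_mul]
      congr 1
      · exact Equiv.ext fun l => (shearMap_shearMap c.toAdd d.toAdd l).symm
      · funext l
        change _ = ZMod.toCircle (c.toAdd * halfSquare (shearMap d.toAdd l)) * _
        rw [halfSquare_shearMap, ← AddChar.map_add_eq_mul, ← add_mul, toAdd_mul])

theorem shearRep_basisVec (c : Multiplicative (ZMod q)) (l : LambdaGroup (HGroup q)) :
    (shearRep q c : EllTwo (LambdaGroup (HGroup q)) →L[ℂ] EllTwo (LambdaGroup (HGroup q)))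
        (basisVec l) =
      (ZMod.toCircle (c.toAdd * halfSquare l) : ℂ) • basisVec (shearMap c.toAdd l) :=
  weightedUnitary_basisVec _ _ l

theorem shearRep_conj (hodd : Odd q) (c : Multiplicative (ZMod q)) (l : LambdaGroup (HGroup q)) :
    (shearRep q c : EllTwo (LambdaGroup (HGroup q)) →L[ℂ] EllTwo (LambdaGroup (HGroup q))) *
        twistedTranslation (cocycleTilde (muCocycle q)) l *
        star (shearRep q c :
          EllTwo (LambdaGroup (HGroup q)) →L[ℂ] EllTwo (LambdaGroup (HGroup q))) =
      (ZMod.toCircle (c.toAdd * halfSquare l) : ℂ) •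
        (twistedTranslation (cocycleTilde (muCocycle q)) (shearMap c.toAdd l) :
          EllTwo (LambdaGroup (HGroup q)) →L[ℂ] EllTwo (LambdaGroup (HGroup q))) := by
  have key : (shearRep q c :
        EllTwo (LambdaGroup (HGroup q)) →L[ℂ] EllTwo (LambdaGroup (HGroup q))) *
        twistedTranslation (cocycleTilde (muCocycle q)) l =
      (ZMod.toCircle (c.toAdd * halfSquare l) : ℂ) •
        ((twistedTranslation (cocycleTilde (muCocycle q)) (shearMap c.toAdd l) :
          EllTwo (LambdaGroup (HGroup q)) →L[ℂ] EllTwo (LambdaGroup (HGroup q))) *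
          shearRep q c) := by
    refine clm_ext_basisVec fun x => ?_
    rw [mul_apply_eq_comp, smul_apply, mul_apply_eq_comp, twistedTranslation_basisVec,
      shearRep_basisVec, map_smul, map_smul, shearRep_basisVec, twistedTranslation_basisVec,
      smul_smul, smul_smul, smul_smul]
    rw [shearMap_add]
    congr 1
    rw [← Circle.coe_mul, ← Circle.coe_mul, ← Circle.coe_mul]
    congr 1
    rw [cocycleTilde_eq, cocycleTilde_eq, mul_comm, ← AddChar.map_add_eq_mul,
      ← AddChar.map_add_eq_mul, ← AddChar.map_add_eq_mul, halfSquare_add hodd]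
  have hs : (shearRep q c :
        EllTwo (LambdaGroup (HGroup q)) →L[ℂ] EllTwo (LambdaGroup (HGroup q))) *
      star (shearRep q c :
        EllTwo (LambdaGroup (HGroup q)) →L[ℂ] EllTwo (LambdaGroup (HGroup q))) = 1 :=
    Unitary.coe_mul_star_self _
  rw [key, smul_mul_assoc, mul_assoc, hs, mul_one]

/-- The action of `ℤ/qℤ` on `N(H_q, μ_q)` by shear automorphisms. -/
def shearAut (hodd : Odd q) : Multiplicative (ZMod q) →* AutVN (bernoulliVN (muCocycle q)) :=
  conjAction (bernoulliVN (muCocycle q)) (shearRep q) fun c _ hx =>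
    conj_mem_vnGenerated _ (shearRep q c) (by
      rintro _ ⟨l, rfl⟩
      beta_reduce
      rw [shearRep_conj hodd]
      exact (vnGenerated _).toStarSubalgebra.smul_mem
        (subset_vnGenerated _ (Set.mem_range_self _)) _) hx

theorem shearAut_bernoulliUnitary (hodd : Odd q) (c : Multiplicative (ZMod q))
    (l : LambdaGroup (HGroup q)) :
    shearAut hodd c (bernoulliUnitary (muCocycle q) l) =
      (ZMod.toCircle (c.toAdd * halfSquare l) : ℂ) •
        bernoulliUnitary (muCocycle q) (shearMap c.toAdd l) :=
  Subtype.ext (shearRep_conj hodd c l)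

theorem shearAut_edge (hodd : Odd q) (c : Multiplicative (ZMod q)) (h : HGroup q) :
    shearAut hodd c (bernoulliUnitary (muCocycle q) (edge h)) =
      (ZMod.toCircle (c.toAdd * (h.1 * h.1)) : ℂ) •
        bernoulliUnitary (muCocycle q) (edge (shear c.toAdd h)) := by
  rw [shearAut_bernoulliUnitary, halfSquare_edge hodd, edge, shearMap_dipole, edge]

/-- The character depends only on the first coordinate, which shears leave alone; this is why they
commute with the action. -/
theorem actionPhase_shearMap (g : AffineSL) (c : ZMod q) (l : LambdaGroup (HGroup q)) :
    actionPhase (chiChar q) g (shearMap c l) = actionPhase (chiChar q) g l := by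
  rw [actionPhase_eq, actionPhase_eq]
  rfl

theorem shiftRep_mul_shearRep (g : AffineSL) (c : Multiplicative (ZMod q)) :
    shiftRep (chiChar q) g * shearRep q c = shearRep q c * shiftRep (chiChar q) g := by
  change weightedUnitary _ _ * weightedUnitary _ _ = weightedUnitary _ _ * weightedUnitary _ _
  rw [weightedUnitary_mul, weightedUnitary_mul]
  congr 1
  · exact Equiv.ext fun l => permute_shearMap _ _ l
  · funext l
    change actionPhase (chiChar q) g (shearMap c.toAdd l) * _ =
      ZMod.toCircle (c.toAdd * halfSquare (permute (affinePerm g) l)) * _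
    rw [actionPhase_shearMap, halfSquare_permute, mul_comm]

theorem shearAut_mem_bernoulliCentralizer (hodd : Odd q) (c : Multiplicative (ZMod q)) :
    shearAut hodd c ∈ bernoulliCentralizer (muCocycle q) (chiChar q) := by
  rw [mem_bernoulliCentralizer_iff]
  intro g x
  refine Subtype.ext ?_
  exact mul_conj_comm (congrArg Subtype.val (shiftRep_mul_shearRep g c).symm) _

theorem bernoulliVN_one_smul {H : Type*} [AddCommGroup H] {μ : NormalizedTwoCocycle H}
    (x : (bernoulliVN μ).toStarSubalgebra) : (1 : ℂ) • x = x := one_smul ℂ x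

/-- The parameter `c` is read off from the image of the edge labelled (1,0), namely the edge
labelled `(1, c)`. -/
theorem shearAut_injective (hodd : Odd q) : Function.Injective (shearAut hodd) := by
  refine (injective_iff_map_eq_one _).2 fun c hc => ?_
  have h1 := shearAut_edge hodd c (1, 0)
  rw [hc] at h1
  have h2 := smul_bernoulliUnitary_inj one_ne_zero ((bernoulliVN_one_smul _).trans h1)
  have h3 := congrArg Prod.snd (edge_injective h2.1)
  rw [shear_snd, zero_add, mul_one] at h3
  exact toAdd_eq_zero.1 h3.symm

/-! ### Rigidity -/

/-- The linear term comes from the character, the quadratic one from the common vertex (1,0), where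
the two edges take the values `-h` and `h`. -/
theorem trianglePhase_muCocycle (h : HGroup q) :
    trianglePhase (muCocycle q) (chiChar q) h = ZMod.toCircle (-h.1 - h.1 * h.2) := by
  have hne : (0 : Lattice) ≠ ![1, 0] := fun h => by simpa using congrFun h 0
  have hne' : (![1, 0] : Lattice) ≠ ![1, 1] := fun h => by simpa using congrFun h 1
  have hne'' : (0 : Lattice) ≠ ![1, 1] := fun h => by simpa using congrFun h 1
  rw [trianglePhase, cocycleTilde_eq, edge, pairing_dipole_left, dipole_apply_left _ hne',
    dipole_apply_of_ne _ hne hne'']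
  change (ZMod.toCircle h.1)⁻¹ * _ = _
  rw [← AddChar.map_neg_eq_inv, ← AddChar.map_add_eq_mul]
  congr 1
  simp [sub_eq_add_neg]

variable {α : AutVN (bernoulliVN (muCocycle q))}

theorem map_edge_coeff (hα : α ∈ bernoulliCentralizer (muCocycle q) (chiChar q)) {h h' : HGroup q}
    {a : ℂ} (ha : a ≠ 0) (hh : α (bernoulliUnitary (muCocycle q) (edge h)) =
      a • bernoulliUnitary (muCocycle q) (edge h')) :
    a = ZMod.toCircle (h'.1 + h'.1 * h'.2 - h.1 - h.1 * h.2) := by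
  have h1 := map_edge_phase hα ha hh
  rw [trianglePhase_muCocycle, trianglePhase_muCocycle] at h1
  refine mul_right_cancel₀ (Circle.coe_ne_zero (ZMod.toCircle (-h'.1 - h'.1 * h'.2))) ?_
  rw [h1, ← Circle.coe_mul, ← AddChar.map_add_eq_mul]
  congr 2
  ring

/-- By the half-turn, `h` and `-h` have the same coefficient `a`. In the formula for `a` the terms
`s t` are even and the terms `s` odd, so comparison leaves `2 (h'.1 - h.1) = 0`. -/
theorem map_edge_fst (hodd : Odd q) (hα : α ∈ bernoulliCentralizer (muCocycle q) (chiChar q))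
    {h h' : HGroup q} {a : ℂ} (ha : a ≠ 0) (hh : α (bernoulliUnitary (muCocycle q) (edge h)) =
      a • bernoulliUnitary (muCocycle q) (edge h')) : h'.1 = h.1 := by
  have h1 := (map_edge_coeff hα ha hh).symm.trans (map_edge_coeff hα ha (map_edge_neg hα hh))
  have h2 := ZMod.injective_toCircle (Circle.coe_injective h1)
  simp only [Prod.fst_neg, Prod.snd_neg] at h2
  refine sub_eq_zero.1 (eq_zero_of_two_mul_eq_zero hodd ?_)
  linear_combination h2

theorem map_edge_symplectic (hodd : Odd q) {h₁ h₂ k₁ k₂ : HGroup q} {a₁ a₂ : ℂ}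
    (ha₁ : a₁ ≠ 0) (ha₂ : a₂ ≠ 0)
    (hh₁ : α (bernoulliUnitary (muCocycle q) (edge h₁)) =
      a₁ • bernoulliUnitary (muCocycle q) (edge k₁))
    (hh₂ : α (bernoulliUnitary (muCocycle q) (edge h₂)) =
      a₂ • bernoulliUnitary (muCocycle q) (edge k₂)) :
    k₁.1 * k₂.2 - k₂.1 * k₁.2 = h₁.1 * h₂.2 - h₂.1 * h₁.2 := by
  have h := map_edge_comm ha₁ ha₂ hh₁ hh₂
  simp only [cocycleTilde_eq, ← AddChar.map_add_eq_mul, pairing_edge] at h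
  have h' := ZMod.injective_toCircle h
  refine sub_eq_zero.1 (eq_zero_of_two_mul_eq_zero hodd ?_)
  linear_combination h'

/-- The image of (1,0) is some `(1, c)`, and preservation of the symplectic form against it forces
every `(s, t)` to go to `(s, t + c s)`. The formula for the coefficient then gives exactly the phase
`c s²` of the shear automorphism. -/
theorem exists_shearAut_eq (hodd : Odd q)
    (hα : α ∈ bernoulliCentralizer (muCocycle q) (chiChar q)) : ∃ c, shearAut hodd c = α := by
  obtain ⟨k, b, hb, hk⟩ := exists_map_edge hα (1, 0)
  have hk1 := map_edge_fst hodd hα hb hk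
  refine ⟨Multiplicative.ofAdd k.2, ?_⟩
  have hedge : ∀ h, α (bernoulliUnitary (muCocycle q) (edge h)) =
      shearAut hodd (Multiplicative.ofAdd k.2) (bernoulliUnitary (muCocycle q) (edge h)) := by
    intro h
    obtain ⟨h', a, ha, hh⟩ := exists_map_edge hα h
    have h1 := map_edge_fst hodd hα ha hh
    have h2 := map_edge_symplectic hodd hb ha hk hh
    rw [hk1, h1] at h2
    have h3 : h' = shear k.2 h := by
      refine Prod.ext h1 ?_
      rw [shear_snd]
      linear_combination h2
    have h4 : a = (ZMod.toCircle (k.2 * (h.1 * h.1)) : ℂ) := by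
      rw [map_edge_coeff hα ha hh, h3, shear_fst, shear_snd]
      congr 2
      ring
    rw [h3, h4] at hh
    exact hh.trans (shearAut_edge hodd (Multiplicative.ofAdd k.2) h).symm
  exact eq_of_map_edge_eq (shearAut_mem_bernoulliCentralizer hodd _) hα fun h => (hedge h).symm

/-- The shear automorphisms exhaust the centralizer. -/
def shearEquiv (hodd : Odd q) :
    Multiplicative (ZMod q) ≃* bernoulliCentralizer (muCocycle q) (chiChar q) :=
  mulEquivSubgroup (shearAut hodd) _ (shearAut_mem_bernoulliCentralizer hodd)
    (shearAut_injective hodd) fun _ hα => exists_shearAut_eq hodd hα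

end ShearAut

/-- The topology is induced by evaluation at `δ_0`, which is injective because `δ_0` is separating.
-/
theorem t2Space_autVN {Γ : Type*} [AddCommGroup Γ] (μ : NormalizedTwoCocycle Γ) :
    T2Space (AutVN (twistedGroupVN μ)) :=
  T2Space.of_injective_continuous (f := fun (α : AutVN (twistedGroupVN μ))
      (x : (twistedGroupVN μ).toStarSubalgebra) =>
      ((α x : (twistedGroupVN μ).toStarSubalgebra) : EllTwo Γ →L[ℂ] EllTwo Γ) (basisVec 0))
    (fun α α' h => StarAlgEquiv.ext fun x => Subtype.ext
      (eq_of_apply_basisVec_zero (α x).2 (α' x).2 (congrFun h x)))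
    continuous_induced_dom

theorem nonempty_bernoulliCentralizer_equiv {q : ℕ} [NeZero q] (hodd : Odd q) :
    Nonempty (bernoulliCentralizer (muCocycle q) (chiChar q) ≃ₜ* Multiplicative (ZMod q)) := by
  have : T2Space (AutVN (bernoulliVN (muCocycle q))) :=
    t2Space_autVN (cocycleTilde (muCocycle q))
  exact nonempty_continuousMulEquiv (shearEquiv hodd)

end TwistedBernoulli

end

theorem corollary5p8 (q : ℕ) [NeZero q] (hq : 3 ≤ q) (hodd : Odd q) :
    TwistedBernoulli.IsAFDFactorIIOne
        (TwistedBernoulli.bernoulliVN (TwistedBernoulli.muCocycle q)) ∧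
      Nonempty
        (TwistedBernoulli.bernoulliCentralizer (TwistedBernoulli.muCocycle q)
            (TwistedBernoulli.chiChar q) ≃ₜ* Multiplicative (ZMod q)) :=
  ⟨⟨TwistedBernoulli.isFactor_bernoulliVN, TwistedBernoulli.isTypeIIOne_bernoulliVN hq,
    TwistedBernoulli.isAFD_bernoulliVN _⟩,
    TwistedBernoulli.nonempty_bernoulliCentralizer_equiv hodd⟩
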